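/- Let $n\ge 1$ and let $\mathbf{H}_n=\mathbb{R}^{2n+1}$ be the Heisenberg group with group law $(x,y,\tau)\circ(x',y',\tau')=\big(x+x',\,y+y',\,\tau+\tau'+\tfrac12(x\cdot y'-x'\cdot y)\big)$, with Lebesgue measure, left-invariant vector fields $X_j=\partial_{x_j}-\tfrac{y_j}{2}\partial_\tau$, $Y_j=\partial_{y_j}+\tfrac{x_j}{2}\partial_\tau$ ($1\le j\le n$), sub-Laplacian $\Delta_H=\sum_{j=1}^n(X_j^2+Y_j^2)$, horizontal gradient $\nabla_H v=(X_1v,\dots,X_nv,Y_1v,\dots,Y_nv)$ and homogeneous dimension $Q=2n+2$. Let $H^1(\mathbf{H}_n)$ be the space of real-valued $v\in L^2(\mathbf{H}_n)$ whose distributional derivatives $X_jv,Y_jv$ all belong to $L^2(\mathbf{H}_n)$, with $\|v\|_{H^1}=\|v\|_{L^2}+\|\nabla_H v\|_{L^2}$. There is a constant $C>0$, depending only on $n$, such that the following holds. Let $(u_0,u_1)\in H^1(\mathbf{H}_n)\times L^2(\mathbf{H}_n)$ and let $u\in\mathcal{C}([0,\infty),H^1(\mathbf{H}_n))\cap\mathcal{C}^1([0,\infty),L^2(\mathbf{H}_n))$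 solve, in the sense of distributions, the damped wave equation $\partial_t^2u-\Delta_Hu+\partial_tu=0$ for $t>0$ with $u(0)=u_0$, $\partial_tu(0)=u_1$. Then for all $t\ge 0$ $$\|u(t)\|_{L^2}\le C\big(\|u_0\|_{L^2}+\|u_1\|_{L^2}\big),$$ $$\|\nabla_Hu(t)\|_{L^2}\le C(1+t)^{-1/2}\big(\|u_0\|_{H^1}+\|u_1\|_{L^2}\big),$$ $$\|\partial_tu(t)\|_{L^2}\le C(1+t)^{-1}\big(\|u_0\|_{H^1}+\|u_1\|_{L^2}\big).$$ If in addition $u_0,u_1\in L^1(\mathbf{H}_n)$, then for all $t\ge0$ $$\|u(t)\|_{L^2}\le C(1+t)^{-Q/4}\big(\|u_0\|_{L^1}+\|u_0\|_{L^2}+\|u_1\|_{L^1}+\|u_1\|_{L^2}\big),$$ $$\|\nabla_Hu(t)\|_{L^2}\le C(1+t)^{-Q/4-1/2}\big(\|u_0\|_{L^1}+\|\nabla_Hu_0\|_{L^2}+\|u_1\|_{L^1}+\|u_1\|_{L^2}\big),$$ $$\|\partial_tu(t)\|_{L^2}\le C(1+t)^{-Q/4-1}\big(\|u_0\|_{L^1}+\|\nabla_Hu_0\|_{L^2}+\|u_1\|_{L^1}+\|u_1\|_{L^2}\big).$$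 -/

import Mathlib

open MeasureTheory Set
open scoped ContDiff

noncomputable section

namespace Heisenberg

/-- The underlying space `ℝⁿ × ℝⁿ × ℝ` of the Heisenberg group, with points `(x, y, τ)`. Its `volume`
is Lebesgue measure, which is the Haar measure of the group law `mul`. -/
abbrev H (n : ℕ) : Type := (Fin n → ℝ) × (Fin n → ℝ) × ℝ

/-- The group law
`(x, y, τ) ∘ (x', y', τ') = (x + x', y + y', τ + τ' + (x ⬝ y' - x' ⬝ y) / 2)`. -/
def mul {n : ℕ} (p q : H n) : H n :=
  (p.1 + q.1, p.2.1 + q.2.1,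
    p.2.2 + q.2.2 + (1 / 2) * ((∑ j, p.1 j * q.2.1 j) - ∑ j, q.1 j * p.2.1 j))

/-- The coefficient field of `X_j = ∂_{x_j} - (y_j / 2) ∂_τ`. -/
def vecX {n : ℕ} (j : Fin n) (p : H n) : H n := (Pi.single j 1, 0, -(p.2.1 j / 2))

/-- The coefficient field of `Y_j = ∂_{y_j} + (x_j / 2) ∂_τ`. -/
def vecY {n : ℕ} (j : Fin n) (p : H n) : H n := (0, Pi.single j 1, p.1 j / 2)

/-- `X_j` is the left-invariant vector field generated by the `j`-th `x`-direction. -/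
theorem hasDerivAt_mul_x {n : ℕ} (j : Fin n) (p : H n) :
    HasDerivAt (fun s : ℝ => mul p (s • (Pi.single j 1, 0, 0))) (vecX j p) 0 := by
  have e : (fun s : ℝ => mul p (s • (Pi.single j 1, 0, 0))) = fun s : ℝ => p + s • vecX j p := by
    funext s
    refine Prod.ext rfl (Prod.ext rfl ?_)
    simp [mul, vecX, Pi.single_apply]
    ring
  rw [e]
  simpa using ((hasDerivAt_id (0 : ℝ)).smul_const (vecX j p)).const_add p

/-- `Y_j` is the left-invariant vector field generated by the `j`-th `y`-direction. -/
theorem hasDerivAt_mul_y {n : ℕ} (j : Fin n) (p : H n) :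
    HasDerivAt (fun s : ℝ => mul p (s • (0, Pi.single j 1, 0))) (vecY j p) 0 := by
  have e : (fun s : ℝ => mul p (s • (0, Pi.single j 1, 0))) = fun s : ℝ => p + s • vecY j p := by
    funext s
    refine Prod.ext rfl (Prod.ext rfl ?_)
    simp [mul, vecY, Pi.single_apply]
    ring
  rw [e]
  simpa using ((hasDerivAt_id (0 : ℝ)).smul_const (vecY j p)).const_add p

/-- The first order differential operator on functions given by the vector field `Z`. -/
def along {n : ℕ} (Z : H n → H n) (φ : H n → ℝ) : H n → ℝ := fun p => fderiv ℝ φ p (Z p)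

/-- The sub-Laplacian `∑_j (X_j² + Y_j²)`, acting on smooth functions. -/
def subLaplacian {n : ℕ} (φ : H n → ℝ) : H n → ℝ := fun p =>
  ∑ j, (along (vecX j) (along (vecX j) φ) p + along (vecY j) (along (vecY j) φ) p)

/-- Real-valued `L²` on the Heisenberg group. -/
abbrev L2 (n : ℕ) : Type := Lp ℝ 2 (volume : Measure (H n))

/-- Test functions: smooth with compact support. -/
def IsTest {n : ℕ} (φ : H n → ℝ) : Prop := ContDiff ℝ ∞ φ ∧ HasCompactSupport φ

/-- `Z v = w` in the sense of distributions, for `Z` one of the fields `X_j`, `Y_j`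
(whose formal adjoint is `-Z`). -/
def IsWeakDeriv {n : ℕ} (Z : H n → H n) (v w : L2 n) : Prop :=
  ∀ φ : H n → ℝ, IsTest φ → ∫ p, w p * φ p = ∫ p, v p * (-along Z φ p)

/-- Weak derivatives in `L²` are unique, so that `weakDeriv` below is well defined. -/
theorem IsWeakDeriv.unique {n : ℕ} {Z : H n → H n} {v w w' : L2 n}
    (h : IsWeakDeriv Z v w) (h' : IsWeakDeriv Z v w') : w = w' := by
  have hl : ∀ f : L2 n, LocallyIntegrable f volume := fun f =>
    (Lp.memLp f).locallyIntegrable (by norm_num)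
  have key := ae_eq_zero_of_integral_contDiff_smul_eq_zero (μ := (volume : Measure (H n)))
    (f := fun p => w p - w' p) ((hl w).sub (hl w')) (fun g hg hc => by
      have i : ∀ f : L2 n, Integrable (fun p => f p * g p) volume := fun f => by
        simpa [mul_comm] using (hl f).integrable_smul_right_of_hasCompactSupport hg.continuous hc
      have e := (h g ⟨hg, hc⟩).trans (h' g ⟨hg, hc⟩).symm
      have : (fun p => g p • (w p - w' p)) = fun p => w p * g p - w' p * g p := by
        funext p; simp only [smul_eq_mul]; ring
      rw [this, integral_sub (i w) (i w'), e, sub_self])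
  refine Lp.ext ?_
  filter_upwards [key] with p hp using sub_eq_zero.mp hp

open Classical in
/-- The weak derivative `Z v`, if it exists in `L²`, and `0` otherwise. -/
def weakDeriv {n : ℕ} (Z : H n → H n) (v : L2 n) : L2 n :=
  if h : ∃ w, IsWeakDeriv Z v w then h.choose else 0

/-- `v ∈ H¹`: all the weak derivatives `X_j v`, `Y_j v` exist in `L²`. -/
def MemH1 {n : ℕ} (v : L2 n) : Prop :=
  ∀ j, (∃ w, IsWeakDeriv (vecX j) v w) ∧ ∃ w, IsWeakDeriv (vecY j) v w

/-- The `L²` norm of the horizontal gradient of `v ∈ H¹`. -/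
def gradNorm {n : ℕ} (v : L2 n) : ℝ :=
  Real.sqrt (∑ j, (‖weakDeriv (vecX j) v‖ ^ 2 + ‖weakDeriv (vecY j) v‖ ^ 2))

/-- The `L¹` norm (used only for integrable `v`). -/
def L1norm {n : ℕ} (v : L2 n) : ℝ := ∫ p, |v p|

/-- The time derivative of `u` on `[0, ∞)` (one-sided at `0`), as an `L²`-valued function. -/
def dt {n : ℕ} (u : ℝ → L2 n) (t : ℝ) : L2 n := derivWithin u (Ici 0) t

/-- `u ∈ C([0,∞), H¹) ∩ C¹([0,∞), L²)`; continuity into `H¹` means that `u` and all the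
`X_j u`, `Y_j u` are continuous into `L²`. -/
structure EnergyClass {n : ℕ} (u : ℝ → L2 n) : Prop where
  memH1 : ∀ t, 0 ≤ t → MemH1 (u t)
  contX : ∀ j, ContinuousOn (fun t => weakDeriv (vecX j) (u t)) (Ici 0)
  contY : ∀ j, ContinuousOn (fun t => weakDeriv (vecY j) (u t)) (Ici 0)
  diff : DifferentiableOn ℝ u (Ici 0)
  cont_dt : ContinuousOn (dt u) (Ici 0)

/-- `u` solves `∂ₜ² u - Δ_H u + ∂ₜ u = 0` for `t > 0`, with `u(0) = u₀`, `∂ₜ u(0) = u₁`. The equation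
holds in the sense of distributions on the group: for each test function `φ`,
`d/dt ⟨∂ₜ u, φ⟩ = ⟨u, Δ_H φ⟩ - ⟨∂ₜ u, φ⟩`. -/
structure IsSolution {n : ℕ} (u₀ u₁ : L2 n) (u : ℝ → L2 n) : Prop where
  energy : EnergyClass u
  equation : ∀ φ : H n → ℝ, IsTest φ → ∀ t, 0 < t →
    HasDerivAt (fun s => ∫ p, dt u s p * φ p)
      ((∫ p, u t p * subLaplacian φ p) - ∫ p, dt u t p * φ p) t
  init : u 0 = u₀
  init_dt : dt u 0 = u₁

/-- The homogeneous dimension `Q = 2n + 2`. -/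
def Q (n : ℕ) : ℝ := 2 * n + 2

end Heisenberg

end

/-!
Multiplying the equation by the resolvent `(1 + A)⁻¹`, where `A = -Δ_H` is given by its form domain
`H¹`, leaves only bounded operators: `D = A (1 + A)⁻¹` is a positive contraction, and
`d/dt ((1 - D) u') = -D u - (1 - D) u'`. At time `t`, weight the energy of this equation by
`D ^ j exp (-(T - t) D / 2)`. The resulting inequality bounds the solution at time `T` by the heat
semigroup of `D`, at a time proportional to `T`, acting on the initial data, and each power of `D`
gains a factor `1 / T`. Summing over `j` turns the estimates for `D` into estimates for the form of
`A`. The weak equation, which only involves test functions, holds in this form because test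
functions are dense in `H¹`: mollified elements of their orthogonal complement are square-integrable
solutions of `Δ_H W = W`, which vanish by Caccioppoli's inequality.

For integrable data the heat semigroup decays by the Nash inequality. Averaging over right
translates in a box of size `r` costs `r ‖∇_H f‖`, because the center of the group is reached by
commutators of horizontal translations, and gains `r ^ (-Q / 2) ‖f‖_{L¹}`. The semigroup contracts
`L¹` because it is an average of powers of the resolvent, and the resolvent preserves the bound
`|f| ≤ 1` because truncating decreases the form.
-/

namespace DampedWave

open Filter
open scoped RealInnerProductSpace Topology

/-! ### Positive contractions and their heat semigroups -/

section PositiveContraction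

variable {E : Type*} [NormedAddCommGroup E] [InnerProductSpace ℝ E]

/-- A positive contraction of a Hilbert space: `0 ≤ D ≤ 1` in the sense of quadratic forms. The
example to keep in mind is `D = A (1 + A)⁻¹` for an unbounded positive operator `A`. -/
structure IsPositiveContraction (D : E →L[ℝ] E) : Prop where
  isPositive : D.IsPositive
  one_sub_isPositive : (1 - D).IsPositive

/-- The semigroup `exp (-t D)` generated by the bounded operator `-D`. -/
noncomputable def heat (D : E →L[ℝ] E) (t : ℝ) : E →L[ℝ] E := NormedSpace.exp (t • -D)

/-- The quadratic form of `D ^ j * exp (-t D)`. -/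
noncomputable def heatForm (D : E →L[ℝ] E) (j : ℕ) (t : ℝ) (x : E) : ℝ := ⟪(D ^ j * heat D t) x, x⟫

variable {D : E →L[ℝ] E}

@[simp]
theorem heat_zero (D : E →L[ℝ] E) : heat D 0 = 1 := by simp [heat]

theorem commute_heat {M : E →L[ℝ] E} (h : Commute M D) (t : ℝ) : Commute M (heat D t) :=
  (h.neg_right.smul_right t).exp_right

theorem heatForm_at_zero (D : E →L[ℝ] E) (j : ℕ) (x : E) :
    heatForm D j 0 x = ⟪(D ^ j) x, x⟫ := by
  simp [heatForm]

theorem heatForm_zero_zero (D : E →L[ℝ] E) (x : E) : heatForm D 0 0 x = ‖x‖ ^ 2 := by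
  simp [heatForm_at_zero]

theorem heatForm_add_add_heatForm_sub (D : E →L[ℝ] E) (j : ℕ) (t : ℝ) (x y : E) :
    heatForm D j t (x + y) + heatForm D j t (x - y) =
      2 * heatForm D j t x + 2 * heatForm D j t y := by
  simp only [heatForm, map_add, map_sub, inner_add_left, inner_add_right, inner_sub_left,
    inner_sub_right]
  ring

theorem heatForm_one_sub (D : E →L[ℝ] E) (j : ℕ) (t : ℝ) (x : E) :
    ⟪(D ^ j * (1 - D) * heat D t) x, x⟫ = heatForm D j t x - heatForm D (j + 1) t x := by
  rw [heatForm, heatForm, ← inner_sub_left, ← sub_apply, mul_sub, sub_mul, mul_one, pow_succ]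

theorem sum_heatForm_sub_succ (D : E →L[ℝ] E) (k N : ℕ) (t : ℝ) (x : E) :
    ∑ i ∈ Finset.range N, (heatForm D (k + i) t x - heatForm D (k + i + 1) t x) =
      heatForm D k t x - heatForm D (k + N) t x :=
  Finset.sum_range_sub' (fun i => heatForm D (k + i) t x) N

namespace IsPositiveContraction

theorem one_sub (hD : IsPositiveContraction D) : IsPositiveContraction (1 - D) :=
  ⟨hD.one_sub_isPositive, by simpa using hD.isPositive⟩

theorem inner_apply_le (hD : IsPositiveContraction D) (x : E) : ⟪D x, x⟫ ≤ ‖x‖ ^ 2 := by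
  simpa [inner_sub_left] using hD.one_sub_isPositive.inner_nonneg_left x

theorem norm_sq_apply_eq_heatForm (hD : IsPositiveContraction D) (x : E) :
    ‖D x‖ ^ 2 = heatForm D 2 0 x := by
  rw [heatForm_at_zero, pow_two D, mul_apply_eq_comp, hD.isPositive.isSymmetric.apply_clm,
    real_inner_self_eq_norm_sq]

end IsPositiveContraction

variable [CompleteSpace E]

theorem isPositive_conj {S T : E →L[ℝ] E} (hS : IsSelfAdjoint S) (hT : T.IsPositive) :
    (S * T * S).IsPositive := by
  have h := hT.conj_adjoint S
  rwa [hS.adjoint_eq] at h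

theorem isPositive_pow_mul {M : E →L[ℝ] E} (hD : IsSelfAdjoint D) (hc : Commute D M)
    (h0 : M.IsPositive) (h1 : (D * M).IsPositive) (a : ℕ) : (D ^ a * M).IsPositive := by
  induction a using Nat.twoStepInduction with
  | zero => simpa using h0
  | one => simpa using h1
  | more a ih _ =>
    have h_conj : D ^ (a + 2) * M = D * (D ^ a * M) * D := by
      rw [mul_assoc, mul_assoc, ← hc.eq, ← mul_assoc (D ^ a), ← pow_succ, ← mul_assoc, ← pow_succ']
    exact h_conj ▸ isPositive_conj hD ih

theorem heat_add (D : E →L[ℝ] E) (s t : ℝ) : heat D (s + t) = heat D s * heat D t := by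
  let _ := NormedAlgebra.restrictScalars ℚ ℝ (E →L[ℝ] E)
  rw [heat, add_smul, NormedSpace.exp_add_of_commute]
  · rfl
  · exact ((Commute.refl (-D)).smul_left s).smul_right t

theorem isSelfAdjoint_heat (hD : IsSelfAdjoint D) (t : ℝ) : IsSelfAdjoint (heat D t) :=
  ((IsSelfAdjoint.all t).smul hD.neg).exp

theorem hasDerivAt_heat (D : E →L[ℝ] E) (t : ℝ) : HasDerivAt (heat D) (-(D * heat D t)) t := by
  rw [← neg_mul]
  exact hasDerivAt_exp_smul_const' (𝕂 := ℝ) (-D) t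

theorem hasDerivAt_heatForm (D : E →L[ℝ] E) (j : ℕ) (t : ℝ) (x : E) :
    HasDerivAt (fun t => heatForm D j t x) (-heatForm D (j + 1) t x) t := by
  have h := (((hasDerivAt_heat D t).const_mul (D ^ j)).clm_apply (hasDerivAt_const t x)).inner ℝ
    (hasDerivAt_const t x)
  refine h.congr_deriv ?_
  simp [heatForm, pow_succ]

namespace IsPositiveContraction

theorem isSelfAdjoint (hD : IsPositiveContraction D) : IsSelfAdjoint D :=
  hD.isPositive.isSelfAdjoint

-- `D (1 - D) = D (1 - D) D + (1 - D) D (1 - D)`.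
theorem mul_one_sub_isPositive (hD : IsPositiveContraction D) : (D * (1 - D)).IsPositive := by
  have h_split : D * (1 - D) = D * (1 - D) * D + (1 - D) * D * (1 - D) := by noncomm_ring
  rw [h_split]
  exact (isPositive_conj hD.isSelfAdjoint hD.one_sub_isPositive).add
    (isPositive_conj hD.one_sub.isSelfAdjoint hD.isPositive)

theorem norm_sq_apply_le_inner (hD : IsPositiveContraction D) (x : E) : ‖D x‖ ^ 2 ≤ ⟪D x, x⟫ := by
  have h := hD.mul_one_sub_isPositive.inner_nonneg_left x
  simp only [mul_apply_eq_comp, sub_apply, one_apply_eq_self, map_sub, inner_sub_left] at h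
  rw [hD.isPositive.isSymmetric.apply_clm (D x) x, real_inner_self_eq_norm_sq] at h
  linarith

theorem norm_apply_le (hD : IsPositiveContraction D) (x : E) : ‖D x‖ ≤ ‖x‖ :=
  le_of_sq_le_sq ((hD.norm_sq_apply_le_inner x).trans (hD.inner_apply_le x)) (norm_nonneg x)

theorem pow_mul_one_sub_pow_isPositive (hD : IsPositiveContraction D) (a b : ℕ) :
    (D ^ a * (1 - D) ^ b).IsPositive := by
  have hc : Commute D (1 - D) := (Commute.one_right D).sub_right (Commute.refl D)
  refine isPositive_pow_mul hD.isSelfAdjoint (hc.pow_right b) ?_ ?_ a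
  · simpa using isPositive_pow_mul hD.one_sub.isSelfAdjoint (Commute.one_right _)
      ContinuousLinearMap.isPositive_one (by simpa using hD.one_sub_isPositive) b
  · rw [(hc.pow_right b).eq]
    exact isPositive_pow_mul hD.one_sub.isSelfAdjoint hc.symm hD.isPositive
      (hc.eq ▸ hD.mul_one_sub_isPositive) b

theorem pow_mul_one_sub_pow_mul_heat_isPositive (hD : IsPositiveContraction D) (a b : ℕ) (t : ℝ) :
    (D ^ a * (1 - D) ^ b * heat D t).IsPositive := by
  have hc : Commute (D ^ a * (1 - D) ^ b) D :=
    ((Commute.refl D).pow_left a).mul_left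
      (((Commute.one_left D).sub_left (Commute.refl D)).pow_left b)
  have h_conj : D ^ a * (1 - D) ^ b * heat D t =
      heat D (t / 2) * (D ^ a * (1 - D) ^ b) * heat D (t / 2) := by
    rw [← (commute_heat hc _).eq, mul_assoc _ (heat D _), ← heat_add, add_halves]
  rw [h_conj]
  exact isPositive_conj (isSelfAdjoint_heat hD.isSelfAdjoint _)
    (hD.pow_mul_one_sub_pow_isPositive a b)

theorem heatForm_nonneg (hD : IsPositiveContraction D) (j : ℕ) (t : ℝ) (x : E) :
    0 ≤ heatForm D j t x := by
  simpa [heatForm] using (hD.pow_mul_one_sub_pow_mul_heat_isPositive j 0 t).inner_nonneg_left x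

theorem heatForm_succ_le (hD : IsPositiveContraction D) (j : ℕ) (t : ℝ) (x : E) :
    heatForm D (j + 1) t x ≤ heatForm D j t x := by
  have h := (hD.pow_mul_one_sub_pow_mul_heat_isPositive j 1 t).inner_nonneg_left x
  rw [pow_one, heatForm_one_sub] at h
  linarith

theorem heatForm_convex (hD : IsPositiveContraction D) (j : ℕ) (t : ℝ) (x : E) :
    2 * heatForm D (j + 1) t x ≤ heatForm D j t x + heatForm D (j + 2) t x := by
  have h := (hD.pow_mul_one_sub_pow_mul_heat_isPositive j 2 t).inner_nonneg_left x
  have h_expand : D ^ j * (1 - D) ^ 2 =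
      D ^ j * (1 - D) - D ^ (j + 1) * (1 - D) := by
    rw [pow_succ D j, mul_assoc (D ^ j), ← mul_sub]
    noncomm_ring
  rw [h_expand, sub_mul, sub_apply, inner_sub_left, heatForm_one_sub, heatForm_one_sub] at h
  linarith

theorem heatForm_antitone_index (hD : IsPositiveContraction D) (t : ℝ) (x : E) :
    Antitone fun j => heatForm D j t x :=
  antitone_nat_of_succ_le fun j => hD.heatForm_succ_le j t x

theorem heatForm_antitone_time (hD : IsPositiveContraction D) (j : ℕ) (x : E) :
    Antitone fun t => heatForm D j t x :=
  antitone_of_hasDerivAt_nonpos (fun t => hasDerivAt_heatForm D j t x)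
    fun t => neg_nonpos.2 (hD.heatForm_nonneg _ t x)

theorem heatForm_zero_le (hD : IsPositiveContraction D) {t : ℝ} (ht : 0 ≤ t) (x : E) :
    heatForm D 0 t x ≤ ‖x‖ ^ 2 :=
  heatForm_zero_zero D x ▸ hD.heatForm_antitone_time 0 x ht

theorem heatForm_eq_heatForm_zero_heat_half (hD : IsPositiveContraction D) (j : ℕ) (t : ℝ) (x : E) :
    heatForm D j t x = heatForm D j 0 (heat D (t / 2) x) := by
  have h_symm := ContinuousLinearMap.isSelfAdjoint_iff_isSymmetric.1
    (isSelfAdjoint_heat hD.isSelfAdjoint (t / 2))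
  have h_comm : Commute (D ^ j) (heat D (t / 2)) := commute_heat ((Commute.refl D).pow_left j) _
  rw [heatForm_at_zero, heatForm, ← h_symm.apply_clm, ← mul_apply_eq_comp, ← mul_apply_eq_comp,
    ← h_comm.eq, mul_assoc, ← heat_add, add_halves]

theorem tendsto_heatForm_at_zero (hD : IsPositiveContraction D) (h_fixed : ∀ x, D x = x → x = 0)
    (x : E) : Tendsto (fun N => heatForm D N 0 x) atTop (𝓝 0) := by
  obtain ⟨L, hL⟩ : ∃ L, Tendsto (fun N => heatForm D N 0 x) atTop (𝓝 L) :=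
    ⟨_, tendsto_atTop_ciInf (hD.heatForm_antitone_index 0 x)
      ⟨0, forall_mem_range.2 fun N => hD.heatForm_nonneg N 0 x⟩⟩
  have h_norm : ‖D‖ ≤ 1 :=
    D.opNorm_le_bound zero_le_one fun y => by simpa using hD.norm_apply_le y
  have h_ergodic : Tendsto (birkhoffAverage ℝ D id · x) atTop (𝓝 0) := by
    convert D.tendsto_birkhoffAverage_orthogonalProjection h_norm x using 2
    obtain ⟨y, hy⟩ := Submodule.orthogonalProjectionOnto
      ((D : E →ₗ[ℝ] E).eqLocus ((1 : E →L[ℝ] E) : E →ₗ[ℝ] E)) x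
    exact (h_fixed y hy).symm
  have h_mean : Tendsto (fun N : ℕ => (N : ℝ)⁻¹ * ∑ k ∈ Finset.range N, heatForm D k 0 x)
      atTop (𝓝 0) := by
    have h := h_ergodic.inner (𝕜 := ℝ) (tendsto_const_nhds (x := x))
    simpa [birkhoffAverage, birkhoffSum, inner_smul_left, sum_inner, heatForm_at_zero,
      FunLike.coe_pow_eq_iterate] using h
  rwa [tendsto_nhds_unique hL.cesaro h_mean] at hL

theorem one_add_mul_heatForm_succ_le (hD : IsPositiveContraction D) (j : ℕ) {t : ℝ} (ht : 0 ≤ t)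
    (x : E) : (1 + t) * heatForm D (j + 1) t x ≤ 3 * heatForm D j (t / 2) x := by
  have h_deriv (s : ℝ) : HasDerivAt
      (fun s => heatForm D j s x + (s - t / 2) * heatForm D (j + 1) s x)
      (-((s - t / 2) * heatForm D (j + 2) s x)) s :=
    ((hasDerivAt_heatForm D j s x).add (((hasDerivAt_id s).sub_const (t / 2)).mul
      (hasDerivAt_heatForm D (j + 1) s x))).congr_deriv (by simp)
  have h_anti : AntitoneOn (fun s => heatForm D j s x + (s - t / 2) * heatForm D (j + 1) s x)
      (Icc (t / 2) t) := by
    refine antitoneOn_of_hasDerivWithinAt_nonpos (convex_Icc _ _)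
      (fun s _ => (h_deriv s).continuousAt.continuousWithinAt)
      (fun s _ => (h_deriv s).hasDerivWithinAt) fun s hs => neg_nonpos.2 ?_
    rw [interior_Icc] at hs
    exact mul_nonneg (by linarith [hs.1]) (hD.heatForm_nonneg _ _ _)
  have h_ends := h_anti (left_mem_Icc.2 (by linarith)) (right_mem_Icc.2 (by linarith)) (by linarith)
  have h_time : heatForm D j t x ≤ heatForm D j (t / 2) x :=
    hD.heatForm_antitone_time j x (by linarith)
  have h_nonneg := hD.heatForm_nonneg j t x
  have h_index := hD.heatForm_succ_le j t x
  simp only [sub_self, zero_mul, add_zero] at h_ends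
  linarith

end IsPositiveContraction

end PositiveContraction

section PoissonAverage

open ProbabilityTheory

variable {E : Type*} [NormedAddCommGroup E] [InnerProductSpace ℝ E]

theorem norm_pow_apply_le (R : E →L[ℝ] E) (k : ℕ) (x : E) : ‖(R ^ k) x‖ ≤ ‖R‖ ^ k * ‖x‖ := by
  induction k with
  | zero => simp
  | succ k ih =>
    rw [pow_succ', pow_succ', mul_assoc, mul_apply_eq_comp]
    exact R.le_opNorm_of_le ih

theorem integrable_pow_apply_poissonMeasure (R : E →L[ℝ] E) (t : NNReal) (x : E) :
    Integrable (fun k => (R ^ k) x) (poissonMeasure t) := by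
  refine integrable_poissonMeasure_iff.2 ?_
  have h_sum := (Real.summable_pow_div_factorial (t * ‖R‖)).mul_left (Real.exp (-t) * ‖x‖)
  refine h_sum.of_nonneg_of_le (fun k => by positivity) fun k => ?_
  calc Real.exp (-t) * t ^ k / k.factorial * ‖(R ^ k) x‖
      ≤ Real.exp (-t) * t ^ k / k.factorial * (‖R‖ ^ k * ‖x‖) := by
        gcongr
        exact norm_pow_apply_le R k x
    _ = Real.exp (-t) * ‖x‖ * ((t * ‖R‖) ^ k / k.factorial) := by ring

variable [CompleteSpace E]

theorem heat_eq_exp_smul_exp (D : E →L[ℝ] E) (t : ℝ) :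
    heat D t = Real.exp (-t) • NormedSpace.exp (t • (1 - D)) := by
  let _ := NormedAlgebra.restrictScalars ℚ ℝ (E →L[ℝ] E)
  have h_split : t • -D = (-t) • (1 : E →L[ℝ] E) + t • (1 - D) := by module
  rw [heat, h_split, NormedSpace.exp_add_of_commute ((Commute.one_left _).smul_left _),
    ← Algebra.algebraMap_eq_smul_one, ← NormedSpace.algebraMap_exp_comm,
    Algebra.algebraMap_eq_smul_one, smul_mul_assoc, one_mul, Real.exp_eq_exp_ℝ]

theorem heat_apply_eq_integral (D : E →L[ℝ] E) (t : NNReal) (x : E) :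
    heat D t x = ∫ k, ((1 - D) ^ k) x ∂poissonMeasure t := by
  refine HasSum.unique (f := fun k : ℕ =>
    (Real.exp (-t) * t ^ k / k.factorial) • ((1 - D) ^ k) x) ?_
    (hasSum_integral_poissonMeasure (integrable_pow_apply_poissonMeasure _ t x))
  have h := ((NormedSpace.exp_series_hasSum_exp' (𝕂 := ℝ) ((t : ℝ) • (1 - D))).mapL
    (ContinuousLinearMap.apply ℝ E x)).const_smul (Real.exp (-t))
  rw [heat_eq_exp_smul_exp, smul_apply]
  refine h.congr_fun fun k => ?_
  rw [ContinuousLinearMap.apply_apply, smul_pow, smul_apply, smul_apply, smul_smul, smul_smul]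
  ring_nf

-- The heat semigroup is an average of the powers of `1 - D` over Poisson distributed exponents.
theorem heat_apply_mem {D : E →L[ℝ] E} {S : Set E} (hS : Convex ℝ S) (h_closed : IsClosed S)
    (h_maps : MapsTo ⇑(1 - D) S S) {t : ℝ} (ht : 0 ≤ t) {x : E} (hx : x ∈ S) :
    heat D t x ∈ S := by
  lift t to NNReal using ht
  rw [heat_apply_eq_integral]
  refine hS.integral_mem h_closed (ae_of_all _ fun k => ?_)
    (integrable_pow_apply_poissonMeasure _ t x)
  rw [FunLike.coe_pow_eq_iterate]
  exact h_maps.iterate k hx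

end PoissonAverage

/-! ### The weighted energy of the damped wave equation -/

section Energy

variable {E : Type*} [NormedAddCommGroup E] [InnerProductSpace ℝ E] {D : E →L[ℝ] E}

-- The increment of the form is `⟪(M s - M t) R q, q⟫ + ⟪M t (R q - R q₀), q + q₀⟫`, so only `R ∘ q`
-- has to be differentiable.
theorem hasDerivAt_inner_of_isSymmetric {M : ℝ → E →L[ℝ] E} {M' R : E →L[ℝ] E} {q : ℝ → E} {z : E}
    {t : ℝ} (hM : HasDerivAt M M' t) (h_symm : (M t * R).IsSymmetric) (hq : ContinuousAt q t)
    (hRq : HasDerivAt (fun s => R (q s)) z t) :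
    HasDerivAt (fun s => ⟪M s (R (q s)), q s⟫) (⟪M' (R (q t)), q t⟫ + 2 * ⟪M t z, q t⟫) t := by
  have hR : Tendsto (fun s => R (q s)) (𝓝[≠] t) (𝓝 (R (q t))) :=
    hRq.continuousAt.tendsto.mono_left nhdsWithin_le_nhds
  rw [hasDerivAt_iff_tendsto_slope] at hM hRq ⊢
  replace hq : Tendsto q (𝓝[≠] t) (𝓝 (q t)) := hq.tendsto.mono_left nhdsWithin_le_nhds
  have h_operator : Tendsto (fun s => ⟪slope M t s (R (q s)), q s⟫) (𝓝[≠] t)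
      (𝓝 ⟪M' (R (q t)), q t⟫) := ((isBoundedBilinearMap_apply.continuous.tendsto (M', R (q t))).comp
      (hM.prodMk_nhds hR)).inner hq
  have h_vector : Tendsto (fun s => ⟪M t (slope (fun s => R (q s)) t s), q s + q t⟫)
      (𝓝[≠] t) (𝓝 ⟪M t z, q t + q t⟫) :=
    (((M t).continuous.tendsto _).comp hRq).inner (hq.add tendsto_const_nhds)
  have h_limit := h_operator.add h_vector
  rw [inner_add_right, ← two_mul] at h_limit
  refine h_limit.congr fun s => ?_
  have h_cross : ⟪M t (R (q s)), q t⟫ = ⟪M t (R (q t)), q s⟫ := by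
    rw [real_inner_comm (q s)]
    exact h_symm.apply_clm (q s) (q t)
  simp only [slope_def_module, smul_apply, sub_apply, map_smul, map_sub, real_inner_smul_left,
    inner_sub_left, inner_add_right, smul_eq_mul]
  rw [h_cross]
  ring

/-- The energy at position `x` and velocity `y` for `d/dt ((1 - D) u') = -D u - (1 - D) u'`, with
all forms weighted by `D ^ j * exp (-s D)`. Without the weight it is `‖√(1 - D) (x + y)‖² / 2 +
‖√(1 - D) y‖² / 2 + ‖√D x‖²`. -/
noncomputable def waveEnergy (D : E →L[ℝ] E) (j : ℕ) (s : ℝ) (x y : E) : ℝ :=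
  1 / 2 * (heatForm D j s (x + y) - heatForm D (j + 1) s (x + y)) +
    1 / 2 * (heatForm D j s y - heatForm D (j + 1) s y) + heatForm D (j + 1) s x

variable [CompleteSpace E]

theorem continuousOn_heatForm_comp {S : Set ℝ} {s : ℝ → ℝ} {q : ℝ → E} (j : ℕ)
    (hs : ContinuousOn s S) (hq : ContinuousOn q S) :
    ContinuousOn (fun t => heatForm D j (s t) (q t)) S := by
  have h_heat : Continuous (heat D) :=
    continuous_iff_continuousAt.2 fun t => (hasDerivAt_heat D t).continuousAt
  exact ((continuousOn_const.mul (h_heat.comp_continuousOn hs)).clm_apply hq).inner hq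

theorem continuousOn_waveEnergy {S : Set ℝ} {s : ℝ → ℝ} {u w : ℝ → E} (j : ℕ)
    (hs : ContinuousOn s S) (hu : ContinuousOn u S) (hw : ContinuousOn w S) :
    ContinuousOn (fun t => waveEnergy D j (s t) (u t) (w t)) S :=
  ((continuousOn_const.mul ((continuousOn_heatForm_comp j hs (hu.add hw)).sub
    (continuousOn_heatForm_comp _ hs (hu.add hw)))).add
    (continuousOn_const.mul ((continuousOn_heatForm_comp j hs hw).sub
      (continuousOn_heatForm_comp _ hs hw)))).add (continuousOn_heatForm_comp _ hs hu)

theorem hasDerivAt_backward_heat (D : E →L[ℝ] E) (j : ℕ) (T t : ℝ) :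
    HasDerivAt (fun t => D ^ j * heat D ((T - t) / 2))
      ((1 / 2 : ℝ) • (D ^ (j + 1) * heat D ((T - t) / 2))) t := by
  have h_time : HasDerivAt (fun t => (T - t) / 2) (-1 / 2 : ℝ) t :=
    ((hasDerivAt_id t).const_sub T).div_const 2
  refine (((hasDerivAt_heat D _).scomp t h_time).const_mul (D ^ j)).congr_deriv ?_
  rw [smul_neg, ← neg_smul, mul_smul_comm, ← mul_assoc, ← pow_succ]
  norm_num

namespace IsPositiveContraction

theorem hasDerivAt_backward_heatForm (hD : IsPositiveContraction D) (j : ℕ) (T : ℝ) {q : ℝ → E}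
    {z : E} {t : ℝ} (hq : HasDerivAt q z t) :
    HasDerivAt (fun t => heatForm D j ((T - t) / 2) (q t))
      (1 / 2 * heatForm D (j + 1) ((T - t) / 2) (q t) +
        2 * ⟪(D ^ j * heat D ((T - t) / 2)) z, q t⟫) t := by
  refine (hasDerivAt_inner_of_isSymmetric (R := 1) (hasDerivAt_backward_heat D j T t) ?_
    hq.continuousAt hq).congr_deriv ?_
  · simpa using (hD.pow_mul_one_sub_pow_mul_heat_isPositive j 0 _).isSymmetric
  · simp [heatForm, real_inner_smul_left]

theorem hasDerivAt_backward_heatForm_sub (hD : IsPositiveContraction D) (j : ℕ) (T : ℝ) {q : ℝ → E}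
    {z : E} {t : ℝ} (hq : ContinuousAt q t) (hRq : HasDerivAt (fun t => (1 - D) (q t)) z t) :
    HasDerivAt (fun t => heatForm D j ((T - t) / 2) (q t) - heatForm D (j + 1) ((T - t) / 2) (q t))
      (1 / 2 * (heatForm D (j + 1) ((T - t) / 2) (q t) - heatForm D (j + 2) ((T - t) / 2) (q t)) +
        2 * ⟪(D ^ j * heat D ((T - t) / 2)) z, q t⟫) t := by
  have h_comm (i : ℕ) (s : ℝ) : D ^ i * heat D s * (1 - D) = D ^ i * (1 - D) * heat D s := by
    have hc : Commute (1 - D) D := (Commute.one_left D).sub_left (Commute.refl D)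
    rw [mul_assoc, mul_assoc, (commute_heat hc s).eq]
  have h_form (i : ℕ) (s : ℝ) (x : E) :
      ⟪(D ^ i * heat D s) ((1 - D) x), x⟫ = heatForm D i s x - heatForm D (i + 1) s x := by
    rw [← heatForm_one_sub, ← h_comm, mul_apply_eq_comp _ (1 - D)]
  have h_deriv := hasDerivAt_inner_of_isSymmetric (hasDerivAt_backward_heat D j T t)
    (h_comm j _ ▸ by simpa using (hD.pow_mul_one_sub_pow_mul_heat_isPositive j 1 _).isSymmetric)
    hq hRq
  simp only [h_form, smul_apply, real_inner_smul_left] at h_deriv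
  exact h_deriv

theorem hasDerivAt_waveEnergy (hD : IsPositiveContraction D) (j : ℕ) (T : ℝ) {u w : ℝ → E} {t : ℝ}
    (hw : ContinuousAt w t) (hu' : HasDerivAt u (w t) t)
    (hw' : HasDerivAt (fun t => (1 - D) (w t)) (-D (u t) - (1 - D) (w t)) t) :
    HasDerivAt (fun t => waveEnergy D j ((T - t) / 2) (u t) (w t))
      (1 / 4 * (heatForm D (j + 1) ((T - t) / 2) (u t + w t) -
          heatForm D (j + 2) ((T - t) / 2) (u t + w t)) +
        1 / 4 * (heatForm D (j + 1) ((T - t) / 2) (w t) - heatForm D (j + 2) ((T - t) / 2) (w t)) +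
        1 / 2 * heatForm D (j + 2) ((T - t) / 2) (u t) - heatForm D (j + 1) ((T - t) / 2) (u t) -
        (heatForm D j ((T - t) / 2) (w t) - heatForm D (j + 1) ((T - t) / 2) (w t))) t := by
  have h_sum : HasDerivAt (fun s => (1 - D) (u s + w s)) (-D (u t)) t := by
    have h := ((1 - D).hasFDerivAt.comp_hasDerivAt t hu').add hw'
    refine (h.congr_deriv (by abel)).congr_of_eventuallyEq (.of_forall fun s => ?_)
    simp only [map_add]
    rfl
  refine ((((hD.hasDerivAt_backward_heatForm_sub j T (hu'.continuousAt.add hw) h_sum).const_mul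
    (1 / 2)).add ((hD.hasDerivAt_backward_heatForm_sub j T hw hw').const_mul (1 / 2))).add
    (hD.hasDerivAt_backward_heatForm (j + 1) T hu')).congr_deriv ?_
  set M := D ^ j * heat D ((T - t) / 2)
  have h_succ : D ^ (j + 1) * heat D ((T - t) / 2) = M * D := by
    rw [pow_succ, mul_assoc, (commute_heat (Commute.refl D) _).eq, ← mul_assoc]
  have hM (x : E) : ⟪M (D x), x⟫ = heatForm D (j + 1) ((T - t) / 2) x := by
    rw [heatForm, h_succ]
    rfl
  have hM_one (x : E) : ⟪M x, x⟫ = heatForm D j ((T - t) / 2) x := rfl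
  have h_symm : ⟪M (D (u t)), w t⟫ = ⟪M (D (w t)), u t⟫ := by
    have h := (hD.pow_mul_one_sub_pow_mul_heat_isPositive (j + 1) 0 ((T - t) / 2)).isSymmetric
    rw [pow_zero, mul_one, h_succ] at h
    rw [real_inner_comm (u t)]
    exact h.apply_clm (u t) (w t)
  simp only [h_succ, mul_apply_eq_comp, Pi.add_apply, map_neg, map_sub, sub_apply,
    one_apply_eq_self, inner_neg_left, inner_sub_left, inner_add_right, hM, hM_one, h_symm]
  ring

theorem waveEnergy_dissipation (hD : IsPositiveContraction D) (j : ℕ) (s : ℝ) (x y : E) :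
    1 / 4 * (heatForm D (j + 1) s (x + y) - heatForm D (j + 2) s (x + y)) +
        1 / 4 * (heatForm D (j + 1) s y - heatForm D (j + 2) s y) +
        1 / 2 * heatForm D (j + 2) s x - heatForm D (j + 1) s x -
        (heatForm D j s y - heatForm D (j + 1) s y) ≤ 0 := by
  have h_parallelogram := heatForm_add_add_heatForm_sub D (j + 1) s x y
  have h_parallelogram' := heatForm_add_add_heatForm_sub D (j + 2) s x y
  have h_sub := hD.heatForm_succ_le (j + 1) s (x - y)
  have h_convex := hD.heatForm_convex j s y
  have h_succ_le := hD.heatForm_succ_le j s y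
  have h_succ_le' := hD.heatForm_succ_le (j + 1) s x
  have h_nonneg := hD.heatForm_nonneg (j + 2) s x
  linarith

theorem antitoneOn_waveEnergy (hD : IsPositiveContraction D) {u w : ℝ → E}
    (hu : ContinuousOn u (Ici 0)) (hw : ContinuousOn w (Ici 0))
    (hu' : ∀ t, 0 < t → HasDerivAt u (w t) t)
    (hw' : ∀ t, 0 < t → HasDerivAt (fun t => (1 - D) (w t)) (-D (u t) - (1 - D) (w t)) t)
    (j : ℕ) (T : ℝ) :
    AntitoneOn (fun t => waveEnergy D j ((T - t) / 2) (u t) (w t)) (Icc 0 T) := by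
  have h_pos (t : ℝ) (ht : t ∈ interior (Icc 0 T)) : 0 < t := by
    rw [interior_Icc] at ht
    exact ht.1
  have h_time : ContinuousOn (fun t => (T - t) / 2) (Icc 0 T) := by fun_prop
  exact antitoneOn_of_hasDerivWithinAt_nonpos (convex_Icc _ _)
    (continuousOn_waveEnergy j h_time (hu.mono Icc_subset_Ici_self) (hw.mono Icc_subset_Ici_self))
    (fun t ht => (hD.hasDerivAt_waveEnergy j T (hw.continuousAt (Ici_mem_nhds (h_pos t ht)))
      (hu' t (h_pos t ht)) (hw' t (h_pos t ht))).hasDerivWithinAt)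
    fun t _ => hD.waveEnergy_dissipation j _ _ _

theorem waveEnergy_le (hD : IsPositiveContraction D) (j : ℕ) (s : ℝ) (x y : E) :
    waveEnergy D j s x y ≤
      3 / 2 * (heatForm D j s x + (heatForm D j s y - heatForm D (j + 1) s y)) := by
  have h_parallelogram := heatForm_add_add_heatForm_sub D j s x y
  have h_parallelogram' := heatForm_add_add_heatForm_sub D (j + 1) s x y
  have h_sub := hD.heatForm_succ_le j s (x - y)
  have h_nonneg := hD.heatForm_nonneg j s x
  rw [waveEnergy]
  linarith

theorem le_waveEnergy (hD : IsPositiveContraction D) (j : ℕ) (s : ℝ) (x y : E) :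
    heatForm D j s x + (heatForm D j s y - heatForm D (j + 1) s y) ≤ 6 * waveEnergy D j s x y := by
  have h_parallelogram := heatForm_add_add_heatForm_sub D j s (x + y) y
  have h_parallelogram' := heatForm_add_add_heatForm_sub D (j + 1) s (x + y) y
  rw [add_sub_cancel_right] at h_parallelogram h_parallelogram'
  have h_add := hD.heatForm_succ_le j s (x + y + y)
  have h_succ_le := hD.heatForm_succ_le j s (x + y)
  have h_nonneg := hD.heatForm_nonneg (j + 1) s x
  rw [waveEnergy]
  linarith

theorem energy_le (hD : IsPositiveContraction D) {u w : ℝ → E}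
    (hu : ContinuousOn u (Ici 0)) (hw : ContinuousOn w (Ici 0))
    (hu' : ∀ t, 0 < t → HasDerivAt u (w t) t)
    (hw' : ∀ t, 0 < t → HasDerivAt (fun t => (1 - D) (w t)) (-D (u t) - (1 - D) (w t)) t)
    (j : ℕ) {T : ℝ} (hT : 0 ≤ T) :
    heatForm D j 0 (u T) + (heatForm D j 0 (w T) - heatForm D (j + 1) 0 (w T)) ≤
      9 * (heatForm D j (T / 2) (u 0) +
        (heatForm D j (T / 2) (w 0) - heatForm D (j + 1) (T / 2) (w 0))) := by
  have h_anti := hD.antitoneOn_waveEnergy hu hw hu' hw' j T (left_mem_Icc.2 hT)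
    (right_mem_Icc.2 hT) hT
  simp only [sub_self, sub_zero, zero_div] at h_anti
  have h_final := hD.le_waveEnergy j 0 (u T) (w T)
  have h_initial := hD.waveEnergy_le j (T / 2) (u 0) (w 0)
  linarith

end IsPositiveContraction

end Energy

/-! ### The resolvent of a form domain -/

theorem pow_apply_comm {E V : Type*} [NormedAddCommGroup E] [NormedSpace ℝ E]
    [NormedAddCommGroup V] [NormedSpace ℝ V] {J : V →L[ℝ] E} {A : E →L[ℝ] E} {B : V →L[ℝ] V}
    (h : ∀ v, A (J v) = J (B v)) (k : ℕ) (v : V) : (A ^ k) (J v) = J ((B ^ k) v) := by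
  simpa only [FunLike.coe_pow_eq_iterate] using
    ((show Function.Semiconj J B A from fun v => (h v).symm).iterate_right k v).symm

section FormDomain

variable {E V : Type*} [NormedAddCommGroup E] [InnerProductSpace ℝ E] [CompleteSpace E]
  [NormedAddCommGroup V] [InnerProductSpace ℝ V] [CompleteSpace V] {J : V →L[ℝ] E}

/-- If `J` embeds the domain `V` of a closed form, with the graph norm, into `E`, and `A` is the
operator of the form, then `J J† = (1 + A)⁻¹` and `defect J` is the bounded operator
`A (1 + A)⁻¹` on `E`, while `defect J†` is the same operator on `V`. -/
noncomputable def defect (J : V →L[ℝ] E) : E →L[ℝ] E := 1 - J ∘L J.adjoint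

theorem norm_adjoint_le_one (hJ : ‖J‖ ≤ 1) : ‖J.adjoint‖ ≤ 1 :=
  (LinearIsometryEquiv.norm_map _ J).trans_le hJ

theorem inner_defect_apply_self (J : V →L[ℝ] E) (x : E) :
    ⟪defect J x, x⟫ = ‖x‖ ^ 2 - ‖J.adjoint x‖ ^ 2 := by
  simp [defect, inner_sub_left, ← ContinuousLinearMap.adjoint_inner_right]

theorem isPositiveContraction_defect (hJ : ‖J‖ ≤ 1) : IsPositiveContraction (defect J) where
  isPositive := by
    refine (ContinuousLinearMap.isPositive_iff' _).2 ⟨?_, fun x => ?_⟩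
    · exact (IsSelfAdjoint.one _).sub J.isPositive_self_comp_adjoint.isSelfAdjoint
    · rw [inner_defect_apply_self, sub_nonneg]
      gcongr
      simpa using J.adjoint.le_of_opNorm_le (norm_adjoint_le_one hJ) x
  one_sub_isPositive := by simpa [defect] using J.isPositive_self_comp_adjoint

theorem eq_zero_of_defect_apply_eq (h_inj : Function.Injective J.adjoint) {x : E}
    (hx : defect J x = x) : x = 0 := by
  have h := inner_defect_apply_self J x
  rw [hx, real_inner_self_eq_norm_sq, eq_comm, sub_eq_self] at h
  exact h_inj (by simpa using h)

theorem adjoint_injective_of_denseRange (hJ : DenseRange J) : Function.Injective J.adjoint := by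
  refine (injective_iff_map_eq_zero _).2 fun x hx => hJ.eq_zero_of_inner_left (𝕜 := ℝ) fun v => ?_
  rw [real_inner_comm, ← ContinuousLinearMap.adjoint_inner_right, hx, inner_zero_right]

theorem heat_apply_comm {A : E →L[ℝ] E} {B : V →L[ℝ] V} (h : ∀ v, A (J v) = J (B v)) (t : ℝ)
    (v : V) : heat A t (J v) = J (heat B t v) := by
  have hA := (NormedSpace.exp_series_hasSum_exp' (𝕂 := ℝ) (t • -A)).mapL
    (ContinuousLinearMap.apply ℝ E (J v))
  have hB := ((NormedSpace.exp_series_hasSum_exp' (𝕂 := ℝ) (t • -B)).mapL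
    (ContinuousLinearMap.apply ℝ V v)).mapL J
  refine hA.unique (hB.congr_fun fun k => ?_)
  simp only [ContinuousLinearMap.apply_apply, map_smul]
  rw [pow_apply_comm (B := t • -B) fun v => by simp [h]]

theorem defect_apply_comm (J : V →L[ℝ] E) (v : V) : defect J (J v) = J (defect J.adjoint v) := by
  simp [defect]

theorem heatForm_defect_apply (J : V →L[ℝ] E) (j : ℕ) (t : ℝ) (v : V) :
    heatForm (defect J) j t (J v) =
      heatForm (defect J.adjoint) j t v - heatForm (defect J.adjoint) (j + 1) t v := by
  rw [heatForm, mul_apply_eq_comp, heat_apply_comm (defect_apply_comm J),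
    pow_apply_comm (defect_apply_comm J), ← ContinuousLinearMap.adjoint_inner_left, heatForm,
    heatForm, pow_succ', ← inner_sub_left]
  simp [defect]

theorem sum_heatForm_defect_apply (J : V →L[ℝ] E) (k N : ℕ) (t : ℝ) (v : V) :
    ∑ i ∈ Finset.range N, heatForm (defect J) (k + i) t (J v) =
      heatForm (defect J.adjoint) k t v - heatForm (defect J.adjoint) (k + N) t v := by
  simp only [heatForm_defect_apply]
  exact sum_heatForm_sub_succ _ k N t v

theorem sum_heatForm_defect_apply_le (hJ : ‖J‖ ≤ 1) (m a N : ℕ) (t : ℝ) (v : V) :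
    ∑ i ∈ Finset.range N, heatForm (defect J) (m + i) t (J v) ≤
      a * heatForm (defect J) m t (J v) + heatForm (defect J.adjoint) (m + a) t v := by
  have hD := isPositiveContraction_defect hJ
  have h_head : ∑ i ∈ Finset.range a, heatForm (defect J) (m + i) t (J v) ≤
      a * heatForm (defect J) m t (J v) := by
    simpa using Finset.sum_le_card_nsmul (Finset.range a) _ _ fun i _ =>
      hD.heatForm_antitone_index t (J v) (Nat.le_add_right m i)
  have h_tail : ∑ i ∈ Finset.range N, heatForm (defect J) (m + a + i) t (J v) ≤
      heatForm (defect J.adjoint) (m + a) t v := by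
    rw [sum_heatForm_defect_apply]
    linarith [(isPositiveContraction_defect (norm_adjoint_le_one hJ)).heatForm_nonneg
      (m + a + N) t v]
  calc ∑ i ∈ Finset.range N, heatForm (defect J) (m + i) t (J v)
      ≤ ∑ i ∈ Finset.range (a + N), heatForm (defect J) (m + i) t (J v) :=
        Finset.sum_le_sum_of_subset_of_nonneg (Finset.range_mono (Nat.le_add_left _ _))
          fun i _ _ => hD.heatForm_nonneg _ _ _
    _ = ∑ i ∈ Finset.range a, heatForm (defect J) (m + i) t (J v) +
        ∑ i ∈ Finset.range N, heatForm (defect J) (m + a + i) t (J v) := by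
        rw [Finset.sum_range_add]
        simp only [add_assoc]
    _ ≤ _ := add_le_add h_head h_tail

theorem norm_sq_sub_norm_sq_apply_le_of_sum_le (hJ : ‖J‖ ≤ 1) (h_inj : Function.Injective J) (v : V)
    {B : ℝ} (hB : ∀ N, ∑ i ∈ Finset.range N, heatForm (defect J) (1 + i) 0 (J v) ≤ B) :
    ‖v‖ ^ 2 - ‖J v‖ ^ 2 ≤ B := by
  have h_tail : Tendsto (fun N => heatForm (defect J.adjoint) (1 + N) 0 v) atTop (𝓝 0) := by
    simp only [add_comm 1]
    exact (tendsto_add_atTop_iff_nat 1).2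
      ((isPositiveContraction_defect (norm_adjoint_le_one hJ)).tendsto_heatForm_at_zero
        (fun _ => eq_zero_of_defect_apply_eq (by rwa [ContinuousLinearMap.adjoint_adjoint])) v)
  have h_head : heatForm (defect J.adjoint) 1 0 v = ‖v‖ ^ 2 - ‖J v‖ ^ 2 := by
    rw [heatForm_at_zero, pow_one, inner_defect_apply_self, ContinuousLinearMap.adjoint_adjoint]
  have h_limit := h_tail.const_sub (‖v‖ ^ 2 - ‖J v‖ ^ 2)
  rw [sub_zero] at h_limit
  refine le_of_tendsto h_limit (.of_forall fun N => ?_)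
  rw [← h_head, ← sum_heatForm_defect_apply]
  exact hB N

theorem norm_sq_defect_le_of_sum_le (hJ : ‖J‖ ≤ 1) (h_dense : DenseRange J) (x : E) {B : ℝ}
    (hB : ∀ N, ∑ i ∈ Finset.range N,
      (heatForm (defect J) (2 + i) 0 x - heatForm (defect J) (2 + i + 1) 0 x) ≤ B) :
    ‖defect J x‖ ^ 2 ≤ B := by
  have hD := isPositiveContraction_defect hJ
  have h_tail : Tendsto (fun N => heatForm (defect J) (2 + N) 0 x) atTop (𝓝 0) := by
    simp only [add_comm 2]
    exact (tendsto_add_atTop_iff_nat 2).2 (hD.tendsto_heatForm_at_zero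
      (fun _ => eq_zero_of_defect_apply_eq (adjoint_injective_of_denseRange h_dense)) x)
  have h_limit := h_tail.const_sub (‖defect J x‖ ^ 2)
  rw [sub_zero] at h_limit
  refine le_of_tendsto h_limit (.of_forall fun N => ?_)
  rw [hD.norm_sq_apply_eq_heatForm, ← sum_heatForm_sub_succ]
  exact hB N

end FormDomain

/-! ### Decay of damped waves -/

section ScalarODE

theorem le_add_of_deriv_le_sub_half {y y' : ℝ → ℝ} {K T : ℝ} (hT : 0 ≤ T)
    (hy : ContinuousOn y (Icc 0 T)) (hy' : ∀ t ∈ Ioo 0 T, HasDerivAt y (y' t) t)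
    (h_le : ∀ t ∈ Ioo 0 T, y' t ≤ K - y t / 2) (h_zero : 0 ≤ y 0) (hK : 0 ≤ K) :
    y T ≤ y 0 + 2 * K := by
  have h_exp (t : ℝ) : HasDerivAt (fun t => Real.exp (t / 2)) (Real.exp (t / 2) * (1 / 2)) t :=
    ((hasDerivAt_id t).div_const 2).exp
  have h_anti : AntitoneOn (fun t => Real.exp (t / 2) * (y t - 2 * K)) (Icc 0 T) := by
    have h_mem {t : ℝ} (ht : t ∈ interior (Icc 0 T)) : t ∈ Ioo 0 T := by rwa [interior_Icc] at ht
    refine antitoneOn_of_hasDerivWithinAt_nonpos (convex_Icc 0 T)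
      ((Continuous.continuousOn (by fun_prop)).mul (hy.sub continuousOn_const))
      (fun t ht => ((h_exp t).mul ((hy' t (h_mem ht)).sub_const _)).hasDerivWithinAt)
      fun t ht => ?_
    rw [mul_assoc, ← mul_add]
    refine mul_nonpos_of_nonneg_of_nonpos (Real.exp_pos _).le ?_
    linarith [h_le t (h_mem ht)]
  have h_ends := h_anti (left_mem_Icc.2 hT) (right_mem_Icc.2 hT) hT
  simp only [zero_div, Real.exp_zero, one_mul] at h_ends
  by_contra! h_lt
  have h_exp_ge : 1 ≤ Real.exp (T / 2) := Real.one_le_exp (by linarith)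
  nlinarith

-- The slower weight `(1 + c t) ^ p`, `c = 1 / (2 (p + 1))`, has logarithmic derivative at most
-- `1 / 2`.
theorem mul_one_add_pow_le_of_deriv_le {f f' : ℝ → ℝ} {K : ℝ} (p : ℕ) (hf : ContinuousOn f (Ici 0))
    (hf' : ∀ t, 0 < t → HasDerivAt f (f' t) t) (h_nonneg : ∀ t, 0 ≤ t → 0 ≤ f t) (hK : 0 ≤ K)
    (h_le : ∀ t, 0 < t → (f' t + f t) * (1 + t) ^ p ≤ K) {T : ℝ} (hT : 0 ≤ T) :
    f T * (1 + T) ^ p ≤ (2 * (p + 1)) ^ p * (f 0 + 2 * K) := by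
  set c : ℝ := 1 / (2 * (p + 1)) with hc
  have hc_pos : 0 < c := by positivity
  have hc_inv : 2 * (p + 1) * c = 1 := by rw [hc]; field_simp
  have hcp : c * p ≤ 1 / 2 := by linarith
  have hc_le : c ≤ 1 := by nlinarith [(Nat.cast_nonneg p : (0 : ℝ) ≤ p)]
  have h_weight (t : ℝ) : HasDerivAt (fun t => (1 + c * t) ^ p) (p * (1 + c * t) ^ (p - 1) * c) t :=
    (by simpa using ((hasDerivAt_id t).const_mul c).const_add 1 :
      HasDerivAt (fun t : ℝ => 1 + c * t) c t).pow p
  have h_weight_le (t : ℝ) (ht : 0 ≤ t) :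
      p * (1 + c * t) ^ (p - 1) * c ≤ 1 / 2 * (1 + c * t) ^ p := by
    have h_one : 1 ≤ 1 + c * t := by linarith [mul_nonneg hc_pos.le ht]
    calc p * (1 + c * t) ^ (p - 1) * c = c * p * (1 + c * t) ^ (p - 1) := by ring
      _ ≤ 1 / 2 * (1 + c * t) ^ p := by gcongr; exact Nat.sub_le p 1
  have h_source (t : ℝ) (ht : 0 < t) : (f' t + f t) * (1 + c * t) ^ p ≤ K := by
    rcases le_total 0 (f' t + f t) with h_sign | h_sign
    · refine (mul_le_mul_of_nonneg_left ?_ h_sign).trans (h_le t ht)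
      gcongr
      exact mul_le_of_le_one_left ht.le hc_le
    · exact (mul_nonpos_of_nonpos_of_nonneg h_sign (by positivity)).trans hK
  have h_bound : f T * (1 + c * T) ^ p ≤ f 0 + 2 * K := by
    have h := le_add_of_deriv_le_sub_half (y := fun t => f t * (1 + c * t) ^ p) hT
      ((hf.mono Icc_subset_Ici_self).mul (by fun_prop))
      (fun t ht => (hf' t ht.1).mul (h_weight t))
      (fun t ht => by
        have := mul_le_mul_of_nonneg_left (h_weight_le t ht.1.le) (h_nonneg t ht.1.le)
        linarith [h_source t ht.1])
      (by simpa using h_nonneg 0 le_rfl) hK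
    simpa using h
  calc f T * (1 + T) ^ p ≤ f T * (2 * (p + 1) * (1 + c * T)) ^ p := by
        have := h_nonneg T hT
        gcongr
        linarith [mul_nonneg (Nat.cast_nonneg (α := ℝ) p) hT, congrArg (· * T) hc_inv]
    _ = (2 * (p + 1)) ^ p * (f T * (1 + c * T) ^ p) := by rw [mul_pow]; ring
    _ ≤ _ := by gcongr

theorem one_add_pow_le_two_pow_mul {T : ℝ} (hT : 0 ≤ T) (k : ℕ) :
    (1 + T) ^ k ≤ 2 ^ k * (1 + T / 2) ^ k := by
  rw [← mul_pow]
  gcongr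
  linarith

end ScalarODE

section HeatDecay

variable {E : Type*} [NormedAddCommGroup E] [InnerProductSpace ℝ E]

/-- The norm of `exp (-(t / 2) D) x` decays like `(1 + t) ^ (-a / 2)`, with constant `√B`. -/
def HasHeatDecay (D : E →L[ℝ] E) (a : ℕ) (B : ℝ) (x : E) : Prop :=
  ∀ t, 0 ≤ t → heatForm D 0 t x * (1 + t) ^ a ≤ B

theorem HasHeatDecay.mono {D : E →L[ℝ] E} {a : ℕ} {B B' : ℝ} {x : E} (hx : HasHeatDecay D a B x)
    (h : B ≤ B') : HasHeatDecay D a B' x := fun t ht => (hx t ht).trans h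

variable [CompleteSpace E]

theorem hasHeatDecay_zero {D : E →L[ℝ] E} (hD : IsPositiveContraction D) {B : ℝ} {x : E}
    (hx : ‖x‖ ^ 2 ≤ B) : HasHeatDecay D 0 B x := fun t ht => by
  simpa using (hD.heatForm_zero_le ht x).trans hx

variable (E) in
theorem exists_heatForm_decay (a m : ℕ) : ∃ C : ℝ, 0 < C ∧
    ∀ {D : E →L[ℝ] E}, IsPositiveContraction D → ∀ {B : ℝ} {x : E}, HasHeatDecay D a B x →
      ∀ t, 0 ≤ t → heatForm D m t x * (1 + t) ^ (a + m) ≤ C * B := by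
  induction m with
  | zero => exact ⟨1, one_pos, fun _ _ _ hx t ht => by simpa using hx t ht⟩
  | succ m ih =>
    obtain ⟨C, hC, h_decay⟩ := ih
    refine ⟨3 * 2 ^ (a + m) * C, by positivity, fun hD B x hx t ht => ?_⟩
    have h_half := h_decay hD hx (t / 2) (by positivity)
    have h_nonneg := hD.heatForm_nonneg m (t / 2) x
    calc _ = (1 + t) * heatForm _ (m + 1) t x * (1 + t) ^ (a + m) := by ring
      _ ≤ 3 * heatForm _ m (t / 2) x * (2 ^ (a + m) * (1 + t / 2) ^ (a + m)) :=
        mul_le_mul (hD.one_add_mul_heatForm_succ_le m ht x) (one_add_pow_le_two_pow_mul ht _)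
          (by positivity) (by positivity)
      _ = 3 * 2 ^ (a + m) * (heatForm _ m (t / 2) x * (1 + t / 2) ^ (a + m)) := by ring
      _ ≤ 3 * 2 ^ (a + m) * (C * B) := by gcongr
      _ = _ := by ring

end HeatDecay

theorem two_mul_inner_add_norm_sq_le {E : Type*} [NormedAddCommGroup E]
    [InnerProductSpace ℝ E] (x y : E) : 2 * ⟪y, -x - y⟫ + ‖y‖ ^ 2 ≤ ‖x‖ ^ 2 := by
  have h_square : ‖x + y‖ ^ 2 = ‖x‖ ^ 2 + 2 * ⟪y, x⟫ + ‖y‖ ^ 2 := by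
    rw [norm_add_sq_real, real_inner_comm]
  rw [inner_sub_right, inner_neg_right, real_inner_self_eq_norm_sq]
  linarith [sq_nonneg ‖x + y‖]

section Solution

variable {E V : Type*} [NormedAddCommGroup E] [InnerProductSpace ℝ E] [CompleteSpace E]
  [NormedAddCommGroup V] [InnerProductSpace ℝ V] [CompleteSpace V]
  {J : V →L[ℝ] E} {v : ℝ → V} {u w : ℝ → E}

/-- `u = J v` solves `u'' + A u + u' = 0`, `w = u'`, for the operator `A` of the form with domain
embedding `J`. The equation is multiplied by `(1 + A)⁻¹ = 1 - defect J`, so that it only involves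
bounded operators. -/
structure IsDampedWave (J : V →L[ℝ] E) (v : ℝ → V) (u w : ℝ → E) : Prop where
  eq_apply : ∀ t, 0 ≤ t → u t = J (v t)
  continuousOn : ContinuousOn u (Ici 0)
  continuousOn_velocity : ContinuousOn w (Ici 0)
  hasDerivAt : ∀ t, 0 < t → HasDerivAt u (w t) t
  hasDerivAt_velocity : ∀ t, 0 < t →
    HasDerivAt (fun t => (1 - defect J) (w t)) (-defect J (u t) - (1 - defect J) (w t)) t

namespace IsDampedWave

theorem energy_le (h : IsDampedWave J v u w) (hJ : ‖J‖ ≤ 1) (j : ℕ) {T : ℝ} (hT : 0 ≤ T) :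
    heatForm (defect J) j 0 (u T) +
        (heatForm (defect J) j 0 (w T) - heatForm (defect J) (j + 1) 0 (w T)) ≤
      9 * (heatForm (defect J) j (T / 2) (u 0) +
        (heatForm (defect J) j (T / 2) (w 0) - heatForm (defect J) (j + 1) (T / 2) (w 0))) :=
  (isPositiveContraction_defect hJ).energy_le h.continuousOn h.continuousOn_velocity h.hasDerivAt
    h.hasDerivAt_velocity j hT

theorem norm_sq_mul_le (h : IsDampedWave J v u w) (hJ : ‖J‖ ≤ 1) {a : ℕ} {B : ℝ}
    (hu₀ : HasHeatDecay (defect J) a B (u 0)) (hw₀ : HasHeatDecay (defect J) a B (w 0)) {T : ℝ}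
    (hT : 0 ≤ T) : ‖u T‖ ^ 2 * (1 + T) ^ a ≤ 18 * 2 ^ a * B := by
  have hD := isPositiveContraction_defect hJ
  have h_energy : ‖u T‖ ^ 2 ≤
      9 * (heatForm (defect J) 0 (T / 2) (u 0) + heatForm (defect J) 0 (T / 2) (w 0)) := by
    have := h.energy_le hJ 0 hT
    rw [heatForm_zero_zero] at this
    linarith [hD.heatForm_succ_le 0 0 (w T), hD.heatForm_nonneg (0 + 1) (T / 2) (w 0)]
  have hu_half := hu₀ (T / 2) (by positivity)
  have hw_half := hw₀ (T / 2) (by positivity)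
  have hu_nonneg := hD.heatForm_nonneg 0 (T / 2) (u 0)
  have hw_nonneg := hD.heatForm_nonneg 0 (T / 2) (w 0)
  calc _ ≤ 9 * (heatForm (defect J) 0 (T / 2) (u 0) + heatForm (defect J) 0 (T / 2) (w 0)) *
        (2 ^ a * (1 + T / 2) ^ a) := by gcongr; exact one_add_pow_le_two_pow_mul hT a
    _ = 9 * 2 ^ a * (heatForm (defect J) 0 (T / 2) (u 0) * (1 + T / 2) ^ a +
        heatForm (defect J) 0 (T / 2) (w 0) * (1 + T / 2) ^ a) := by ring
    _ ≤ 9 * 2 ^ a * (B + B) := by gcongr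
    _ = _ := by ring

theorem sum_energy_le (h : IsDampedWave J v u w) (hJ : ‖J‖ ≤ 1) (m a N : ℕ) {T : ℝ} (hT : 0 ≤ T) :
    ∑ i ∈ Finset.range N, (heatForm (defect J) (m + i) 0 (u T) +
        (heatForm (defect J) (m + i) 0 (w T) - heatForm (defect J) (m + i + 1) 0 (w T))) ≤
      9 * (a * heatForm (defect J) m (T / 2) (u 0) +
        heatForm (defect J.adjoint) (m + a) (T / 2) (v 0) +
        heatForm (defect J) m (T / 2) (w 0)) := by
  have h_position := sum_heatForm_defect_apply_le hJ m a N (T / 2) (v 0)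
  have h_velocity := sum_heatForm_sub_succ (defect J) m N (T / 2) (w 0)
  have h_nonneg := (isPositiveContraction_defect hJ).heatForm_nonneg (m + N) (T / 2) (w 0)
  rw [← h.eq_apply 0 le_rfl] at h_position
  refine (Finset.sum_le_sum fun i _ => h.energy_le hJ (m + i) hT).trans ?_
  rw [← Finset.mul_sum, Finset.sum_add_distrib]
  linarith

variable (J) in
theorem exists_sum_energy_decay (hJ : ‖J‖ ≤ 1) (a m : ℕ) : ∃ C : ℝ, 0 < C ∧
    ∀ {v : ℝ → V} {u w : ℝ → E} {B : ℝ}, IsDampedWave J v u w →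
      HasHeatDecay (defect J) a B (u 0) → HasHeatDecay (defect J) a B (w 0) → ‖v 0‖ ^ 2 ≤ B →
      ∀ N {T : ℝ}, 0 ≤ T → (∑ i ∈ Finset.range N, (heatForm (defect J) (m + i) 0 (u T) +
        (heatForm (defect J) (m + i) 0 (w T) - heatForm (defect J) (m + i + 1) 0 (w T)))) *
          (1 + T) ^ (a + m) ≤ C * B := by
  obtain ⟨C, hC, h_decay⟩ := exists_heatForm_decay E a m
  obtain ⟨C', hC', h_decay'⟩ := exists_heatForm_decay V 0 (a + m)
  refine ⟨9 * 2 ^ (a + m) * (a * C + C' + C), by positivity, ?_⟩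
  intro v u w B h hu₀ hw₀ hv₀ N T hT
  have hD := isPositiveContraction_defect hJ
  have hD' := isPositiveContraction_defect (norm_adjoint_le_one hJ)
  have h_half : 0 ≤ T / 2 := by positivity
  have hu_half := h_decay hD hu₀ (T / 2) h_half
  have hw_half := h_decay hD hw₀ (T / 2) h_half
  have hv_half := h_decay' hD' (hasHeatDecay_zero hD' hv₀) (T / 2) h_half
  have h_sum := h.sum_energy_le hJ m a N hT
  have hu_nonneg := hD.heatForm_nonneg m (T / 2) (u 0)
  have hw_nonneg := hD.heatForm_nonneg m (T / 2) (w 0)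
  have hv_nonneg := hD'.heatForm_nonneg (a + m) (T / 2) (v 0)
  rw [zero_add] at hv_half
  rw [add_comm m a] at h_sum
  calc _ ≤ 9 * (a * heatForm (defect J) m (T / 2) (u 0) +
        heatForm (defect J.adjoint) (a + m) (T / 2) (v 0) +
        heatForm (defect J) m (T / 2) (w 0)) * (2 ^ (a + m) * (1 + T / 2) ^ (a + m)) :=
        mul_le_mul h_sum (one_add_pow_le_two_pow_mul hT _) (by positivity) (by positivity)
    _ = 9 * 2 ^ (a + m) * (a * (heatForm (defect J) m (T / 2) (u 0) * (1 + T / 2) ^ (a + m)) +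
        heatForm (defect J.adjoint) (a + m) (T / 2) (v 0) * (1 + T / 2) ^ (a + m) +
        heatForm (defect J) m (T / 2) (w 0) * (1 + T / 2) ^ (a + m)) := by ring
    _ ≤ 9 * 2 ^ (a + m) * (a * (C * B) + C' * B + C * B) := by gcongr
    _ = _ := by ring

variable (J) in
theorem exists_form_decay (hJ : ‖J‖ ≤ 1) (h_inj : Function.Injective J) (a : ℕ) :
    ∃ C : ℝ, 0 < C ∧ ∀ {v : ℝ → V} {u w : ℝ → E} {B : ℝ}, IsDampedWave J v u w →
      HasHeatDecay (defect J) a B (u 0) → HasHeatDecay (defect J) a B (w 0) → ‖v 0‖ ^ 2 ≤ B →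
      ∀ {T : ℝ}, 0 ≤ T → (‖v T‖ ^ 2 - ‖J (v T)‖ ^ 2) * (1 + T) ^ (a + 1) ≤ C * B := by
  obtain ⟨C, hC, h_decay⟩ := exists_sum_energy_decay J hJ a 1
  refine ⟨C, hC, fun {v u w B} h hu₀ hw₀ hv₀ {T} hT => ?_⟩
  rw [← le_div_iff₀ (by positivity)]
  refine norm_sq_sub_norm_sq_apply_le_of_sum_le hJ h_inj _ fun N => ?_
  rw [le_div_iff₀ (by positivity), ← h.eq_apply T hT]
  refine le_trans ?_ (h_decay h hu₀ hw₀ hv₀ N hT)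
  gcongr
  exact le_add_of_nonneg_right
    (sub_nonneg.2 ((isPositiveContraction_defect hJ).heatForm_succ_le (1 + _) 0 (w T)))

variable (J) in
theorem exists_norm_sq_defect_decay (hJ : ‖J‖ ≤ 1) (h_dense : DenseRange J) (a : ℕ) :
    ∃ C : ℝ, 0 < C ∧ ∀ {v : ℝ → V} {u w : ℝ → E} {B : ℝ}, IsDampedWave J v u w →
      HasHeatDecay (defect J) a B (u 0) → HasHeatDecay (defect J) a B (w 0) → ‖v 0‖ ^ 2 ≤ B →
      ∀ {T : ℝ}, 0 ≤ T → ‖defect J (u T)‖ ^ 2 * (1 + T) ^ (a + 2) ≤ C * B ∧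
        ‖defect J (w T)‖ ^ 2 * (1 + T) ^ (a + 2) ≤ C * B := by
  have hD := isPositiveContraction_defect hJ
  obtain ⟨C, hC, h_decay⟩ := exists_sum_energy_decay J hJ a 2
  refine ⟨C, hC, fun {v u w B} h hu₀ hw₀ hv₀ {T} hT => ⟨?_, ?_⟩⟩
  · refine le_trans ?_ (h_decay h hu₀ hw₀ hv₀ 1 hT)
    gcongr
    simp only [Finset.range_one, Finset.sum_singleton, add_zero, hD.norm_sq_apply_eq_heatForm]
    linarith [hD.heatForm_succ_le 2 0 (w T)]
  · rw [← le_div_iff₀ (by positivity)]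
    refine norm_sq_defect_le_of_sum_le hJ h_dense _ fun N => ?_
    rw [le_div_iff₀ (by positivity)]
    refine le_trans ?_ (h_decay h hu₀ hw₀ hv₀ N hT)
    gcongr with i
    exact le_add_of_nonneg_left (hD.heatForm_nonneg (2 + i) 0 (u T))

variable (J) in
theorem exists_norm_sq_one_sub_defect_decay (hJ : ‖J‖ ≤ 1) (h_dense : DenseRange J) (a : ℕ) :
    ∃ C : ℝ, 0 < C ∧ ∀ {v : ℝ → V} {u w : ℝ → E} {B : ℝ}, IsDampedWave J v u w →
      HasHeatDecay (defect J) a B (u 0) → HasHeatDecay (defect J) a B (w 0) → ‖v 0‖ ^ 2 ≤ B →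
      ∀ {T : ℝ}, 0 ≤ T → ‖(1 - defect J) (w T)‖ ^ 2 * (1 + T) ^ (a + 2) ≤ C * B := by
  have hD := isPositiveContraction_defect hJ
  obtain ⟨C, hC, h_decay⟩ := exists_norm_sq_defect_decay J hJ h_dense a
  refine ⟨(2 * ((a + 2 : ℕ) + 1)) ^ (a + 2) * (1 + 2 * C), by positivity, ?_⟩
  intro v u w B h hu₀ hw₀ hv₀ T hT
  have h_initial : ‖(1 - defect J) (w 0)‖ ^ 2 ≤ B := by
    have hw_zero := hw₀ 0 le_rfl
    rw [heatForm_zero_zero, add_zero, one_pow, mul_one] at hw_zero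
    refine le_trans ?_ hw_zero
    gcongr
    exact hD.one_sub.norm_apply_le (w 0)
  have hB : 0 ≤ B := (sq_nonneg _).trans hv₀
  refine (mul_one_add_pow_le_of_deriv_le (a + 2) (f := fun t => ‖(1 - defect J) (w t)‖ ^ 2)
    (((1 - defect J).continuous.comp_continuousOn h.continuousOn_velocity).norm.pow 2)
    (fun t ht => (h.hasDerivAt_velocity t ht).norm_sq) (fun t _ => sq_nonneg _)
    (by positivity : 0 ≤ C * B) (fun t ht => ?_) hT).trans ?_
  · refine le_trans ?_ (h_decay h hu₀ hw₀ hv₀ ht.le).1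
    gcongr
    exact two_mul_inner_add_norm_sq_le _ _
  · rw [mul_assoc]
    gcongr
    linarith

variable (J) in
theorem exists_velocity_decay (hJ : ‖J‖ ≤ 1) (h_dense : DenseRange J) (a : ℕ) :
    ∃ C : ℝ, 0 < C ∧ ∀ {v : ℝ → V} {u w : ℝ → E} {B : ℝ}, IsDampedWave J v u w →
      HasHeatDecay (defect J) a B (u 0) → HasHeatDecay (defect J) a B (w 0) → ‖v 0‖ ^ 2 ≤ B →
      ∀ {T : ℝ}, 0 ≤ T → ‖w T‖ ^ 2 * (1 + T) ^ (a + 2) ≤ C * B := by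
  obtain ⟨C, hC, h_decay⟩ := exists_norm_sq_defect_decay J hJ h_dense a
  obtain ⟨C', hC', h_decay'⟩ := exists_norm_sq_one_sub_defect_decay J hJ h_dense a
  refine ⟨2 * (C + C'), by positivity, fun {v u w B} h hu₀ hw₀ hv₀ {T} hT => ?_⟩
  have h_split : ‖w T‖ ^ 2 ≤ 2 * (‖defect J (w T)‖ ^ 2 + ‖(1 - defect J) (w T)‖ ^ 2) := by
    have h_sum : w T = defect J (w T) + (1 - defect J) (w T) := by simp
    calc ‖w T‖ ^ 2 ≤ (‖defect J (w T)‖ + ‖(1 - defect J) (w T)‖) ^ 2 := by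
          gcongr
          exact (congrArg norm h_sum).trans_le (norm_add_le _ _)
      _ ≤ _ := add_sq_le
  calc ‖w T‖ ^ 2 * (1 + T) ^ (a + 2)
      ≤ 2 * (‖defect J (w T)‖ ^ 2 + ‖(1 - defect J) (w T)‖ ^ 2) * (1 + T) ^ (a + 2) := by gcongr
    _ = 2 * (‖defect J (w T)‖ ^ 2 * (1 + T) ^ (a + 2) +
        ‖(1 - defect J) (w T)‖ ^ 2 * (1 + T) ^ (a + 2)) := by ring
    _ ≤ 2 * (C * B + C' * B) := 
      mul_le_mul_of_nonneg_left (add_le_add (h_decay h hu₀ hw₀ hv₀ hT).2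
        (h_decay' h hu₀ hw₀ hv₀ hT)) two_pos.le
    _ = _ := by ring

end IsDampedWave

end Solution

section Nash

variable {E : Type*} [NormedAddCommGroup E] [InnerProductSpace ℝ E] [CompleteSpace E]
  {D : E →L[ℝ] E}

-- Along `s = 1 + t / (C (p + 1))` the Nash inequality says that `s ^ (p + 1) * heatForm D 0 t f`
-- grows at most at the constant rate `K`.
theorem antitoneOn_of_nash (p : ℕ) {C K : ℝ} (hC : 0 < C) {f : E}
    (h_nash : ∀ t, 0 ≤ t → ∀ s, 1 ≤ s →
      heatForm D 0 t f * s ^ p ≤ C * (s ^ (p + 1) * heatForm D 1 t f + K)) :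
    AntitoneOn (fun t => (1 + t / (C * (p + 1))) ^ (p + 1) * heatForm D 0 t f - K * t) (Ici 0) := by
  have h_deriv (t : ℝ) : HasDerivAt
      (fun t => (1 + t / (C * (p + 1))) ^ (p + 1) * heatForm D 0 t f - K * t)
      ((p + 1 : ℕ) * (1 + t / (C * (p + 1))) ^ p * (1 / (C * (p + 1))) * heatForm D 0 t f +
        (1 + t / (C * (p + 1))) ^ (p + 1) * -heatForm D 1 t f - K) t := by
    have h_scale : HasDerivAt (fun t : ℝ => 1 + t / (C * (p + 1))) (1 / (C * (p + 1))) t :=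
      ((hasDerivAt_id t).div_const _).const_add 1
    exact (((h_scale.pow (p + 1)).mul (hasDerivAt_heatForm D 0 t f)).sub
      ((hasDerivAt_id t).const_mul K)).congr_deriv (by simp)
  refine antitoneOn_of_hasDerivWithinAt_nonpos (convex_Ici 0)
    (fun t _ => (h_deriv t).continuousAt.continuousWithinAt)
    (fun t _ => (h_deriv t).hasDerivWithinAt) fun t ht => ?_
  rw [interior_Ici] at ht
  have h_one_le : 1 ≤ 1 + t / (C * (p + 1)) := by
    have := div_nonneg ht.le (by positivity : 0 ≤ C * ((p : ℝ) + 1))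
    linarith
  have h_cancel : ((p + 1 : ℕ) : ℝ) * (1 + t / (C * (p + 1))) ^ p * (1 / (C * (p + 1))) *
      heatForm D 0 t f = heatForm D 0 t f * (1 + t / (C * (p + 1))) ^ p / C := by
    push_cast
    field_simp
  have h_div := (div_le_iff₀' hC).2 (h_nash t ht.le _ h_one_le)
  rw [h_cancel]
  linarith

theorem IsPositiveContraction.hasHeatDecay_of_nash (hD : IsPositiveContraction D) (p : ℕ) {C K : ℝ}
    (hC : 0 < C) (hK : 0 ≤ K) {f : E}
    (h_nash : ∀ t, 0 ≤ t → ∀ s, 1 ≤ s →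
      heatForm D 0 t f * s ^ p ≤ C * (s ^ (p + 1) * heatForm D 1 t f + K)) :
    HasHeatDecay D p ((1 + C * (p + 1)) ^ p * (‖f‖ ^ 2 + C * (p + 1) * K)) f := by
  intro t ht
  have h_anti := antitoneOn_of_nash p hC h_nash self_mem_Ici ht ht
  set A : ℝ := C * (p + 1)
  have hA_pos : 0 < A := by positivity
  obtain ⟨s, rfl⟩ : ∃ s, t = A * s := ⟨t / A, by field_simp⟩
  have hs : 0 ≤ s := nonneg_of_mul_nonneg_right ht hA_pos
  simp only [zero_div, add_zero, one_pow, one_mul, mul_zero, sub_zero, heatForm_zero_zero,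
    mul_div_cancel_left₀ s hA_pos.ne'] at h_anti
  have h_scaled : (1 + s) ^ p * heatForm D 0 (A * s) f ≤ ‖f‖ ^ 2 + A * K := by
    refine le_of_mul_le_mul_left ?_ (by positivity : 0 < 1 + s)
    calc (1 + s) * ((1 + s) ^ p * heatForm D 0 (A * s) f)
        = (1 + s) ^ (p + 1) * heatForm D 0 (A * s) f := by ring
      _ ≤ ‖f‖ ^ 2 + K * (A * s) := by linarith
      _ ≤ (1 + s) * (‖f‖ ^ 2 + A * K) := by
        linarith [mul_nonneg hs (sq_nonneg ‖f‖), mul_nonneg hA_pos.le hK]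
  have h_nonneg := hD.heatForm_nonneg 0 (A * s) f
  calc heatForm D 0 (A * s) f * (1 + A * s) ^ p
      ≤ heatForm D 0 (A * s) f * ((1 + A) * (1 + s)) ^ p := by gcongr; linarith
    _ = (1 + A) ^ p * ((1 + s) ^ p * heatForm D 0 (A * s) f) := by rw [mul_pow]; ring
    _ ≤ _ := by gcongr

end Nash

section WeakDerivative

variable {E : Type*} [NormedAddCommGroup E] [InnerProductSpace ℝ E] [CompleteSpace E]

-- Integrate: the fundamental theorem of calculus holds after pairing with each element of `S`.
theorem hasDerivAt_of_hasDerivAt_inner {ξ ξ' : ℝ → E} {S : Set E}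
    (hS : ∀ x : E, (∀ s ∈ S, ⟪x, s⟫ = 0) → x = 0) (h_cont : ContinuousOn ξ' (Ioi 0))
    (h : ∀ s ∈ S, ∀ t, 0 < t → HasDerivAt (fun t => ⟪s, ξ t⟫) ⟪s, ξ' t⟫ t)
    {t : ℝ} (ht : 0 < t) : HasDerivAt ξ (ξ' t) t := by
  have h_sub {x : ℝ} (hx : 0 < x) : uIcc (t / 2) x ⊆ Ioi 0 := fun y hy =>
    (lt_min (half_pos ht) hx).trans_le hy.1
  have h_int {x : ℝ} (hx : 0 < x) : IntervalIntegrable ξ' volume (t / 2) x :=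
    (h_cont.mono (h_sub hx)).intervalIntegrable
  have h_primitive (x : ℝ) (hx : 0 < x) : ξ x = ξ (t / 2) + ∫ y in (t / 2)..x, ξ' y := by
    rw [← sub_eq_zero]
    refine hS _ fun s hs => ?_
    have h_inner : ∫ y in (t / 2)..x, ⟪s, ξ' y⟫ = ⟪s, ∫ y in (t / 2)..x, ξ' y⟫ :=
      (innerSL ℝ s).intervalIntegral_comp_comm (h_int hx)
    have h_ftc := intervalIntegral.integral_eq_sub_of_hasDerivAt
      (fun y hy => h s hs y (h_sub hx hy))
      ((continuousOn_const.inner (h_cont.mono (h_sub hx))).intervalIntegrable)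
    rw [real_inner_comm, inner_sub_right, inner_add_right, ← h_inner, h_ftc]
    ring
  have h_deriv : HasDerivAt (fun x => ξ (t / 2) + ∫ y in (t / 2)..x, ξ' y) (ξ' t) t :=
    (intervalIntegral.integral_hasDerivAt_right (h_int ht)
      (h_cont.stronglyMeasurableAtFilter isOpen_Ioi t ht)
      (h_cont.continuousAt (Ioi_mem_nhds ht))).const_add _
  exact h_deriv.congr_of_eventuallyEq (eventually_of_mem (Ioi_mem_nhds ht) h_primitive)

end WeakDerivative

end DampedWave

noncomputable section

namespace Heisenberg

open DampedWave Filter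
open scoped Matrix RealInnerProductSpace Topology

variable {n : ℕ}

/-! ### The Heisenberg group -/

section GroupLaw

theorem mul_eq (p q : H n) : mul p q =
    (p.1 + q.1, p.2.1 + q.2.1, p.2.2 + q.2.2 + 1 / 2 * (p.1 ⬝ᵥ q.2.1 - q.1 ⬝ᵥ p.2.1)) := rfl

protected theorem mul_assoc (p q r : H n) : mul (mul p q) r = mul p (mul q r) := by
  simp only [mul_eq, add_dotProduct, dotProduct_add, add_assoc, Prod.mk.injEq, true_and]
  ring

protected theorem mul_zero (p : H n) : mul p 0 = p := by simp [mul]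

protected theorem zero_mul (p : H n) : mul 0 p = p := by simp [mul]

theorem mul_neg_self (p : H n) : mul p (-p) = 0 := by simp [mul]

theorem neg_mul_self (p : H n) : mul (-p) p = 0 := by simp [mul]

theorem mul_neg_cancel_right (p q : H n) : mul (mul p q) (-q) = p := by
  rw [Heisenberg.mul_assoc, mul_neg_self, Heisenberg.mul_zero]

theorem neg_mul_cancel_right (p q : H n) : mul (mul p (-q)) q = p := by
  rw [Heisenberg.mul_assoc, neg_mul_self, Heisenberg.mul_zero]

theorem mul_neg_cancel_left (p q : H n) : mul p (mul (-p) q) = q := by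
  rw [← Heisenberg.mul_assoc, mul_neg_self, Heisenberg.zero_mul]

theorem neg_mul_cancel_left (p q : H n) : mul (-p) (mul p q) = q := by
  rw [← Heisenberg.mul_assoc, neg_mul_self, Heisenberg.zero_mul]

theorem neg_mul_rev (p q : H n) : -mul p q = mul (-q) (-p) := by
  simp only [mul_eq, Prod.neg_mk, Prod.fst_neg, Prod.snd_neg, neg_dotProduct, dotProduct_neg,
    neg_neg, neg_add_rev, Prod.mk.injEq, true_and]
  ring

theorem contDiff_mul {k : WithTop ℕ∞} : ContDiff ℝ k fun x : H n × H n => mul x.1 x.2 := by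
  unfold mul
  fun_prop

theorem contDiff_mul_right {k : WithTop ℕ∞} (q : H n) : ContDiff ℝ k fun p => mul p q :=
  contDiff_mul.comp (contDiff_id.prodMk contDiff_const)

theorem continuous_mul : Continuous fun x : H n × H n => mul x.1 x.2 :=
  contDiff_mul.continuous (n := 0)

/-- Right translation as a homeomorphism. -/
def mulRightHomeo (q : H n) : H n ≃ₜ H n where
  toFun p := mul p q
  invFun p := mul p (-q)
  left_inv p := mul_neg_cancel_right p q
  right_inv p := neg_mul_cancel_right p q
  continuous_toFun := continuous_mul.comp (continuous_id.prodMk continuous_const)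
  continuous_invFun := continuous_mul.comp (continuous_id.prodMk continuous_const)

/-- Left translation as a homeomorphism. -/
def mulLeftHomeo (q : H n) : H n ≃ₜ H n where
  toFun p := mul q p
  invFun p := mul (-q) p
  left_inv p := neg_mul_cancel_left q p
  right_inv p := mul_neg_cancel_left q p
  continuous_toFun := continuous_mul.comp (continuous_const.prodMk continuous_id)
  continuous_invFun := continuous_mul.comp (continuous_const.prodMk continuous_id)

end GroupLaw

section Measure

theorem measurePreserving_shear (a b : Fin n → ℝ) {ℓ : (Fin n → ℝ) → (Fin n → ℝ) → ℝ}
    (hℓ : Continuous (Function.uncurry ℓ)) :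
    MeasurePreserving fun p : H n => ((p.1 + a, p.2.1 + b, p.2.2 + ℓ p.1 p.2.1) : H n) := by
  have h_inner (x : Fin n → ℝ) :
      MeasurePreserving fun p : (Fin n → ℝ) × ℝ => (p.1 + b, p.2 + ℓ x p.1) :=
    (measurePreserving_add_right volume b).skew_product (g := fun y τ => τ + ℓ x y)
      (by fun_prop) (.of_forall fun y => (measurePreserving_add_right volume (ℓ x y)).map_eq)
  exact (measurePreserving_add_right volume a).skew_product
    (g := fun x (z : (Fin n → ℝ) × ℝ) => (z.1 + b, z.2 + ℓ x z.1))
    (by fun_prop) (.of_forall fun x => (h_inner x).map_eq)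

theorem measurePreserving_mul_right (q : H n) : MeasurePreserving fun p => mul p q := by
  convert measurePreserving_shear q.1 q.2.1
    (ℓ := fun x y => q.2.2 + 1 / 2 * (x ⬝ᵥ q.2.1 - q.1 ⬝ᵥ y)) (by fun_prop) using 2 with p
  rw [mul_eq, add_assoc p.2.2]

theorem measurePreserving_mul_left (q : H n) : MeasurePreserving fun p => mul q p := by
  convert measurePreserving_shear q.1 q.2.1
    (ℓ := fun x y => q.2.2 + 1 / 2 * (q.1 ⬝ᵥ y - x ⬝ᵥ q.2.1)) (by fun_prop) using 2 with p
  rw [mul_eq, add_comm q.1, add_comm q.2.1, add_comm q.2.2, add_assoc p.2.2]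

theorem measurableEmbedding_mul_right (q : H n) : MeasurableEmbedding fun p => mul p q :=
  (mulRightHomeo q).measurableEmbedding

theorem measurePreserving_neg : MeasurePreserving fun p : H n => -p :=
  (Measure.measurePreserving_neg volume).prod
    ((Measure.measurePreserving_neg volume).prod (Measure.measurePreserving_neg volume))

end Measure

section Field

/-- The horizontal directions `(a, b)`, which parametrize the left-invariant horizontal fields
`∑ j, (a j * X_j + b j * Y_j)`. -/
abbrev Horizontal (n : ℕ) : Type := (Fin n → ℝ) × (Fin n → ℝ)

/-- The horizontal element `(a, b, 0)` of the group. -/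
def horizontal (ζ : Horizontal n) : H n := (ζ.1, ζ.2, 0)

/-- The left-invariant vector field generated by the one-parameter group `s • (a, b, 0)`. -/
def field (ζ : Horizontal n) (p : H n) : H n :=
  (ζ.1, ζ.2, 1 / 2 * (p.1 ⬝ᵥ ζ.2 - ζ.1 ⬝ᵥ p.2.1))

theorem mul_smul_horizontal (p : H n) (s : ℝ) (ζ : Horizontal n) :
    mul p (s • horizontal ζ) = p + s • field ζ p := by
  refine Prod.ext rfl (Prod.ext rfl ?_)
  simp only [mul_eq, horizontal, field, Prod.smul_mk, dotProduct_smul, smul_dotProduct,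
    Prod.snd_add, smul_eq_mul]
  ring

theorem smul_horizontal_mul_smul_horizontal (s t : ℝ) (ζ : Horizontal n) :
    mul (s • horizontal ζ) (t • horizontal ζ) = (s + t) • horizontal ζ := by
  refine Prod.ext (add_smul s t ζ.1).symm (Prod.ext (add_smul s t ζ.2).symm ?_)
  simp only [mul_eq, horizontal, Prod.smul_mk, dotProduct_smul, smul_dotProduct, smul_eq_mul]
  ring

theorem field_mul_smul_horizontal (ζ : Horizontal n) (p : H n) (s : ℝ) :
    field ζ (mul p (s • horizontal ζ)) = field ζ p := by
  simp only [mul_eq, field, horizontal, Prod.smul_mk, add_dotProduct, dotProduct_add,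
    dotProduct_smul, smul_dotProduct, smul_eq_mul, Prod.mk.injEq, true_and]
  ring

theorem vecX_eq_field (j : Fin n) : vecX j = field (Pi.single j 1, 0) := by
  funext p
  simp only [vecX, field, dotProduct_zero, single_one_dotProduct, Prod.mk.injEq, true_and]
  ring

theorem vecY_eq_field (j : Fin n) : vecY j = field (0, Pi.single j 1) := by
  funext p
  simp only [vecY, field, zero_dotProduct, dotProduct_single_one, Prod.mk.injEq, true_and]
  ring

theorem contDiff_field (ζ : Horizontal n) : ContDiff ℝ ∞ (field ζ) := by
  unfold field dotProduct
  fun_prop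

/-- The coordinate directions, of `X_j` on the left and `Y_j` on the right summand. -/
def coordDir : Fin n ⊕ Fin n → Horizontal n :=
  Sum.elim (fun j => (Pi.single j 1, 0)) fun j => (0, Pi.single j 1)

end Field

/-! ### Test functions and right translations -/

section TestFunction

variable {φ ψ : H n → ℝ}

namespace IsTest

theorem continuous (hφ : IsTest φ) : Continuous φ := hφ.1.continuous

theorem differentiable (hφ : IsTest φ) : Differentiable ℝ φ := hφ.1.differentiable (by simp)

theorem memLp (hφ : IsTest φ) : MemLp φ 2 := hφ.continuous.memLp_of_hasCompactSupport hφ.2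

protected theorem mul (hφ : IsTest φ) (hψ : ContDiff ℝ ∞ ψ) : IsTest fun p => φ p * ψ p :=
  ⟨hφ.1.mul hψ, hφ.2.mul_right⟩

theorem integrable_mul {v : H n → ℝ} (hφ : IsTest φ) (hv : LocallyIntegrable v) :
    Integrable fun p => v p * φ p := by
  simpa only [smul_eq_mul, mul_comm] using
    hv.integrable_smul_right_of_hasCompactSupport hφ.continuous hφ.2

theorem comp_mul_right (hφ : IsTest φ) (q : H n) : IsTest fun p => φ (mul p q) :=
  ⟨hφ.1.comp (contDiff_mul_right q), hφ.2.comp_homeomorph (mulRightHomeo q)⟩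

end IsTest

theorem contDiff_along (hφ : ContDiff ℝ ∞ φ) (ζ : Horizontal n) :
    ContDiff ℝ ∞ (along (field ζ) φ) :=
  (hφ.fderiv_right (by simp)).clm_apply (contDiff_field ζ)

protected theorem IsTest.along (hφ : IsTest φ) (ζ : Horizontal n) : IsTest (along (field ζ) φ) := by
  refine ⟨contDiff_along hφ.1 ζ, (hφ.2.fderiv ℝ).mono fun p hp h_zero => hp ?_⟩
  rw [Heisenberg.along, h_zero, zero_apply]

theorem along_mul (hφ : Differentiable ℝ φ) (hψ : Differentiable ℝ ψ) (Z : H n → H n) (p : H n) :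
    along Z (fun p => φ p * ψ p) p = along Z φ p * ψ p + φ p * along Z ψ p := by
  simp only [along, fderiv_fun_mul (hφ p) (hψ p), add_apply, smul_apply, smul_eq_mul]
  ring

theorem hasDerivAt_comp_mul_smul (hφ : Differentiable ℝ φ) (ζ : Horizontal n) (p : H n) (s : ℝ) :
    HasDerivAt (fun s => φ (mul p (s • horizontal ζ)))
      (along (field ζ) φ (mul p (s • horizontal ζ))) s := by
  have h_line : HasDerivAt (fun s : ℝ => mul p (s • horizontal ζ)) (field ζ p) s := by
    simpa only [mul_smul_horizontal, one_smul, id_eq] using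
      ((hasDerivAt_id s).smul_const (field ζ p)).const_add p
  have h_comp := (hφ (mul p (s • horizontal ζ))).hasFDerivAt.comp_hasDerivAt s h_line
  rwa [← field_mul_smul_horizontal ζ p s] at h_comp

theorem along_comp_mul_smul (hφ : ContDiff ℝ ∞ φ) (ζ : Horizontal n) (p : H n) (s : ℝ) :
    along (field ζ) (fun p => φ (mul p (s • horizontal ζ))) p =
      along (field ζ) φ (mul p (s • horizontal ζ)) := by
  have h_translate := hasDerivAt_comp_mul_smul
    ((hφ.comp (contDiff_mul_right (s • horizontal ζ))).differentiable (by simp)) ζ p 0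
  have h_shift :=
    (hasDerivAt_comp_mul_smul (hφ.differentiable (by simp)) ζ p (0 + s)).comp_add_const 0 s
  simp only [Function.comp_apply, Heisenberg.mul_assoc, smul_horizontal_mul_smul_horizontal]
    at h_translate
  simpa only [zero_smul, zero_add, Heisenberg.mul_zero, Function.comp_def] using
    h_translate.unique h_shift

theorem hasDerivAt_integral_comp_mul_smul {v : H n → ℝ} (hv : LocallyIntegrable v) (hφ : IsTest φ)
    (ζ : Horizontal n) (s : ℝ) :
    HasDerivAt (fun s => ∫ p, v p * φ (mul p (s • horizontal ζ)))
      (∫ p, v p * along (field ζ) φ (mul p (s • horizontal ζ))) s := by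
  have hφ' := hφ.along ζ
  obtain ⟨C, hC⟩ := hφ'.2.exists_bound_of_continuous hφ'.continuous
  set K : Set (H n) := (fun x : H n × ℝ => mul x.1 (-(x.2 • horizontal ζ))) ''
    (tsupport (along (field ζ) φ) ×ˢ Metric.closedBall s 1)
  have hK : IsCompact K := (hφ'.2.isCompact.prod (isCompact_closedBall s 1)).image
    (continuous_mul.comp (continuous_fst.prodMk (continuous_snd.smul continuous_const).neg))
  refine (hasDerivAt_integral_of_dominated_loc_of_deriv_le
    (bound := K.indicator fun p => ‖v p‖ * C) (Metric.ball_mem_nhds s one_pos)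
    (.of_forall fun t => ((hφ.comp_mul_right _).integrable_mul hv).aestronglyMeasurable)
    ((hφ.comp_mul_right _).integrable_mul hv)
    ((hφ'.comp_mul_right _).integrable_mul hv).aestronglyMeasurable
    (.of_forall fun p t ht => ?_) ?_
    (.of_forall fun p t _ => (hasDerivAt_comp_mul_smul hφ.differentiable ζ p t).const_mul (v p))).2
  · by_cases hp : p ∈ K
    · rw [indicator_of_mem hp, norm_mul]
      gcongr
      exact hC _
    · have h_outside : mul p (t • horizontal ζ) ∉ tsupport (along (field ζ) φ) := fun h_mem =>
        hp ⟨(_, t), ⟨h_mem, Metric.ball_subset_closedBall ht⟩, mul_neg_cancel_right _ _⟩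
      rw [indicator_of_notMem hp, image_eq_zero_of_notMem_tsupport h_outside, mul_zero, norm_zero]
  · rw [integrable_indicator_iff hK.measurableSet]
    exact (hv.integrableOn_isCompact hK).norm.mul_const C

theorem integral_along_eq_zero (hφ : IsTest φ) (ζ : Horizontal n) :
    ∫ p, along (field ζ) φ p = 0 := by
  have h_deriv := hasDerivAt_integral_comp_mul_smul (locallyIntegrable_const 1) hφ ζ 0
  have h_const (s : ℝ) : ∫ p, φ (mul p (s • horizontal ζ)) = ∫ p, φ p :=
    (measurePreserving_mul_right _).integral_comp (measurableEmbedding_mul_right _) φ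
  simp only [one_mul, h_const, zero_smul, Heisenberg.mul_zero] at h_deriv
  exact h_deriv.unique (hasDerivAt_const 0 _)

theorem integral_along_mul (hφ : IsTest φ) (hψ : ContDiff ℝ ∞ ψ) (ζ : Horizontal n) :
    ∫ p, along (field ζ) φ p * ψ p = -∫ p, φ p * along (field ζ) ψ p := by
  have h_left := (hφ.along ζ).mul hψ
  have h_right := hφ.mul (contDiff_along hψ ζ)
  have h_sum := integral_along_eq_zero (hφ.mul hψ) ζ
  simp only [along_mul hφ.differentiable (hψ.differentiable (by simp))] at h_sum
  rw [integral_add (h_left.continuous.integrable_of_hasCompactSupport h_left.2)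
    (h_right.continuous.integrable_of_hasCompactSupport h_right.2)] at h_sum
  linarith

end TestFunction

section L2

theorem locallyIntegrable_L2 (f : L2 n) : LocallyIntegrable f :=
  (Lp.memLp f).locallyIntegrable (by norm_num)

theorem inner_toLp (f : L2 n) {φ : H n → ℝ} (hφ : MemLp φ 2) :
    ⟪f, hφ.toLp φ⟫ = ∫ p, f p * φ p := by
  rw [L2.inner_def]
  refine integral_congr_ae ?_
  filter_upwards [hφ.coeFn_toLp] with p hp
  rw [hp, RCLike.inner_apply, RCLike.conj_to_real, mul_comm]

/-- The class in `L²` of a test function. -/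
def IsTest.toL2 {φ : H n → ℝ} (hφ : IsTest φ) : L2 n := hφ.memLp.toLp φ

theorem inner_toL2 (f : L2 n) {φ : H n → ℝ} (hφ : IsTest φ) : ⟪f, hφ.toL2⟫ = ∫ p, f p * φ p :=
  inner_toLp f hφ.memLp

theorem eq_of_inner_toL2_eq {f g : L2 n}
    (h : ∀ (φ : H n → ℝ) (hφ : IsTest φ), ⟪f, hφ.toL2⟫ = ⟪g, hφ.toL2⟫) : f = g := by
  rw [← sub_eq_zero, Lp.eq_zero_iff_ae_eq_zero]
  refine ae_eq_zero_of_integral_contDiff_smul_eq_zero (locallyIntegrable_L2 _) fun φ hφ hφ' => ?_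
  simp only [smul_eq_mul, mul_comm (φ _), ← inner_toL2 _ ⟨hφ, hφ'⟩, inner_sub_left]
  exact sub_eq_zero.2 (h φ _)

theorem dense_toL2 : Dense {f : L2 n | ∃ (φ : H n → ℝ) (hφ : IsTest φ), hφ.toL2 = f} := by
  refine (Lp.dense_hasCompactSupport_contDiff (p := 2) ENNReal.ofNat_ne_top).mono ?_
  rintro f ⟨φ, hf, h_supp, h_smooth⟩
  exact ⟨φ, ⟨h_smooth, h_supp⟩, (Lp.ext (hf.trans (MemLp.coeFn_toLp _).symm)).symm⟩

theorem norm_le_of_inner_toL2_le {f : L2 n} {K : ℝ} (hK : 0 ≤ K)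
    (h : ∀ (φ : H n → ℝ) (hφ : IsTest φ), ⟪f, hφ.toL2⟫ ≤ K * ‖hφ.toL2‖) : ‖f‖ ≤ K := by
  have h_closed : IsClosed {g : L2 n | ⟪f, g⟫ ≤ K * ‖g‖} := isClosed_le (by fun_prop) (by fun_prop)
  have h_self : f ∈ {g : L2 n | ⟪f, g⟫ ≤ K * ‖g‖} :=
    h_closed.closure_subset_iff.2 (by rintro _ ⟨φ, hφ, rfl⟩; exact h φ hφ) (dense_toL2 f)
  rw [mem_ofPred_eq, real_inner_self_eq_norm_mul_norm] at h_self
  rcases (norm_nonneg f).eq_or_lt with h_zero | h_pos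
  · rwa [← h_zero]
  · exact le_of_mul_le_mul_right h_self h_pos

/-- Right translation on `L²`. -/
def rightTranslate (q : H n) : L2 n →ₗᵢ[ℝ] L2 n :=
  Lp.compMeasurePreservingₗᵢ ℝ (fun p => mul p q) (measurePreserving_mul_right q)

theorem coeFn_rightTranslate (q : H n) (f : L2 n) :
    rightTranslate q f =ᵐ[volume] fun p => f (mul p q) :=
  Lp.coeFn_compMeasurePreserving f (measurePreserving_mul_right q)

theorem rightTranslate_toL2 (q : H n) {φ : H n → ℝ} (hφ : IsTest φ) :
    rightTranslate q hφ.toL2 = (hφ.comp_mul_right q).toL2 :=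
  Lp.toLp_compMeasurePreserving hφ.memLp (measurePreserving_mul_right q)

theorem rightTranslate_zero (f : L2 n) : rightTranslate 0 f = f := by
  refine Lp.ext ((coeFn_rightTranslate 0 f).trans ?_)
  simp only [Heisenberg.mul_zero, EventuallyEq.rfl]

theorem rightTranslate_mul (p q : H n) (f : L2 n) :
    rightTranslate (mul p q) f = rightTranslate p (rightTranslate q f) := by
  refine Lp.ext ?_
  filter_upwards [coeFn_rightTranslate (mul p q) f, coeFn_rightTranslate p (rightTranslate q f),
    (measurePreserving_mul_right p).quasiMeasurePreserving.ae (coeFn_rightTranslate q f)]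
    with x h_mul h_left h_right
  rw [h_mul, h_left, h_right, Heisenberg.mul_assoc]

theorem inner_rightTranslate_left (q : H n) (f g : L2 n) :
    ⟪rightTranslate q f, g⟫ = ⟪f, rightTranslate (-q) g⟫ := by
  rw [← LinearIsometry.inner_map_map (rightTranslate (-q)), ← rightTranslate_mul, neg_mul_self,
    rightTranslate_zero]

end L2

/-! ### Weak derivatives -/

theorem exists_norm_le_inner_eq_of_tendsto {ι X : Type*} [NormedAddCommGroup X]
    [InnerProductSpace ℝ X] [CompleteSpace X] {l : Filter ι} [NeBot l] {x : ι → X} {K : ℝ}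
    (hx : ∀ᶠ i in l, ‖x i‖ ≤ K) :
    ∃ w, ‖w‖ ≤ K ∧ ∀ {g : X} {c : ℝ}, Tendsto (fun i => ⟪x i, g⟫) l (𝓝 c) → ⟪w, g⟫ = c := by
  obtain ⟨f, hf, h_cluster⟩ := (WeakDual.isCompact_closedBall (0 : StrongDual ℝ X) K
    ).exists_mapClusterPt (f := l)
      (u := fun i => StrongDual.toWeakDual (InnerProductSpace.toDual ℝ X (x i)))
      (tendsto_principal.2 (hx.mono fun i hi => by simpa using hi))
  obtain ⟨U, hU, hf_lim⟩ := mapClusterPt_iff_ultrafilter.1 h_cluster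
  refine ⟨(InnerProductSpace.toDual ℝ X).symm (WeakDual.toStrongDual f), by simpa using hf,
    fun {g c} hc => ?_⟩
  rw [InnerProductSpace.toDual_symm_apply]
  exact tendsto_nhds_unique (((WeakDual.eval_continuous g).tendsto f).comp hf_lim) (hc.mono_left hU)

section WeakDerivative

variable {ζ : Horizontal n} {v w v' w' : L2 n} {φ : H n → ℝ}

theorem isWeakDeriv_iff_inner : IsWeakDeriv (field ζ) v w ↔
    ∀ (φ : H n → ℝ) (hφ : IsTest φ), ⟪w, hφ.toL2⟫ = -⟪v, (hφ.along ζ).toL2⟫ := by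
  simp only [IsWeakDeriv, inner_toL2, mul_neg, integral_neg]

theorem isWeakDeriv_toL2 (hφ : IsTest φ) (ζ : Horizontal n) :
    IsWeakDeriv (field ζ) hφ.toL2 (hφ.along ζ).toL2 := by
  intro ψ hψ
  calc ∫ p, (hφ.along ζ).toL2 p * ψ p
      = ∫ p, along (field ζ) φ p * ψ p :=
        integral_congr_ae ((hφ.along ζ).memLp.coeFn_toLp.mul .rfl)
    _ = ∫ p, φ p * -along (field ζ) ψ p := by
        simp only [integral_along_mul hφ hψ.1, mul_neg, integral_neg]
    _ = ∫ p, hφ.toL2 p * -along (field ζ) ψ p :=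
        integral_congr_ae (hφ.memLp.coeFn_toLp.symm.mul .rfl)

theorem IsWeakDeriv.add (h : IsWeakDeriv (field ζ) v w) (h' : IsWeakDeriv (field ζ) v' w') :
    IsWeakDeriv (field ζ) (v + v') (w + w') := by
  rw [isWeakDeriv_iff_inner] at *
  intro φ hφ
  rw [inner_add_left, inner_add_left, h φ hφ, h' φ hφ, neg_add]

theorem IsWeakDeriv.const_smul (h : IsWeakDeriv (field ζ) v w) (c : ℝ) :
    IsWeakDeriv (field ζ) (c • v) (c • w) := by
  rw [isWeakDeriv_iff_inner] at *
  intro φ hφ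
  rw [real_inner_smul_left, real_inner_smul_left, h φ hφ, mul_neg]

theorem isWeakDeriv_zero (ζ : Horizontal n) : IsWeakDeriv (field ζ) (0 : L2 n) 0 :=
  isWeakDeriv_iff_inner.2 fun φ hφ => by rw [inner_zero_left, inner_zero_left, neg_zero]

theorem isClosed_isWeakDeriv (ζ : Horizontal n) :
    IsClosed {x : L2 n × L2 n | IsWeakDeriv (field ζ) x.1 x.2} := by
  simp only [isWeakDeriv_iff_inner, ofPred_forall]
  exact isClosed_iInter fun φ => isClosed_iInter fun hφ =>
    isClosed_eq (by fun_prop) (by fun_prop)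

theorem hasDerivAt_inner_rightTranslate (v : L2 n) (hφ : IsTest φ) (ζ : Horizontal n) (s : ℝ) :
    HasDerivAt (fun s : ℝ => ⟪v, rightTranslate (s • horizontal ζ) hφ.toL2⟫)
      ⟪v, rightTranslate (s • horizontal ζ) (hφ.along ζ).toL2⟫ s := by
  simp only [rightTranslate_toL2, inner_toL2]
  exact hasDerivAt_integral_comp_mul_smul (locallyIntegrable_L2 v) hφ ζ s

theorem IsWeakDeriv.inner_rightTranslate_along (h : IsWeakDeriv (field ζ) v w) (hφ : IsTest φ)
    (s : ℝ) : ⟪v, rightTranslate (s • horizontal ζ) (hφ.along ζ).toL2⟫ =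
      -⟪w, rightTranslate (s • horizontal ζ) hφ.toL2⟫ := by
  rw [rightTranslate_toL2, rightTranslate_toL2, isWeakDeriv_iff_inner.1 h, neg_neg]
  simp only [inner_toL2, along_comp_mul_smul hφ.1]

theorem IsWeakDeriv.norm_rightTranslate_sub_le (h : IsWeakDeriv (field ζ) v w) (s : ℝ) :
    ‖rightTranslate (s • horizontal ζ) v - v‖ ≤ |s| * ‖w‖ := by
  refine norm_le_of_inner_toL2_le (by positivity) fun φ hφ => ?_
  have h_mvt := convex_univ.norm_image_sub_le_of_norm_hasDerivWithin_le
    (C := ‖w‖ * ‖hφ.toL2‖)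
    (fun t _ => (hasDerivAt_inner_rightTranslate v hφ ζ t).hasDerivWithinAt)
    (fun t _ => by
      rw [h.inner_rightTranslate_along, norm_neg]
      exact (norm_inner_le_norm _ _).trans_eq (by rw [LinearIsometry.norm_map]))
    (mem_univ 0) (mem_univ (-s))
  calc ⟪rightTranslate (s • horizontal ζ) v - v, hφ.toL2⟫
      = ⟪v, rightTranslate (-s • horizontal ζ) hφ.toL2⟫ -
          ⟪v, rightTranslate ((0 : ℝ) • horizontal ζ) hφ.toL2⟫ := by
        rw [inner_sub_left, inner_rightTranslate_left, neg_smul, zero_smul, rightTranslate_zero]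
    _ ≤ ‖w‖ * ‖hφ.toL2‖ * ‖-s - 0‖ := (le_abs_self _).trans h_mvt
    _ = |s| * ‖w‖ * ‖hφ.toL2‖ := by rw [sub_zero, norm_neg, Real.norm_eq_abs]; ring

-- The difference quotients are bounded in `L²`, and any weak limit point is the derivative.
theorem exists_isWeakDeriv_of_norm_rightTranslate_sub_le {K : ℝ}
    (h : ∀ s : ℝ, ‖rightTranslate (s • horizontal ζ) v - v‖ ≤ |s| * K) :
    ∃ w, IsWeakDeriv (field ζ) v w ∧ ‖w‖ ≤ K := by
  have h_bdd (s : ℝ) (hs : s ≠ 0) :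
      ‖-(s⁻¹ • (rightTranslate (-s • horizontal ζ) v - v))‖ ≤ K := by
    rw [norm_neg, norm_smul, norm_inv, inv_mul_le_iff₀ (norm_pos_iff.2 hs), Real.norm_eq_abs,
      ← abs_neg]
    exact h (-s)
  obtain ⟨w, hw, hw_lim⟩ := exists_norm_le_inner_eq_of_tendsto
    (eventually_nhdsWithin_of_forall (a := (0 : ℝ)) (s := {0}ᶜ) h_bdd)
  refine ⟨w, isWeakDeriv_iff_inner.2 fun φ hφ => hw_lim ?_, hw⟩
  have h_slope := (hasDerivAt_inner_rightTranslate v hφ ζ 0).tendsto_slope.neg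
  rw [zero_smul, rightTranslate_zero] at h_slope
  refine h_slope.congr fun s => ?_
  rw [slope_def_module, sub_zero, zero_smul, rightTranslate_zero, inner_neg_left,
    real_inner_smul_left, inner_sub_left, inner_rightTranslate_left, neg_smul, neg_neg, smul_eq_mul]

end WeakDerivative

section Sobolev

/-- The horizontal Sobolev space `H¹`, as the space of all functions `v none` together with their
weak derivatives `v (some (.inl j)) = X_j v`, `v (some (.inr j)) = Y_j v`. -/
def sobolev (n : ℕ) : Submodule ℝ (PiLp 2 fun _ : Option (Fin n ⊕ Fin n) => L2 n) where
  carrier := {v | ∀ i, IsWeakDeriv (field (coordDir i)) (v none) (v (some i))}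
  add_mem' h h' i := (h i).add (h' i)
  zero_mem' _ := isWeakDeriv_zero _
  smul_mem' c _ h i := (h i).const_smul c

theorem isClosed_sobolev :
    IsClosed (sobolev n : Set (PiLp 2 fun _ : Option (Fin n ⊕ Fin n) => L2 n)) := by
  have h_inter : (sobolev n : Set (PiLp 2 fun _ : Option (Fin n ⊕ Fin n) => L2 n)) =
      ⋂ i, (fun v => (v none, v (some i))) ⁻¹'
        {x : L2 n × L2 n | IsWeakDeriv (field (coordDir i)) x.1 x.2} := by
    ext v
    simp [sobolev]
  rw [h_inter]
  exact isClosed_iInter fun i => (isClosed_isWeakDeriv _).preimage (by fun_prop)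

instance : CompleteSpace (sobolev n) := isClosed_sobolev.completeSpace_coe

/-- The embedding of the Sobolev space into `L²`. -/
def sobolevEmb (n : ℕ) : sobolev n →L[ℝ] L2 n :=
  PiLp.proj 2 (fun _ : Option (Fin n ⊕ Fin n) => L2 n) none ∘L (sobolev n).subtypeL

theorem inner_sobolev (v w : sobolev n) : ⟪v, w⟫ =
    ⟪sobolevEmb n v, sobolevEmb n w⟫ + ∑ i, ⟪v.1 (some i), w.1 (some i)⟫ := by
  rw [Submodule.coe_inner, PiLp.inner_apply, Fintype.sum_option]
  rfl

theorem norm_sobolev_sq (v : sobolev n) :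
    ‖v‖ ^ 2 = ‖sobolevEmb n v‖ ^ 2 + ∑ i, ‖v.1 (some i)‖ ^ 2 := by
  simp only [← real_inner_self_eq_norm_sq, inner_sobolev]

theorem norm_sobolevEmb_le_one : ‖sobolevEmb n‖ ≤ 1 := by
  refine ContinuousLinearMap.opNorm_le_bound _ zero_le_one fun v => ?_
  rw [one_mul]
  refine le_of_sq_le_sq ?_ (norm_nonneg v)
  rw [norm_sobolev_sq]
  exact le_add_of_nonneg_right (Finset.sum_nonneg fun _ _ => sq_nonneg _)

theorem injective_sobolevEmb : Function.Injective (sobolevEmb n) := by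
  intro v w h
  refine Subtype.ext (PiLp.ext fun i => ?_)
  cases i with
  | none => exact h
  | some i =>
    have h_eq : v.1 none = w.1 none := h
    exact (v.2 i).unique (h_eq ▸ w.2 i)

/-- An `L²` function and its weak derivatives, as an element of the Sobolev space. -/
def sobolevMk (v : L2 n) (w : Fin n ⊕ Fin n → L2 n)
    (h : ∀ i, IsWeakDeriv (field (coordDir i)) v (w i)) : sobolev n :=
  ⟨WithLp.toLp 2 fun o => o.elim v w, h⟩

/-- A test function as an element of the Sobolev space. -/
def IsTest.toSobolev {φ : H n → ℝ} (hφ : IsTest φ) : sobolev n :=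
  sobolevMk hφ.toL2 (fun i => (hφ.along (coordDir i)).toL2) fun _ => isWeakDeriv_toL2 hφ _

theorem inner_toSobolev (v : sobolev n) {φ : H n → ℝ} (hφ : IsTest φ) : ⟪v, hφ.toSobolev⟫ =
    (∫ p, sobolevEmb n v p * φ p) + ∑ i, ∫ p, v.1 (some i) p * along (field (coordDir i)) φ p := by
  simp only [← inner_toL2 _ hφ, ← inner_toL2 _ (hφ.along _), inner_sobolev]
  rfl

theorem denseRange_sobolevEmb : DenseRange (sobolevEmb n) :=
  dense_toL2.mono (by rintro _ ⟨φ, hφ, rfl⟩; exact ⟨hφ.toSobolev, rfl⟩)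

end Sobolev

/-! ### Density of test functions in the Sobolev space -/

section Mollification

variable {ρ : H n → ℝ} {v : H n → ℝ}

theorem IsTest.integrable {φ : H n → ℝ} (hφ : IsTest φ) : Integrable φ :=
  hφ.continuous.integrable_of_hasCompactSupport hφ.2

theorem IsTest.comp_neg {φ : H n → ℝ} (hφ : IsTest φ) : IsTest fun p => φ (-p) :=
  ⟨hφ.1.comp contDiff_neg, hφ.2.comp_homeomorph (Homeomorph.neg (H n))⟩

theorem IsTest.comp_mul_neg {φ : H n → ℝ} (hφ : IsTest φ) (p : H n) :
    IsTest fun q => φ (mul p (-q)) :=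
  ⟨hφ.1.comp (contDiff_mul.comp (contDiff_const.prodMk contDiff_neg)),
    hφ.2.comp_homeomorph ((Homeomorph.neg (H n)).trans (mulLeftHomeo p))⟩

/-- The group convolution `ρ * v`, which commutes with left-invariant differentiation of `v`. -/
def mollify (ρ v : H n → ℝ) (p : H n) : ℝ := ∫ q, v q * ρ (mul p (-q))

theorem contDiff_mollify (hρ : IsTest ρ) (hv : LocallyIntegrable v) :
    ContDiff ℝ ∞ (mollify ρ v) := by
  rw [contDiff_iff_contDiffAt]
  intro p₀
  set k : Set (H n) :=
    (fun x : H n × H n => mul (-x.1) x.2) '' (Metric.closedBall p₀ 1 ×ˢ tsupport ρ)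
  have hk : IsCompact k := ((isCompact_closedBall p₀ 1).prod hρ.2.isCompact).image
    (continuous_mul.comp (continuous_fst.neg.prodMk continuous_snd))
  have h_support (p x : H n) (hp : p ∈ Metric.ball p₀ 1) (hx : x ∉ k) : ρ (mul p x) = 0 :=
    image_eq_zero_of_notMem_tsupport fun h_mem =>
      hx ⟨(p, mul p x), ⟨Metric.ball_subset_closedBall hp, h_mem⟩, neg_mul_cancel_left p x⟩
  have h_conv := contDiffOn_convolution_right_with_param_comp (𝕜 := ℝ) (n := ⊤) (μ := volume)
    (ContinuousLinearMap.mul ℝ ℝ) (v := fun _ : H n => (0 : H n)) (g := fun p z => ρ (mul p z))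
    contDiffOn_const Metric.isOpen_ball hk h_support hv (hρ.1.comp contDiff_mul).contDiffOn
  refine (h_conv.contDiffAt (Metric.ball_mem_nhds p₀ one_pos)).congr_of_eventuallyEq
    (.of_forall fun p => ?_)
  simp [mollify, convolution]

theorem along_mollify (hρ : IsTest ρ) (hv : LocallyIntegrable v) (ζ : Horizontal n) (p : H n) :
    along (field ζ) (mollify ρ v) p =
      -∫ q, v q * along (field ζ) (fun q => ρ (mul p (-q))) q := by
  have h_left := hasDerivAt_comp_mul_smul
    ((contDiff_mollify hρ hv).differentiable (by simp)) ζ p 0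
  have h_right :=
    (hasDerivAt_integral_comp_mul_smul hv (hρ.comp_mul_neg p) ζ (-0)).scomp 0 (hasDerivAt_neg 0)
  have h_eq : (fun s : ℝ => mollify ρ v (mul p (s • horizontal ζ))) =
      (fun s => ∫ q, v q * ρ (mul p (-mul q (s • horizontal ζ)))) ∘ fun s => -s := by
    funext s
    simp only [mollify, Function.comp_apply, neg_mul_rev, Heisenberg.mul_assoc, neg_smul, neg_neg]
  rw [h_eq] at h_left
  simpa [Heisenberg.mul_zero] using h_left.unique h_right

theorem IsWeakDeriv.along_mollify {ζ : Horizontal n} {v w : L2 n}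
    (h : IsWeakDeriv (field ζ) v w) (hρ : IsTest ρ) :
    along (field ζ) (mollify ρ v) = mollify ρ w := by
  funext p
  rw [Heisenberg.along_mollify hρ (locallyIntegrable_L2 v), mollify, h _ (hρ.comp_mul_neg p)]
  simp only [mul_neg, integral_neg]

theorem sq_integral_mul_le {α : Type*} [MeasurableSpace α] {μ : Measure α} {v φ : α → ℝ}
    (hφ : Integrable φ μ) (hvφ : Integrable (fun x => v x * φ x) μ)
    (hv_sq : Integrable (fun x => v x ^ 2 * |φ x|) μ) :
    (∫ x, v x * φ x ∂μ) ^ 2 ≤ (∫ x, |φ x| ∂μ) * ∫ x, v x ^ 2 * |φ x| ∂μ := by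
  have h_quadratic (c : ℝ) : 0 ≤ (∫ x, |φ x| ∂μ) * (c * c) + (2 * ∫ x, v x * φ x ∂μ) * c +
      ∫ x, v x ^ 2 * |φ x| ∂μ := by
    have h_nonneg (x : α) : 0 ≤ |φ x| * (c * c) + 2 * (v x * φ x) * c + v x ^ 2 * |φ x| := by
      rcases abs_cases (φ x) with ⟨h, _⟩ | ⟨h, _⟩ <;> rw [h] <;>
        nlinarith [mul_nonneg (abs_nonneg (φ x)) (sq_nonneg (c + v x)),
          mul_nonneg (abs_nonneg (φ x)) (sq_nonneg (c - v x))]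
    rw [← integral_const_mul, ← integral_mul_const, ← integral_mul_const,
      ← integral_add (hφ.abs.mul_const _) ((hvφ.const_mul 2).mul_const c),
      ← integral_add (by fun_prop) hv_sq]
    exact integral_nonneg h_nonneg
  have h_discrim := discrim_le_zero h_quadratic
  rw [discrim] at h_discrim
  linarith

theorem integrable_mul_comp_mul_neg (hv : Integrable v) (hρ : Integrable ρ)
    (hρ_cont : Continuous ρ) :
    Integrable fun x : H n × H n => v x.2 * ρ (mul x.1 (-x.2)) := by
  have h_shift (q : H n) : MeasurePreserving fun p => mul p (-q) := measurePreserving_mul_right _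
  have h_meas : AEStronglyMeasurable fun x : H n × H n => v x.2 * ρ (mul x.1 (-x.2)) :=
    hv.aestronglyMeasurable.comp_snd.mul (hρ_cont.comp (continuous_mul.comp
      (continuous_fst.prodMk continuous_snd.neg))).aestronglyMeasurable
  refine (integrable_prod_iff' h_meas).2 ⟨.of_forall fun q => ?_, ?_⟩
  · exact (((h_shift q).integrable_comp hρ.aestronglyMeasurable).2 hρ).const_mul (v q)
  · have h_integral (q : H n) : ∫ p, ‖v q * ρ (mul p (-q))‖ = ‖v q‖ * ∫ p, ‖ρ p‖ := by
      simp only [norm_mul]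
      rw [integral_const_mul, (h_shift q).integral_comp (measurableEmbedding_mul_right _) (‖ρ ·‖)]
    simpa only [h_integral] using hv.norm.mul_const _

theorem integrable_mollify_sq (hρ : IsTest ρ) (v : L2 n) :
    Integrable fun p => mollify ρ v p ^ 2 := by
  have h_prod := integrable_mul_comp_mul_neg (Lp.memLp v).integrable_sq hρ.integrable.abs
    hρ.continuous.abs
  have h_reflect (p : H n) : ∫ q, |ρ (mul p (-q))| = ∫ q, |ρ q| :=
    ((measurePreserving_mul_left p).comp measurePreserving_neg).integral_comp
      ((mulLeftHomeo p).measurableEmbedding.comp (Homeomorph.neg _).measurableEmbedding) (|ρ ·|)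
  refine (h_prod.integral_prod_left.const_mul (∫ q, |ρ q|)).mono'
    ((contDiff_mollify hρ (locallyIntegrable_L2 v)).continuous.pow 2).aestronglyMeasurable ?_
  filter_upwards [h_prod.prod_right_ae] with p hp
  have hρp := hρ.comp_mul_neg p
  rw [Real.norm_of_nonneg (sq_nonneg _), ← h_reflect p]
  exact sq_integral_mul_le hρp.integrable (hρp.integrable_mul (locallyIntegrable_L2 v)) hp

end Mollification

section Cutoff

/-- The automorphic dilations, used to rescale cutoff functions. -/
def dilate (r : ℝ) (p : H n) : H n := (r • p.1, r • p.2.1, r ^ 2 * p.2.2)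

theorem contDiff_dilate (r : ℝ) : ContDiff ℝ ∞ (dilate (n := n) r) := by
  unfold dilate
  fun_prop

theorem dilate_inv_dilate {r : ℝ} (hr : r ≠ 0) (p : H n) : dilate r⁻¹ (dilate r p) = p := by
  simp [dilate, hr, smul_smul]

theorem tendsto_dilate_zero (p : H n) : Tendsto (fun r => dilate r p) (𝓝 0) (𝓝 0) := by
  have h_cont : Continuous fun r : ℝ => dilate r p := by unfold dilate; fun_prop
  exact h_cont.tendsto' 0 0 (by simp [dilate])

theorem dilate_mul_smul_horizontal (r s : ℝ) (ζ : Horizontal n) (p : H n) :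
    dilate r (mul p (s • horizontal ζ)) = mul (dilate r p) ((r * s) • horizontal ζ) := by
  simp only [dilate, mul_eq, horizontal, Prod.smul_mk, smul_add, smul_smul, smul_dotProduct,
    dotProduct_smul, smul_eq_mul, Prod.mk.injEq, true_and]
  ring

theorem along_comp_dilate {φ : H n → ℝ} (hφ : ContDiff ℝ ∞ φ) (r : ℝ) (ζ : Horizontal n)
    (p : H n) :
    along (field ζ) (fun p => φ (dilate r p)) p = r * along (field ζ) φ (dilate r p) := by
  have h_left := hasDerivAt_comp_mul_smul
    ((hφ.comp (contDiff_dilate r)).differentiable (by simp)) ζ p 0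
  have h_right := (hasDerivAt_comp_mul_smul (hφ.differentiable (by simp)) ζ (dilate r p)
    (r * 0)).comp 0 ((hasDerivAt_id (0 : ℝ)).const_mul r)
  simp only [Function.comp_def, dilate_mul_smul_horizontal] at h_left h_right
  simpa [Heisenberg.mul_zero, mul_comm] using h_left.unique h_right

theorem IsTest.comp_dilate {φ : H n → ℝ} (hφ : IsTest φ) {r : ℝ} (hr : r ≠ 0) :
    IsTest fun p => φ (dilate r p) := by
  let e : H n ≃ₜ H n := Homeomorph.mk
    ⟨dilate r, dilate r⁻¹, dilate_inv_dilate hr,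
      fun p => by simpa using dilate_inv_dilate (inv_ne_zero hr) p⟩
    (contDiff_dilate r).continuous (contDiff_dilate r⁻¹).continuous
  exact ⟨hφ.1.comp (contDiff_dilate r), hφ.2.comp_homeomorph e⟩

theorem exists_cutoff (n : ℕ) : ∃ (η : ℝ → H n → ℝ) (S : ℝ), (∀ r ≠ 0, IsTest (η r)) ∧
    (∀ r p, |η r p| ≤ 1) ∧ (∀ p, Tendsto (fun r => η r p) (𝓝 0) (𝓝 1)) ∧
    ∀ r p, ∑ i, along (field (coordDir i)) (η r) p ^ 2 ≤ r ^ 2 * S := by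
  let b : ContDiffBump (0 : H n) := ⟨1, 2, one_pos, one_lt_two⟩
  have hb : IsTest b := ⟨b.contDiff, b.hasCompactSupport⟩
  have h_bdd (i : Fin n ⊕ Fin n) := (hb.along (coordDir i)).2.exists_bound_of_continuous
    (hb.along (coordDir i)).continuous
  choose C hC using h_bdd
  refine ⟨fun r p => b (dilate r p), ∑ i, C i ^ 2, fun r hr => hb.comp_dilate hr,
    fun r p => (abs_of_nonneg b.nonneg).trans_le b.le_one, fun p => ?_, fun r p => ?_⟩
  · exact tendsto_const_nhds.congr' <|
      ((tendsto_dilate_zero p).eventually b.eventuallyEq_one).mono fun r hr => hr.symm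
  · simp only [along_comp_dilate hb.1, mul_pow, ← Finset.mul_sum]
    refine mul_le_mul_of_nonneg_left (Finset.sum_le_sum fun i _ => ?_) (sq_nonneg r)
    exact sq_le_sq.2 ((hC i _).trans (le_abs_self _))

end Cutoff

section Liouville

variable {W η : H n → ℝ}

theorem subLaplacian_eq_sum (φ : H n → ℝ) (p : H n) : subLaplacian φ p =
    ∑ i, along (field (coordDir i)) (along (field (coordDir i)) φ) p := by
  rw [subLaplacian, Fintype.sum_sum_type, Finset.sum_add_distrib]
  simp only [vecX_eq_field, vecY_eq_field]
  rfl

-- Caccioppoli's inequality: integrate `∑ i, Z i (η² W Z i W)`, which is at least the difference.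
theorem integral_cutoff_sq_le (hW : ContDiff ℝ ∞ W) (h_eigen : ∀ p, subLaplacian W p = W p)
    (hη : IsTest η) : ∫ p, (η p * W p) ^ 2 ≤
      ∫ p, W p ^ 2 * ∑ i, along (field (coordDir i)) η p ^ 2 := by
  set Z := fun i : Fin n ⊕ Fin n => field (coordDir i)
  have hG (i) : ContDiff ℝ ∞ (along (Z i) W) := contDiff_along hW _
  have h_test (i) : IsTest fun p => (η p * η p) * (W p * along (Z i) W p) :=
    (hη.mul hη.1).mul (hW.mul (hG i))
  have h_expand (p) : ∑ i, along (Z i) (fun p => (η p * η p) * (W p * along (Z i) W p)) p =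
      (η p * W p) ^ 2 - W p ^ 2 * ∑ i, along (Z i) η p ^ 2 +
        ∑ i, (η p * along (Z i) W p + W p * along (Z i) η p) ^ 2 := by
    have hW' : Differentiable ℝ W := hW.differentiable (by simp)
    have hG' (i) : Differentiable ℝ (along (Z i) W) := (hG i).differentiable (by simp)
    have hηη : Differentiable ℝ fun p => η p * η p := hη.differentiable.mul hη.differentiable
    have h_eigen' := h_eigen p
    rw [subLaplacian_eq_sum] at h_eigen'
    rw [mul_pow, pow_two (W p)]
    nth_rw 2 [← h_eigen']
    simp only [Finset.mul_sum, ← Finset.sum_sub_distrib, ← Finset.sum_add_distrib]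
    refine Finset.sum_congr rfl fun i _ => ?_
    rw [along_mul hηη (hW'.fun_mul (hG' i)), along_mul hη.differentiable hη.differentiable,
      along_mul hW' (hG' i)]
    ring
  have h_zero : ∫ p, ∑ i, along (Z i) (fun p => (η p * η p) * (W p * along (Z i) W p)) p = 0 := by
    rw [integral_finsetSum _ fun i _ => ((h_test i).along _).integrable]
    exact Finset.sum_eq_zero fun i _ => integral_along_eq_zero (h_test i) _
  have h_int_left : Integrable fun p => (η p * W p) ^ 2 := by
    simpa only [pow_two] using ((hη.mul hW).mul (hη.mul hW).1).integrable
  have h_int_right : Integrable fun p => W p ^ 2 * ∑ i, along (Z i) η p ^ 2 := by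
    simp only [Finset.mul_sum]
    refine integrable_finsetSum _ fun i _ => ?_
    simpa only [mul_comm, pow_two] using
      (((hη.along (coordDir i)).mul (hη.along (coordDir i)).1).mul (hW.mul hW)).integrable
  rw [← sub_nonpos, ← integral_sub h_int_left h_int_right, ← h_zero]
  refine integral_mono (h_int_left.sub h_int_right)
    (integrable_finsetSum _ fun i _ => ((h_test i).along _).integrable) fun p => ?_
  rw [h_expand]
  exact le_add_of_nonneg_right (Finset.sum_nonneg fun _ _ => sq_nonneg _)

theorem eq_zero_of_subLaplacian_eq_self (hW : ContDiff ℝ ∞ W)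
    (hW_sq : Integrable fun p => W p ^ 2) (h_eigen : ∀ p, subLaplacian W p = W p) : W = 0 := by
  obtain ⟨η, S, hη, hη_le, hη_lim, hη_deriv⟩ := exists_cutoff n
  have h_le {r : ℝ} (hr : r ≠ 0) :
      ∫ p, (η r p * W p) ^ 2 ≤ r ^ 2 * (S * ∫ p, W p ^ 2) := by
    calc _ ≤ ∫ p, W p ^ 2 * ∑ i, along (field (coordDir i)) (η r) p ^ 2 :=
          integral_cutoff_sq_le hW h_eigen (hη r hr)
      _ ≤ ∫ p, W p ^ 2 * (r ^ 2 * S) :=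
          integral_mono_of_nonneg (.of_forall fun p => by positivity) (hW_sq.mul_const _)
            (.of_forall fun p => mul_le_mul_of_nonneg_left (hη_deriv r p) (sq_nonneg _))
      _ = r ^ 2 * (S * ∫ p, W p ^ 2) := by rw [integral_mul_const]; ring
  have h_lim : Tendsto (fun r => ∫ p, (η r p * W p) ^ 2) (𝓝[≠] 0) (𝓝 (∫ p, W p ^ 2)) := by
    refine tendsto_integral_filter_of_dominated_convergence (fun p => W p ^ 2) ?_ ?_ hW_sq ?_
    · exact eventually_nhdsWithin_of_forall fun r hr =>
        (((hη r hr).continuous.mul hW.continuous).pow 2).aestronglyMeasurable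
    · refine .of_forall fun r => .of_forall fun p => ?_
      rw [Real.norm_of_nonneg (sq_nonneg _), mul_pow]
      exact mul_le_of_le_one_left (sq_nonneg _) ((sq_le_one_iff_abs_le_one _).2 (hη_le r p))
    · refine .of_forall fun p => ?_
      simpa only [one_mul] using
        (((hη_lim p).mono_left nhdsWithin_le_nhds).mul_const (W p)).pow 2
  have h_lim_zero : Tendsto (fun r : ℝ => r ^ 2 * (S * ∫ p, W p ^ 2)) (𝓝[≠] 0) (𝓝 0) := by
    refine Tendsto.mono_left ?_ nhdsWithin_le_nhds
    exact (by fun_prop : Continuous fun r : ℝ => r ^ 2 * (S * ∫ p, W p ^ 2)).tendsto' 0 0 (by simp)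
  have h_nonpos : ∫ p, W p ^ 2 ≤ 0 :=
    le_of_tendsto_of_tendsto h_lim h_lim_zero (eventually_nhdsWithin_of_forall fun r hr => h_le hr)
  have h_ae : (fun p => W p ^ 2) =ᵐ[volume] 0 :=
    (integral_eq_zero_iff_of_nonneg (fun p => sq_nonneg _) hW_sq).1
      (h_nonpos.antisymm (integral_nonneg fun p => sq_nonneg _))
  have h_eq := ((hW.continuous.pow 2).ae_eq_iff_eq volume continuous_const).1 h_ae
  exact funext fun p => pow_eq_zero_iff two_ne_zero |>.1 (congrFun h_eq p)

theorem eq_zero_of_inner_toSobolev {w : sobolev n}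
    (h : ∀ (φ : H n → ℝ) (hφ : IsTest φ), ⟪w, hφ.toSobolev⟫ = 0) : w = 0 := by
  have h_mollify {ρ : H n → ℝ} (hρ : IsTest ρ) : mollify ρ (sobolevEmb n w) = 0 := by
    refine eq_zero_of_subLaplacian_eq_self (contDiff_mollify hρ (locallyIntegrable_L2 _))
      (integrable_mollify_sq hρ _) fun p => ?_
    have h_along (i) : along (field (coordDir i)) (mollify ρ (sobolevEmb n w)) =
        mollify ρ (w.1 (some i)) := (w.2 i).along_mollify hρ
    have h_orth := h _ (hρ.comp_mul_neg p)
    simp only [subLaplacian_eq_sum, h_along, along_mollify hρ (locallyIntegrable_L2 _),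
      Finset.sum_neg_distrib]
    rw [inner_toSobolev] at h_orth
    exact (eq_neg_of_add_eq_zero_left h_orth).symm
  refine injective_sobolevEmb (eq_of_inner_toL2_eq fun φ hφ => ?_)
  have h_zero := congrFun (h_mollify hφ.comp_neg) 0
  simpa [inner_toL2, mollify, Heisenberg.zero_mul] using h_zero

end Liouville

/-! ### The Markov property of the resolvent -/

section Truncation

/-- Truncation of a real number to `[-1, 1]`. -/
def clamp (x : ℝ) : ℝ := max (-1) (min x 1)

theorem lipschitzWith_clamp : LipschitzWith 1 clamp :=
  (LipschitzWith.id.min_const 1).const_max (-1)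

theorem clamp_zero : clamp 0 = 0 := by simp [clamp]

theorem clamp_eq_self {x : ℝ} : clamp x = x ↔ |x| ≤ 1 := by
  rw [clamp, abs_le]
  grind

theorem abs_clamp_le_one (x : ℝ) : |clamp x| ≤ 1 := by
  rw [clamp, abs_le]
  grind

theorem mul_clamp_mul_nonneg {a : ℝ} (ha : 0 ≤ a) (x : ℝ) : 0 ≤ x * clamp (a * x) := by
  rcases le_total 0 x with hx | hx
  · exact mul_nonneg hx (le_max_of_le_right (le_min (mul_nonneg ha hx) zero_le_one))
  · refine mul_nonneg_of_nonpos_of_nonpos hx (max_le (by norm_num) ?_)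
    exact (min_le_left _ _).trans (mul_nonpos_of_nonneg_of_nonpos ha hx)

theorem tendsto_mul_clamp_nat_mul (x : ℝ) :
    Tendsto (fun k : ℕ => x * clamp (k * x)) atTop (𝓝 |x|) := by
  rcases eq_or_ne x 0 with rfl | hx
  · simp
  refine tendsto_const_nhds.congr' ?_
  obtain ⟨N, hN⟩ := exists_nat_gt |x|⁻¹
  filter_upwards [eventually_ge_atTop N] with k hk
  have h_large : 1 ≤ k * |x| := by
    rw [← inv_le_iff_one_le_mul₀ (abs_pos.2 hx)]
    exact hN.le.trans (mod_cast hk)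
  rw [clamp]
  rcases abs_cases x with ⟨h, -⟩ | ⟨h, -⟩ <;> rw [h] at h_large ⊢
  · rw [min_eq_right h_large, max_eq_right (by norm_num), mul_one]
  · rw [max_eq_left ((min_le_left _ _).trans (by linarith)), mul_neg_one]

/-- Truncation of an `L²` function to `[-1, 1]`. -/
def clampL2 (f : L2 n) : L2 n := lipschitzWith_clamp.compLp clamp_zero f

theorem coeFn_clampL2 (f : L2 n) : clampL2 f =ᵐ[volume] fun p => clamp (f p) :=
  lipschitzWith_clamp.coeFn_compLp clamp_zero f

theorem norm_clampL2_sub_le (f g : L2 n) : ‖clampL2 f - clampL2 g‖ ≤ ‖f - g‖ := by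
  have h := lipschitzWith_clamp.norm_compLp_sub_le clamp_zero f g
  rwa [NNReal.coe_one, one_mul] at h

theorem continuous_clampL2 : Continuous (clampL2 (n := n)) :=
  (lipschitzWith_clamp.lipschitzWith_compLp clamp_zero).continuous

theorem rightTranslate_clampL2 (q : H n) (f : L2 n) :
    rightTranslate q (clampL2 f) = clampL2 (rightTranslate q f) := by
  refine Lp.ext ?_
  filter_upwards [coeFn_rightTranslate q (clampL2 f), coeFn_clampL2 (rightTranslate q f),
    coeFn_rightTranslate q f,
    (measurePreserving_mul_right q).quasiMeasurePreserving.ae (coeFn_clampL2 f)] with p h1 h2 h3 h4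
  rw [h1, h2, h3, h4]

/-- The square-integrable functions bounded by `1`. -/
def unitBall (n : ℕ) : Set (L2 n) := {f | ∀ᵐ p, |f p| ≤ 1}

theorem mem_unitBall_iff {f : L2 n} : f ∈ unitBall n ↔ clampL2 f = f := by
  rw [Lp.ext_iff]
  refine eventually_congr (?_ : ∀ᵐ p, |f p| ≤ 1 ↔ clampL2 f p = f p)
  filter_upwards [coeFn_clampL2 f] with p hp
  rw [hp, clamp_eq_self]

theorem clampL2_mem_unitBall (f : L2 n) : clampL2 f ∈ unitBall n := by
  filter_upwards [coeFn_clampL2 f] with p hp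
  rw [hp]
  exact abs_clamp_le_one _

theorem isClosed_unitBall : IsClosed (unitBall n) := by
  have h_fixed : unitBall n = {f | clampL2 f = f} := ext fun _ => mem_unitBall_iff
  exact h_fixed ▸ isClosed_eq continuous_clampL2 continuous_id

theorem convex_unitBall : Convex ℝ (unitBall n) := by
  intro f hf g hg a b ha hb hab
  filter_upwards [hf, hg, Lp.coeFn_add (a • f) (b • g), Lp.coeFn_smul a f, Lp.coeFn_smul b g]
    with p hfp hgp h_add h_smul h_smul'
  rw [h_add, Pi.add_apply, h_smul, h_smul', ← Real.norm_eq_abs, ← mem_closedBall_zero_iff]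
  exact convex_closedBall 0 1 (by simpa using hfp) (by simpa using hgp) ha hb hab

-- Truncation shortens the increments `R_{sζ} v - v`, hence also the weak derivatives.
theorem exists_sobolevEmb_eq_clampL2 (v : sobolev n) : ∃ w : sobolev n,
    sobolevEmb n w = clampL2 (sobolevEmb n v) ∧
      ∑ i, ‖w.1 (some i)‖ ^ 2 ≤ ∑ i, ‖v.1 (some i)‖ ^ 2 := by
  have h_deriv (i : Fin n ⊕ Fin n) : ∃ w,
      IsWeakDeriv (field (coordDir i)) (clampL2 (sobolevEmb n v)) w ∧ ‖w‖ ≤ ‖v.1 (some i)‖ := by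
    refine exists_isWeakDeriv_of_norm_rightTranslate_sub_le fun s => ?_
    rw [rightTranslate_clampL2]
    exact (norm_clampL2_sub_le _ _).trans ((v.2 i).norm_rightTranslate_sub_le s)
  choose w hw h_norm using h_deriv
  refine ⟨sobolevMk _ w hw, rfl, ?_⟩
  gcongr with i
  exact h_norm i

-- `(1 + A)⁻¹ f` minimises `‖∇v‖² + ‖v - f‖²`, and truncating `v` decreases both terms.
theorem mapsTo_resolvent_unitBall :
    MapsTo ⇑(1 - defect (sobolevEmb n)) (unitBall n) (unitBall n) := by
  intro f hf
  set v := (sobolevEmb n).adjoint f with hv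
  have h_resolvent : (1 - defect (sobolevEmb n)) f = sobolevEmb n v := by simp [defect, hv]
  obtain ⟨w, hw, h_grad⟩ := exists_sobolevEmb_eq_clampL2 v
  have h_dist : ‖sobolevEmb n w - f‖ ^ 2 ≤ ‖sobolevEmb n v - f‖ ^ 2 := by
    gcongr
    calc ‖sobolevEmb n w - f‖ = ‖clampL2 (sobolevEmb n v) - clampL2 f‖ := by
          rw [hw, mem_unitBall_iff.1 hf]
      _ ≤ ‖sobolevEmb n v - f‖ := norm_clampL2_sub_le _ _
  have h_inner (u : sobolev n) : ⟪u, v⟫ = ⟪sobolevEmb n u, f⟫ :=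
    ContinuousLinearMap.adjoint_inner_right _ _ _
  have h_eq : ‖w - v‖ ^ 2 ≤ 0 := by
    have h_self := h_inner v
    rw [real_inner_self_eq_norm_sq] at h_self
    rw [norm_sub_sq_real, norm_sub_sq_real] at h_dist
    rw [norm_sub_sq_real, h_inner]
    linarith [norm_sobolev_sq v, norm_sobolev_sq w]
  have h_clamp : w = v := by
    rw [← sub_eq_zero, ← norm_eq_zero]
    exact pow_eq_zero_iff two_ne_zero |>.1 (h_eq.antisymm (sq_nonneg _))
  rw [h_resolvent, ← h_clamp, hw]
  exact clampL2_mem_unitBall _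

theorem heat_apply_mem_unitBall {f : L2 n} (hf : f ∈ unitBall n) {t : ℝ} (ht : 0 ≤ t) :
    heat (defect (sobolevEmb n)) t f ∈ unitBall n :=
  heat_apply_mem convex_unitBall isClosed_unitBall mapsTo_resolvent_unitBall ht hf

theorem inner_le_L1norm {f h : L2 n} (hf : Integrable f) (hh : h ∈ unitBall n) :
    ⟪f, h⟫ ≤ L1norm f := by
  rw [L2.inner_def, L1norm]
  refine integral_mono_ae (L2.integrable_inner f h) hf.abs ?_
  filter_upwards [hh] with p hp
  calc ⟪f p, h p⟫ ≤ |f p| * |h p| := real_inner_le_norm _ _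
    _ ≤ |f p| := mul_le_of_le_one_right (abs_nonneg _) hp

-- Test with the truncations of `k f`, which converge to the sign of `f`.
theorem lintegral_enorm_le_of_inner_le {f : L2 n} {K : ℝ} (h : ∀ g ∈ unitBall n, ⟪f, g⟫ ≤ K) :
    ∫⁻ p, ‖f p‖ₑ ≤ ENNReal.ofReal K := by
  have h_ae : ∀ᵐ p, ∀ k : ℕ,
      ⟪f p, clampL2 ((k : ℝ) • f) p⟫ = f p * clamp (k * f p) := ae_all_iff.2 fun k => by
    filter_upwards [coeFn_clampL2 ((k : ℝ) • f), Lp.coeFn_smul (k : ℝ) f] with p hp hp'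
    rw [hp, hp', Pi.smul_apply, smul_eq_mul, RCLike.inner_apply, RCLike.conj_to_real, mul_comm]
  have h_int (k : ℕ) :
      ∫⁻ p, ENNReal.ofReal ⟪f p, clampL2 ((k : ℝ) • f) p⟫ ≤ ENNReal.ofReal K := by
    rw [← ofReal_integral_eq_lintegral_ofReal (L2.integrable_inner _ _)
      (h_ae.mono fun p hp => (mul_clamp_mul_nonneg k.cast_nonneg _).trans_eq (hp k).symm),
      ← L2.inner_def]
    exact ENNReal.ofReal_le_ofReal (h _ (clampL2_mem_unitBall _))
  calc ∫⁻ p, ‖f p‖ₑ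
      = ∫⁻ p, liminf (fun k : ℕ => ENNReal.ofReal ⟪f p, clampL2 ((k : ℝ) • f) p⟫) atTop := by
        refine lintegral_congr_ae (h_ae.mono fun p hp => ?_)
        simp only [hp, Real.enorm_eq_ofReal_abs]
        exact (ENNReal.tendsto_ofReal (tendsto_mul_clamp_nat_mul (f p))).liminf_eq.symm
    _ ≤ liminf (fun k : ℕ => ∫⁻ p, ENNReal.ofReal ⟪f p, clampL2 ((k : ℝ) • f) p⟫) atTop :=
        lintegral_liminf_le' fun k => (L2.integrable_inner _ _).aemeasurable.ennreal_ofReal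
    _ ≤ ENNReal.ofReal K :=
        (liminf_le_liminf (Eventually.of_forall h_int)).trans_eq (by simp)

end Truncation

/-! ### Nash's inequality -/

section Translation

theorem field_add (ζ η : Horizontal n) (p : H n) : field (ζ + η) p = field ζ p + field η p := by
  ext <;> simp [field, dotProduct_add, add_dotProduct]
  ring

theorem field_smul (c : ℝ) (ζ : Horizontal n) (p : H n) : field (c • ζ) p = c • field ζ p := by
  ext <;> simp [field]
  ring

/-- The horizontal derivatives of a test function, as a linear function of the direction. -/
def IsTest.derivL2 {φ : H n → ℝ} (hφ : IsTest φ) : Horizontal n →ₗ[ℝ] L2 n where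
  toFun ζ := (hφ.along ζ).toL2
  map_add' ζ η := by
    rw [IsTest.toL2, IsTest.toL2, IsTest.toL2, ← MemLp.toLp_add]
    congr 1
    ext p
    simp only [along, field_add, map_add, Pi.add_apply]
  map_smul' c ζ := by
    rw [IsTest.toL2, IsTest.toL2, ← MemLp.toLp_const_smul]
    congr 1
    ext p
    simp only [along, field_smul, map_smul, Pi.smul_apply, RingHom.id_apply]

theorem sum_smul_coordDir (ζ : Horizontal n) : ∑ i, Sum.elim ζ.1 ζ.2 i • coordDir i = ζ := by
  ext j <;> simp [coordDir, Prod.fst_sum, Prod.snd_sum, Pi.single_apply]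

theorem isWeakDeriv_sobolevEmb (v : sobolev n) (ζ : Horizontal n) :
    IsWeakDeriv (field ζ) (sobolevEmb n v) (∑ i, Sum.elim ζ.1 ζ.2 i • v.1 (some i)) := by
  refine isWeakDeriv_iff_inner.2 fun φ hφ => ?_
  have h_coord (i : Fin n ⊕ Fin n) :
      ⟪v.1 (some i), hφ.toL2⟫ = -⟪sobolevEmb n v, hφ.derivL2 (coordDir i)⟫ :=
    isWeakDeriv_iff_inner.1 (v.2 i) φ hφ
  calc ⟪∑ i, Sum.elim ζ.1 ζ.2 i • v.1 (some i), hφ.toL2⟫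
      = -⟪sobolevEmb n v, hφ.derivL2 (∑ i, Sum.elim ζ.1 ζ.2 i • coordDir i)⟫ := by
        simp only [sum_inner, inner_sum, map_sum, map_smul, real_inner_smul_left,
          real_inner_smul_right, h_coord, mul_neg, Finset.sum_neg_distrib]
    _ = -⟪sobolevEmb n v, (hφ.along ζ).toL2⟫ := by rw [sum_smul_coordDir]; rfl

/-- The `L²` norm of the horizontal gradient. -/
def sobolevGrad (v : sobolev n) : ℝ := √(∑ i, ‖v.1 (some i)‖ ^ 2)

theorem sobolevGrad_sq (v : sobolev n) : sobolevGrad v ^ 2 = ‖v‖ ^ 2 - ‖sobolevEmb n v‖ ^ 2 := by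
  rw [sobolevGrad, Real.sq_sqrt (Finset.sum_nonneg fun _ _ => sq_nonneg _), norm_sobolev_sq]
  ring

theorem sobolevGrad_nonneg (v : sobolev n) : 0 ≤ sobolevGrad v := Real.sqrt_nonneg _

theorem norm_le_sobolevGrad (v : sobolev n) (i : Fin n ⊕ Fin n) :
    ‖v.1 (some i)‖ ≤ sobolevGrad v :=
  Real.le_sqrt_of_sq_le <| Finset.single_le_sum (f := fun i => ‖v.1 (some i)‖ ^ 2)
    (fun _ _ => sq_nonneg _) (Finset.mem_univ i)

theorem norm_rightTranslate_mul_sub_le (p q : H n) (f : L2 n) :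
    ‖rightTranslate (mul p q) f - f‖ ≤ ‖rightTranslate p f - f‖ + ‖rightTranslate q f - f‖ := by
  calc ‖rightTranslate (mul p q) f - f‖
      = ‖(rightTranslate p f - f) + rightTranslate p (rightTranslate q f - f)‖ := by
        rw [rightTranslate_mul, map_sub]
        abel_nf
    _ ≤ ‖rightTranslate p f - f‖ + ‖rightTranslate q f - f‖ := by
        refine (norm_add_le _ _).trans_eq ?_
        rw [LinearIsometry.norm_map]

theorem norm_rightTranslate_horizontal_sub_le (v : sobolev n) (ζ : Horizontal n) :
    ‖rightTranslate (horizontal ζ) (sobolevEmb n v) - sobolevEmb n v‖ ≤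
      (∑ i, |Sum.elim ζ.1 ζ.2 i|) * sobolevGrad v := by
  have h_unit := (isWeakDeriv_sobolevEmb v ζ).norm_rightTranslate_sub_le 1
  rw [one_smul, abs_one, one_mul] at h_unit
  refine h_unit.trans ((norm_sum_le _ _).trans ?_)
  rw [Finset.sum_mul]
  gcongr with i
  rw [norm_smul, Real.norm_eq_abs]
  gcongr
  exact norm_le_sobolevGrad v i

theorem mul_commutator (j : Fin n) (a : ℝ) :
    mul (mul (a • horizontal (coordDir (.inl j))) (a • horizontal (coordDir (.inr j))))
      (mul (-a • horizontal (coordDir (.inl j))) (-a • horizontal (coordDir (.inr j)))) =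
      ((0, 0, a ^ 2) : H n) := by
  ext <;> simp [mul, horizontal, coordDir, Pi.single_apply]
  ring

-- The central direction is reached along the four sides of a horizontal square.
theorem norm_rightTranslate_center_sub_le (j : Fin n) (v : sobolev n) {a : ℝ} (ha : 0 ≤ a) :
    ‖rightTranslate ((0, 0, a ^ 2) : H n) (sobolevEmb n v) - sobolevEmb n v‖ ≤
      4 * a * sobolevGrad v := by
  have h_side (i : Fin n ⊕ Fin n) (s : ℝ) (hs : |s| = a) :
      ‖rightTranslate (s • horizontal (coordDir i)) (sobolevEmb n v) - sobolevEmb n v‖ ≤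
        a * sobolevGrad v := by
    refine ((v.2 i).norm_rightTranslate_sub_le s).trans ?_
    rw [hs]
    gcongr
    exact norm_le_sobolevGrad v i
  have h_pos : |a| = a := abs_of_nonneg ha
  have h_neg : |-a| = a := by rw [abs_neg, h_pos]
  rw [← mul_commutator j]
  refine ((norm_rightTranslate_mul_sub_le _ _ _).trans (add_le_add
    (norm_rightTranslate_mul_sub_le _ _ _) (norm_rightTranslate_mul_sub_le _ _ _))).trans ?_
  linarith [h_side (.inl j) a h_pos, h_side (.inr j) a h_pos, h_side (.inl j) (-a) h_neg,
    h_side (.inr j) (-a) h_neg]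

/-- A box of size `r`, adapted to the dilations `(x, y, τ) ↦ (r x, r y, r² τ)` of the group. -/
def box (n : ℕ) (r : ℝ) : Set (H n) :=
  Icc 0 (fun _ => r) ×ˢ Icc 0 (fun _ => r) ×ˢ Icc 0 (r ^ 2)

theorem measurableSet_box (r : ℝ) : MeasurableSet (box n r) :=
  measurableSet_Icc.prod (measurableSet_Icc.prod measurableSet_Icc)

theorem volume_box {r : ℝ} (hr : 0 ≤ r) : volume (box n r) = ENNReal.ofReal (r ^ (2 * n + 2)) := by
  rw [box, Measure.volume_eq_prod, Measure.prod_prod, Measure.volume_eq_prod, Measure.prod_prod,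
    Real.volume_Icc_pi, Real.volume_Icc]
  simp only [Pi.zero_apply, sub_zero, Finset.prod_const, Finset.card_univ, Fintype.card_fin]
  rw [← ENNReal.ofReal_pow hr, ← ENNReal.ofReal_mul (by positivity),
    ← ENNReal.ofReal_mul (by positivity)]
  ring_nf

theorem norm_rightTranslate_box_sub_le (hn : 1 ≤ n) (v : sobolev n) {r : ℝ} (hr : 0 ≤ r) {q : H n}
    (hq : q ∈ box n r) : ‖rightTranslate q (sobolevEmb n v) - sobolevEmb n v‖ ≤
      (2 * n + 4) * r * sobolevGrad v := by
  obtain ⟨x, y, τ⟩ := q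
  obtain ⟨⟨hx_nonneg, hx_le⟩, ⟨hy_nonneg, hy_le⟩, hτ_nonneg, hτ_le⟩ := hq
  have h_factor : ((x, y, τ) : H n) = mul (horizontal (x, y)) (0, 0, √τ ^ 2) := by
    rw [Real.sq_sqrt hτ_nonneg]
    ext <;> simp [mul, horizontal]
  have h_coord (i : Fin n ⊕ Fin n) : |Sum.elim x y i| ≤ r := by
    obtain i | i := i
    · exact (abs_of_nonneg (hx_nonneg i)).trans_le (hx_le i)
    · exact (abs_of_nonneg (hy_nonneg i)).trans_le (hy_le i)
  have h_horizontal : ∑ i, |Sum.elim x y i| ≤ 2 * n * r := by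
    refine (Finset.sum_le_card_nsmul _ _ r fun i _ => h_coord i).trans_eq ?_
    rw [nsmul_eq_mul, Finset.card_univ, Fintype.card_sum, Fintype.card_fin]
    push_cast
    ring
  have h_sqrt : √τ ≤ r := Real.sqrt_le_iff.2 ⟨hr, hτ_le⟩
  have h_grad := sobolevGrad_nonneg v
  rw [h_factor]
  calc ‖rightTranslate (mul (horizontal (x, y)) (0, 0, √τ ^ 2)) (sobolevEmb n v) - sobolevEmb n v‖
      ≤ (∑ i, |Sum.elim x y i|) * sobolevGrad v + 4 * √τ * sobolevGrad v :=
        (norm_rightTranslate_mul_sub_le _ _ _).trans <| add_le_add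
          (norm_rightTranslate_horizontal_sub_le v (x, y))
          (norm_rightTranslate_center_sub_le ⟨0, hn⟩ v (Real.sqrt_nonneg τ))
    _ ≤ 2 * n * r * sobolevGrad v + 4 * r * sobolevGrad v := by gcongr
    _ = (2 * n + 4) * r * sobolevGrad v := by ring

end Translation

section Averaging

theorem sub_le_inner_rightTranslate {f : L2 n} {q : H n} {c : ℝ}
    (h : ‖rightTranslate q f - f‖ ≤ c) : ‖f‖ ^ 2 - c ^ 2 / 2 ≤ ⟪f, rightTranslate q f⟫ := by
  have h_sq : ‖rightTranslate q f - f‖ ^ 2 ≤ c ^ 2 := by gcongr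
  rw [norm_sub_sq_real, LinearIsometry.norm_map, real_inner_comm] at h_sq
  linarith

theorem ofReal_inner_rightTranslate_le (f : L2 n) (q : H n) :
    ENNReal.ofReal ⟪f, rightTranslate q f⟫ ≤ ∫⁻ p, ‖f p‖ₑ * ‖f (mul p q)‖ₑ := by
  calc ENNReal.ofReal ⟪f, rightTranslate q f⟫
      ≤ ‖∫ p, ⟪f p, rightTranslate q f p⟫‖ₑ := by
        rw [L2.inner_def]
        exact Real.ofReal_le_enorm _
    _ ≤ ∫⁻ p, ‖⟪f p, rightTranslate q f p⟫‖ₑ := enorm_integral_le_lintegral_enorm _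
    _ = ∫⁻ p, ‖f p‖ₑ * ‖f (mul p q)‖ₑ := by
        refine lintegral_congr_ae ?_
        filter_upwards [coeFn_rightTranslate q f] with p hp
        rw [hp, RCLike.inner_apply, RCLike.conj_to_real, mul_comm, enorm_mul]

theorem lintegral_lintegral_mul_comp_mul {F G : H n → ENNReal} (hF : Measurable F)
    (hG : Measurable G) :
    ∫⁻ q, ∫⁻ p, F p * G (mul p q) = (∫⁻ p, F p) * ∫⁻ p, G p := by
  calc ∫⁻ q, ∫⁻ p, F p * G (mul p q)
      = ∫⁻ p, ∫⁻ q, F p * G (mul p q) := by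
        refine lintegral_lintegral_swap (Measurable.aemeasurable ?_)
        have h_mul : Measurable fun x : H n × H n => mul x.2 x.1 :=
          (continuous_mul.comp continuous_swap).measurable
        exact (hF.comp measurable_snd).mul (hG.comp h_mul)
    _ = ∫⁻ p, F p * ∫⁻ q, G q := by
        refine lintegral_congr fun p => ?_
        have h_left := measurePreserving_mul_left p
        rw [← h_left.lintegral_comp hG]
        exact lintegral_const_mul _ (hG.comp h_left.measurable)
    _ = (∫⁻ p, F p) * ∫⁻ p, G p := lintegral_mul_const _ hF

theorem ofReal_mul_volume_le {f : L2 n} {B : Set (H n)} {c : ℝ} (hB : MeasurableSet B)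
    (h : ∀ q ∈ B, ‖rightTranslate q f - f‖ ≤ c) :
    ENNReal.ofReal (‖f‖ ^ 2 - c ^ 2 / 2) * volume B ≤ (∫⁻ p, ‖f p‖ₑ) ^ 2 := by
  have hf : Measurable fun p => ‖f p‖ₑ := (Lp.stronglyMeasurable f).measurable.enorm
  calc ENNReal.ofReal (‖f‖ ^ 2 - c ^ 2 / 2) * volume B
      = ∫⁻ _ in B, ENNReal.ofReal (‖f‖ ^ 2 - c ^ 2 / 2) := (setLIntegral_const _ _).symm
    _ ≤ ∫⁻ q in B, ∫⁻ p, ‖f p‖ₑ * ‖f (mul p q)‖ₑ := setLIntegral_mono' hB fun q hq =>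
        (ENNReal.ofReal_le_ofReal (sub_le_inner_rightTranslate (h q hq))).trans
          (ofReal_inner_rightTranslate_le f q)
    _ ≤ ∫⁻ q, ∫⁻ p, ‖f p‖ₑ * ‖f (mul p q)‖ₑ := setLIntegral_le_lintegral _ _
    _ = (∫⁻ p, ‖f p‖ₑ) ^ 2 := by rw [lintegral_lintegral_mul_comp_mul hf hf, sq]

theorem norm_sq_sobolevEmb_mul_pow_le (hn : 1 ≤ n) (v : sobolev n) {K s : ℝ} (hK : 0 ≤ K)
    (hs : 0 ≤ s) (hv : ∫⁻ p, ‖sobolevEmb n v p‖ₑ ≤ ENNReal.ofReal K) :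
    ‖sobolevEmb n v‖ ^ 2 * s ^ (n + 1) ≤
      (2 * n + 4) ^ 2 / 2 * s ^ (n + 2) * sobolevGrad v ^ 2 + K ^ 2 := by
  have h_average := (ofReal_mul_volume_le (measurableSet_box √s) fun q hq =>
    norm_rightTranslate_box_sub_le hn v (Real.sqrt_nonneg s) hq).trans (pow_le_pow_left' hv 2)
  rw [volume_box (Real.sqrt_nonneg s), ← ENNReal.ofReal_mul' (by positivity),
    ← ENNReal.ofReal_pow hK, ENNReal.ofReal_le_ofReal_iff (by positivity),
    show 2 * n + 2 = 2 * (n + 1) by ring, pow_mul, mul_pow, mul_pow, Real.sq_sqrt hs] at h_average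
  linear_combination h_average

end Averaging

section HeatDecay

theorem isPositiveContraction_defect_sobolevEmb : IsPositiveContraction (defect (sobolevEmb n)) :=
  isPositiveContraction_defect norm_sobolevEmb_le_one

theorem L1norm_nonneg (f : L2 n) : 0 ≤ L1norm f := integral_nonneg fun _ => abs_nonneg _

theorem lintegral_enorm_le_L1norm {f : L2 n} (hf : Integrable f) :
    ∫⁻ p, ‖f p‖ₑ ≤ ENNReal.ofReal (L1norm f) :=
  lintegral_enorm_le_of_inner_le fun _ hg => inner_le_L1norm hf hg

theorem lintegral_enorm_resolvent_heat_le {f : L2 n} (hf : Integrable f) {t : ℝ} (ht : 0 ≤ t) :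
    ∫⁻ p, ‖(1 - defect (sobolevEmb n)) (heat (defect (sobolevEmb n)) t f) p‖ₑ ≤
      ENNReal.ofReal (L1norm f) := by
  have hD := isPositiveContraction_defect_sobolevEmb (n := n)
  refine lintegral_enorm_le_of_inner_le fun g hg => ?_
  rw [hD.one_sub.isPositive.isSymmetric.apply_clm,
    (ContinuousLinearMap.isSelfAdjoint_iff_isSymmetric.1
      (isSelfAdjoint_heat hD.isSelfAdjoint t)).apply_clm]
  exact inner_le_L1norm hf (heat_apply_mem_unitBall (mapsTo_resolvent_unitBall hg) ht)

theorem sobolevEmb_adjoint_apply (f : L2 n) :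
    sobolevEmb n ((sobolevEmb n).adjoint f) = (1 - defect (sobolevEmb n)) f := by
  simp [defect]

theorem sobolevGrad_adjoint_sq_le (f : L2 n) :
    sobolevGrad ((sobolevEmb n).adjoint f) ^ 2 ≤ ⟪defect (sobolevEmb n) f, f⟫ := by
  have h_norm := inner_defect_apply_self (sobolevEmb n) f
  have h_emb : ‖sobolevEmb n ((sobolevEmb n).adjoint f)‖ ^ 2 =
      ‖f‖ ^ 2 - 2 * ⟪defect (sobolevEmb n) f, f⟫ + ‖defect (sobolevEmb n) f‖ ^ 2 := by
    rw [sobolevEmb_adjoint_apply, sub_apply, one_apply_eq_self, norm_sub_sq_real, real_inner_comm]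
  rw [sobolevGrad_sq, h_emb]
  linarith [sq_nonneg ‖defect (sobolevEmb n) f‖]

theorem norm_sq_mul_pow_le_of_resolvent (hn : 1 ≤ n) {g : L2 n} {K s : ℝ} (hK : 0 ≤ K)
    (hs : 1 ≤ s) (hg : ∫⁻ p, ‖(1 - defect (sobolevEmb n)) g p‖ₑ ≤ ENNReal.ofReal K) :
    ‖g‖ ^ 2 * s ^ (n + 1) ≤
      (2 * n + 5) ^ 2 * (s ^ (n + 2) * ⟪defect (sobolevEmb n) g, g⟫ + K ^ 2) := by
  set D := defect (sobolevEmb n)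
  set v := (sobolevEmb n).adjoint g
  have hs₀ : 0 ≤ s := zero_le_one.trans hs
  have h_emb : sobolevEmb n v = (1 - D) g := sobolevEmb_adjoint_apply g
  have h_defect : ‖D g‖ ^ 2 ≤ ⟪D g, g⟫ :=
    isPositiveContraction_defect_sobolevEmb.norm_sq_apply_le_inner g
  have h_form : 0 ≤ ⟪D g, g⟫ := (sq_nonneg _).trans h_defect
  have h_nash := norm_sq_sobolevEmb_mul_pow_le hn v hK hs₀ (by rwa [h_emb])
  have h_pow : s ^ (n + 1) ≤ s ^ (n + 2) := pow_le_pow_right₀ hs (Nat.le_succ _)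
  have h_split : ‖g‖ ^ 2 ≤ 2 * (‖sobolevEmb n v‖ ^ 2 + ‖D g‖ ^ 2) := by
    calc ‖g‖ ^ 2 = ‖sobolevEmb n v + D g‖ ^ 2 := by simp [h_emb]
      _ ≤ (‖sobolevEmb n v‖ + ‖D g‖) ^ 2 := by gcongr; exact norm_add_le _ _
      _ ≤ 2 * (‖sobolevEmb n v‖ ^ 2 + ‖D g‖ ^ 2) := add_sq_le
  calc ‖g‖ ^ 2 * s ^ (n + 1)
      ≤ 2 * (‖sobolevEmb n v‖ ^ 2 + ‖D g‖ ^ 2) * s ^ (n + 1) := by gcongr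
    _ = 2 * (‖sobolevEmb n v‖ ^ 2 * s ^ (n + 1)) + 2 * (s ^ (n + 1) * ‖D g‖ ^ 2) := by ring
    _ ≤ 2 * ((2 * n + 4) ^ 2 / 2 * s ^ (n + 2) * ⟪D g, g⟫ + K ^ 2) +
          2 * (s ^ (n + 2) * ⟪D g, g⟫) := by
        gcongr
        refine h_nash.trans ?_
        gcongr
        exact sobolevGrad_adjoint_sq_le g
    _ = ((2 * n + 4) ^ 2 + 2) * (s ^ (n + 2) * ⟪D g, g⟫) + 2 * K ^ 2 := by ring
    _ ≤ (2 * n + 5) ^ 2 * (s ^ (n + 2) * ⟪D g, g⟫) + (2 * n + 5) ^ 2 * K ^ 2 := by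
        gcongr <;> nlinarith [(Nat.cast_nonneg n : (0 : ℝ) ≤ n)]
    _ = (2 * n + 5) ^ 2 * (s ^ (n + 2) * ⟪D g, g⟫ + K ^ 2) := by ring

theorem heatForm_mul_pow_le (hn : 1 ≤ n) {f : L2 n} (hf : Integrable f) {t s : ℝ} (ht : 0 ≤ t)
    (hs : 1 ≤ s) : heatForm (defect (sobolevEmb n)) 0 t f * s ^ (n + 1) ≤ (2 * n + 5) ^ 2 *
      (s ^ (n + 2) * heatForm (defect (sobolevEmb n)) 1 t f + L1norm f ^ 2) := by
  have hD := isPositiveContraction_defect_sobolevEmb (n := n)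
  rw [hD.heatForm_eq_heatForm_zero_heat_half 0, hD.heatForm_eq_heatForm_zero_heat_half 1,
    heatForm_zero_zero, heatForm_at_zero, pow_one]
  exact norm_sq_mul_pow_le_of_resolvent hn (L1norm_nonneg f) hs
    (lintegral_enorm_resolvent_heat_le hf (by positivity))

theorem exists_hasHeatDecay_of_integrable (hn : 1 ≤ n) : ∃ C : ℝ, 1 ≤ C ∧ ∀ f : L2 n,
    Integrable f →
      HasHeatDecay (defect (sobolevEmb n)) (n + 1) (C * (‖f‖ ^ 2 + L1norm f ^ 2)) f := by
  set A : ℝ := (2 * n + 5) ^ 2 * ((n + 1 : ℕ) + 1)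
  have hA₀ : 0 ≤ A := by positivity
  refine ⟨(1 + A) ^ (n + 1 + 1), one_le_pow₀ (by linarith), fun f hf t ht => ?_⟩
  calc heatForm (defect (sobolevEmb n)) 0 t f * (1 + t) ^ (n + 1)
      ≤ (1 + A) ^ (n + 1) * (‖f‖ ^ 2 + A * L1norm f ^ 2) :=
        isPositiveContraction_defect_sobolevEmb.hasHeatDecay_of_nash (n + 1) (by positivity)
          (sq_nonneg (L1norm f)) (fun t ht s hs => heatForm_mul_pow_le hn hf ht hs) t ht
    _ ≤ (1 + A) ^ (n + 1) * ((1 + A) * ‖f‖ ^ 2 + (1 + A) * L1norm f ^ 2) := by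
        gcongr
        · exact le_mul_of_one_le_left (sq_nonneg _) (by linarith)
        · linarith
    _ = (1 + A) ^ (n + 1 + 1) * (‖f‖ ^ 2 + L1norm f ^ 2) := by ring

theorem norm_sq_sobolevEmb_le_of_integrable (hn : 1 ≤ n) (v : sobolev n)
    (hv : Integrable (sobolevEmb n v)) :
    ‖sobolevEmb n v‖ ^ 2 ≤
      (2 * n + 4) ^ 2 / 2 * sobolevGrad v ^ 2 + L1norm (sobolevEmb n v) ^ 2 := by
  simpa using norm_sq_sobolevEmb_mul_pow_le hn v (L1norm_nonneg _) zero_le_one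
    (lintegral_enorm_le_L1norm hv)

end HeatDecay

/-! ### Solutions in the energy class -/

section Solution

variable {u₀ u₁ v : L2 n} {u : ℝ → L2 n}

section Lift

theorem isWeakDeriv_weakDeriv {Z : H n → H n} (h : ∃ w, IsWeakDeriv Z v w) :
    IsWeakDeriv Z v (weakDeriv Z v) := by
  rw [weakDeriv, dif_pos h]
  exact h.choose_spec

/-- The horizontal gradient of `v`, indexed as the directions `coordDir`. -/
def horizontalGrad (v : L2 n) : Fin n ⊕ Fin n → L2 n :=
  Sum.elim (fun j => weakDeriv (vecX j) v) (fun j => weakDeriv (vecY j) v)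

theorem MemH1.isWeakDeriv (h : MemH1 v) (i : Fin n ⊕ Fin n) :
    IsWeakDeriv (field (coordDir i)) v (horizontalGrad v i) := by
  obtain j | j := i
  · simpa only [horizontalGrad, coordDir, Sum.elim_inl, vecX_eq_field]
      using isWeakDeriv_weakDeriv (h j).1
  · simpa only [horizontalGrad, coordDir, Sum.elim_inr, vecY_eq_field]
      using isWeakDeriv_weakDeriv (h j).2

open Classical in
/-- The element of the Sobolev space with image `v` in `L²`, or `0` if `v` is not in `H¹`. -/
def sobolevLift (v : L2 n) : sobolev n :=
  if h : MemH1 v then sobolevMk v (horizontalGrad v) h.isWeakDeriv else 0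

theorem sobolevLift_eq (h : MemH1 v) :
    sobolevLift v = sobolevMk v (horizontalGrad v) h.isWeakDeriv := dif_pos h

theorem sobolevEmb_sobolevLift (h : MemH1 v) : sobolevEmb n (sobolevLift v) = v := by
  rw [sobolevLift_eq h]
  rfl

theorem sobolevGrad_sobolevLift (h : MemH1 v) : sobolevGrad (sobolevLift v) = gradNorm v := by
  rw [sobolevLift_eq h, sobolevGrad, gradNorm, Fintype.sum_sum_type, Finset.sum_add_distrib]
  rfl

theorem norm_sobolevLift_sq (h : MemH1 v) : ‖sobolevLift v‖ ^ 2 = ‖v‖ ^ 2 + gradNorm v ^ 2 := by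
  rw [← sobolevGrad_sobolevLift h, sobolevGrad_sq, sobolevEmb_sobolevLift h]
  ring

theorem EnergyClass.continuousOn_sobolevLift (h : EnergyClass u) :
    ContinuousOn (fun t => sobolevLift (u t)) (Ici 0) := by
  rw [Topology.IsInducing.subtypeVal.continuousOn_iff]
  have h_coord : ContinuousOn (fun t => WithLp.toLp 2 fun o : Option (Fin n ⊕ Fin n) =>
      o.elim (u t) (horizontalGrad (u t))) (Ici 0) := by
    refine (PiLp.continuous_toLp 2 _).comp_continuousOn (continuousOn_pi.2 fun o => ?_)
    obtain _ | j | j := o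
    · exact h.diff.continuousOn
    · exact h.contX j
    · exact h.contY j
  refine h_coord.congr fun t ht => ?_
  rw [Function.comp_apply, sobolevLift_eq (h.memH1 t ht)]
  rfl

end Lift

section Equation

theorem integral_mul_subLaplacian (h : MemH1 v) {φ : H n → ℝ} (hφ : IsTest φ) :
    ∫ p, v p * subLaplacian φ p =
      -∑ i, ∫ p, horizontalGrad v i p * along (field (coordDir i)) φ p := by
  simp only [subLaplacian_eq_sum, Finset.mul_sum]
  rw [integral_finsetSum _ fun i _ =>
    ((hφ.along _).along _).integrable_mul (locallyIntegrable_L2 v), ← Finset.sum_neg_distrib]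
  refine Finset.sum_congr rfl fun i _ => ?_
  rw [h.isWeakDeriv i _ (hφ.along _), ← integral_neg]
  simp only [mul_neg, neg_neg]

theorem inner_toSobolev_sobolevLift (h : MemH1 v) {φ : H n → ℝ} (hφ : IsTest φ) :
    ⟪hφ.toSobolev, sobolevLift v⟫ = (∫ p, v p * φ p) - ∫ p, v p * subLaplacian φ p := by
  rw [real_inner_comm, inner_toSobolev, sobolevEmb_sobolevLift h, integral_mul_subLaplacian h hφ,
    sobolevLift_eq h, sub_neg_eq_add]
  rfl

theorem inner_toSobolev_adjoint (f : L2 n) {φ : H n → ℝ} (hφ : IsTest φ) :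
    ⟪hφ.toSobolev, (sobolevEmb n).adjoint f⟫ = ∫ p, f p * φ p := by
  rw [ContinuousLinearMap.adjoint_inner_right, real_inner_comm, ← inner_toL2 f hφ]
  rfl

theorem IsSolution.hasDerivAt_adjoint_dt (h : IsSolution u₀ u₁ u) {t : ℝ} (ht : 0 < t) :
    HasDerivAt (fun t => (sobolevEmb n).adjoint (dt u t))
      (-sobolevLift (u t) + (sobolevEmb n).adjoint (u t) - (sobolevEmb n).adjoint (dt u t)) t := by
  set J := sobolevEmb n
  have h_cont : ContinuousOn
      (fun t => -sobolevLift (u t) + J.adjoint (u t) - J.adjoint (dt u t)) (Ioi 0) :=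
    ((h.energy.continuousOn_sobolevLift.neg.add
      (J.adjoint.continuous.comp_continuousOn h.energy.diff.continuousOn)).sub
      (J.adjoint.continuous.comp_continuousOn h.energy.cont_dt)).mono Ioi_subset_Ici_self
  refine hasDerivAt_of_hasDerivAt_inner (ξ := fun t => J.adjoint (dt u t))
    (S := {s | ∃ φ, ∃ hφ : IsTest φ, s = hφ.toSobolev})
    (fun x hx => eq_zero_of_inner_toSobolev fun φ hφ => hx _ ⟨φ, hφ, rfl⟩) h_cont ?_ ht
  rintro _ ⟨φ, hφ, rfl⟩ t ht
  simp only [inner_sub_right, inner_add_right, inner_neg_right, J, inner_toSobolev_adjoint,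
    inner_toSobolev_sobolevLift (h.energy.memH1 t ht.le)]
  exact (h.equation φ hφ t ht).congr_deriv (by ring)

theorem IsSolution.isDampedWave (h : IsSolution u₀ u₁ u) :
    IsDampedWave (sobolevEmb n) (fun t => sobolevLift (u t)) u (dt u) where
  eq_apply t ht := (sobolevEmb_sobolevLift (h.energy.memH1 t ht)).symm
  continuousOn := h.energy.diff.continuousOn
  continuousOn_velocity := h.energy.cont_dt
  hasDerivAt t ht :=
    (h.energy.diff t ht.le).hasDerivWithinAt.hasDerivAt (Ici_mem_nhds ht)
  hasDerivAt_velocity t ht := by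
    have h_deriv := (sobolevEmb n).hasFDerivAt.comp_hasDerivAt t (h.hasDerivAt_adjoint_dt ht)
    simp only [Function.comp_def, sobolevEmb_adjoint_apply] at h_deriv
    refine h_deriv.congr_deriv ?_
    rw [map_sub, map_add, map_neg, sobolevEmb_sobolevLift (h.energy.memH1 t ht.le),
      sobolevEmb_adjoint_apply, sobolevEmb_adjoint_apply, sub_apply, one_apply_eq_self]
    abel

end Equation

section Decay

theorem le_mul_rpow_mul_of_sq_mul_pow_le {x C M S t : ℝ} (k : ℕ) (hC : C ≤ M ^ 2) (hM : 0 ≤ M)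
    (hS : 0 ≤ S) (ht : 0 ≤ t) (h : x ^ 2 * (1 + t) ^ k ≤ C * S ^ 2) :
    x ≤ M * (1 + t) ^ (-(k / 2 : ℝ)) * S := by
  have h_base : 0 ≤ 1 + t := by positivity
  have h_sq : ((1 + t) ^ (k / 2 : ℝ)) ^ 2 = (1 + t) ^ k := by
    rw [← Real.rpow_natCast, ← Real.rpow_mul h_base, Nat.cast_ofNat,
      div_mul_cancel₀ _ two_ne_zero, Real.rpow_natCast]
  have h_mul : x * (1 + t) ^ (k / 2 : ℝ) ≤ M * S := by
    refine le_of_sq_le_sq ?_ (by positivity)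
    rw [mul_pow, mul_pow, h_sq]
    exact h.trans (by gcongr)
  rw [Real.rpow_neg h_base, mul_right_comm, ← div_eq_mul_inv, le_div_iff₀ (by positivity)]
  exact h_mul

theorem eventually_norm_decay (n a : ℕ) (K : ℝ) : ∀ᶠ M : ℝ in atTop,
    ∀ {u₀ u₁ : L2 n} {u : ℝ → L2 n} {S : ℝ}, IsSolution u₀ u₁ u → 0 ≤ S →
      HasHeatDecay (defect (sobolevEmb n)) a (K * S ^ 2) u₀ →
      HasHeatDecay (defect (sobolevEmb n)) a (K * S ^ 2) u₁ →
      ∀ t, 0 ≤ t → ‖u t‖ ≤ M * (1 + t) ^ (-(a / 2 : ℝ)) * S := by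
  filter_upwards [eventually_ge_atTop 0,
    (tendsto_pow_atTop two_ne_zero).eventually_ge_atTop (18 * 2 ^ a * K)]
    with M hM hM_sq u₀ u₁ u S h hS h₀ h₁ t ht
  rw [← h.init] at h₀
  rw [← h.init_dt] at h₁
  refine le_mul_rpow_mul_of_sq_mul_pow_le a hM_sq hM hS ht ?_
  rw [mul_assoc (18 * 2 ^ a : ℝ)]
  exact h.isDampedWave.norm_sq_mul_le norm_sobolevEmb_le_one h₀ h₁ ht

theorem eventually_gradNorm_decay (n a : ℕ) (K : ℝ) : ∀ᶠ M : ℝ in atTop,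
    ∀ {u₀ u₁ : L2 n} {u : ℝ → L2 n} {S : ℝ}, IsSolution u₀ u₁ u → 0 ≤ S →
      HasHeatDecay (defect (sobolevEmb n)) a (K * S ^ 2) u₀ →
      HasHeatDecay (defect (sobolevEmb n)) a (K * S ^ 2) u₁ →
      ‖u₀‖ ^ 2 + gradNorm u₀ ^ 2 ≤ K * S ^ 2 →
      ∀ t, 0 ≤ t → gradNorm (u t) ≤ M * (1 + t) ^ (-(a / 2 : ℝ) - 1 / 2) * S := by
  obtain ⟨C, -, h_decay⟩ :=
    IsDampedWave.exists_form_decay (sobolevEmb n) norm_sobolevEmb_le_one injective_sobolevEmb a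
  filter_upwards [eventually_ge_atTop 0,
    (tendsto_pow_atTop two_ne_zero).eventually_ge_atTop (C * K)]
    with M hM hM_sq u₀ u₁ u S h hS h₀ h₁ h_energy t ht
  rw [← h.init] at h₀ h_energy
  rw [← h.init_dt] at h₁
  rw [← norm_sobolevLift_sq (h.energy.memH1 0 le_rfl)] at h_energy
  have h_form := h_decay h.isDampedWave h₀ h₁ h_energy ht
  rw [← sobolevGrad_sq, sobolevGrad_sobolevLift (h.energy.memH1 t ht), ← mul_assoc] at h_form
  convert le_mul_rpow_mul_of_sq_mul_pow_le (a + 1) hM_sq hM hS ht h_form using 4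
  push_cast
  ring

theorem eventually_dt_decay (n a : ℕ) (K : ℝ) : ∀ᶠ M : ℝ in atTop,
    ∀ {u₀ u₁ : L2 n} {u : ℝ → L2 n} {S : ℝ}, IsSolution u₀ u₁ u → 0 ≤ S →
      HasHeatDecay (defect (sobolevEmb n)) a (K * S ^ 2) u₀ →
      HasHeatDecay (defect (sobolevEmb n)) a (K * S ^ 2) u₁ →
      ‖u₀‖ ^ 2 + gradNorm u₀ ^ 2 ≤ K * S ^ 2 →
      ∀ t, 0 ≤ t → ‖dt u t‖ ≤ M * (1 + t) ^ (-(a / 2 : ℝ) - 1) * S := by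
  obtain ⟨C, -, h_decay⟩ :=
    IsDampedWave.exists_velocity_decay (sobolevEmb n) norm_sobolevEmb_le_one denseRange_sobolevEmb a
  filter_upwards [eventually_ge_atTop 0,
    (tendsto_pow_atTop two_ne_zero).eventually_ge_atTop (C * K)]
    with M hM hM_sq u₀ u₁ u S h hS h₀ h₁ h_energy t ht
  rw [← h.init] at h₀ h_energy
  rw [← h.init_dt] at h₁
  rw [← norm_sobolevLift_sq (h.energy.memH1 0 le_rfl)] at h_energy
  have h_velocity := h_decay h.isDampedWave h₀ h₁ h_energy ht
  rw [← mul_assoc] at h_velocity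
  convert le_mul_rpow_mul_of_sq_mul_pow_le (a + 2) hM_sq hM hS ht h_velocity using 4
  push_cast
  ring

end Decay

section InitialData

theorem gradNorm_nonneg (v : L2 n) : 0 ≤ gradNorm v := Real.sqrt_nonneg _

theorem eventually_hasHeatDecay (hn : 1 ≤ n) : ∀ᶠ K : ℝ in atTop, ∀ {f : L2 n} {S : ℝ},
    Integrable f → ‖f‖ + L1norm f ≤ S →
      HasHeatDecay (defect (sobolevEmb n)) (n + 1) (K * S ^ 2) f := by
  obtain ⟨C, hC, h_decay⟩ := exists_hasHeatDecay_of_integrable hn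
  filter_upwards [eventually_ge_atTop C] with K hK f S hf hS
  have hK₀ : 0 ≤ K := by linarith
  have h_nonneg := L1norm_nonneg f
  refine (h_decay f hf).mono ?_
  calc C * (‖f‖ ^ 2 + L1norm f ^ 2) ≤ K * (‖f‖ + L1norm f) ^ 2 := by
        gcongr
        nlinarith [mul_nonneg (norm_nonneg f) h_nonneg]
    _ ≤ K * S ^ 2 := by gcongr

theorem MemH1.norm_le (hn : 1 ≤ n) (hv : MemH1 v) (hv' : Integrable v) :
    ‖v‖ ≤ (2 * n + 4) * (gradNorm v + L1norm v) := by
  have h_nash := norm_sq_sobolevEmb_le_of_integrable hn (sobolevLift v)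
    (by rwa [sobolevEmb_sobolevLift hv])
  rw [sobolevEmb_sobolevLift hv, sobolevGrad_sobolevLift hv] at h_nash
  have h_grad := gradNorm_nonneg v
  have h_L1 := L1norm_nonneg v
  refine le_of_sq_le_sq (h_nash.trans ?_) (by positivity)
  have h_one : (1 : ℝ) ≤ (2 * n + 4) ^ 2 := one_le_pow₀ (by linarith [n.cast_nonneg (α := ℝ)])
  calc (2 * n + 4 : ℝ) ^ 2 / 2 * gradNorm v ^ 2 + L1norm v ^ 2
      ≤ (2 * n + 4) ^ 2 * gradNorm v ^ 2 + (2 * n + 4) ^ 2 * L1norm v ^ 2 := by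
        gcongr
        · exact half_le_self (by positivity)
        · exact le_mul_of_one_le_left (by positivity) h_one
    _ ≤ ((2 * n + 4) * (gradNorm v + L1norm v)) ^ 2 := by
        rw [mul_pow, ← mul_add]
        gcongr
        nlinarith [mul_nonneg h_grad h_L1]

theorem eventually_hasHeatDecay_of_memH1 (hn : 1 ≤ n) : ∀ᶠ K : ℝ in atTop,
    ∀ {v : L2 n} {S : ℝ}, MemH1 v → Integrable v → gradNorm v + L1norm v ≤ S →
      HasHeatDecay (defect (sobolevEmb n)) (n + 1) (K * S ^ 2) v ∧
        ‖v‖ ^ 2 + gradNorm v ^ 2 ≤ K * S ^ 2 := by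
  set A : ℝ := 2 * n + 5
  have hA : 0 < A ^ 2 := by positivity
  filter_upwards [(tendsto_id.atTop_div_const hA).eventually (eventually_hasHeatDecay hn),
    eventually_ge_atTop (A ^ 2)] with K h_decay hK v S hv hv' hS
  have h_norm := hv.norm_le hn hv'
  have h_grad := gradNorm_nonneg v
  have h_L1 := L1norm_nonneg v
  have h_mul : (2 * n + 4) * (gradNorm v + L1norm v) ≤ (2 * n + 4) * S := by gcongr
  have h_le : ‖v‖ + gradNorm v ≤ A * S := by grind
  constructor
  · have h := h_decay (S := A * S) hv' (by grind)
    rwa [id, mul_pow, ← mul_assoc, div_mul_cancel₀ _ hA.ne'] at h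
  · calc ‖v‖ ^ 2 + gradNorm v ^ 2 ≤ (‖v‖ + gradNorm v) ^ 2 := by
          nlinarith [mul_nonneg (norm_nonneg v) h_grad]
      _ ≤ (A * S) ^ 2 := by gcongr
      _ ≤ K * S ^ 2 := by rw [mul_pow]; gcongr

end InitialData

section Bounds

theorem eventually_bounds (n : ℕ) : ∀ᶠ M : ℝ in atTop,
    ∀ {u₀ u₁ : L2 n} {u : ℝ → L2 n}, IsSolution u₀ u₁ u → ∀ t : ℝ, 0 ≤ t →
      ‖u t‖ ≤ M * (‖u₀‖ + ‖u₁‖) ∧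
      gradNorm (u t) ≤ M * (1 + t) ^ (-(1 / 2) : ℝ) * (‖u₀‖ + gradNorm u₀ + ‖u₁‖) ∧
      ‖dt u t‖ ≤ M * (1 + t) ^ (-1 : ℝ) * (‖u₀‖ + gradNorm u₀ + ‖u₁‖) := by
  have h_decay {f : L2 n} {S : ℝ} (hf : ‖f‖ ≤ S) :
      HasHeatDecay (defect (sobolevEmb n)) 0 (1 * S ^ 2) f :=
    hasHeatDecay_zero isPositiveContraction_defect_sobolevEmb (by rw [one_mul]; gcongr)
  filter_upwards [eventually_norm_decay n 0 1, eventually_gradNorm_decay n 0 1,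
    eventually_dt_decay n 0 1] with M h_norm h_gradNorm h_dt u₀ u₁ u h t ht
  simp only [Nat.cast_zero, zero_div, neg_zero, zero_sub, Real.rpow_zero, mul_one]
    at h_norm h_gradNorm h_dt
  have hu₀ := norm_nonneg u₀
  have hu₁ := norm_nonneg u₁
  have hg₀ := gradNorm_nonneg u₀
  have h_energy : ‖u₀‖ ^ 2 + gradNorm u₀ ^ 2 ≤ 1 * (‖u₀‖ + gradNorm u₀ + ‖u₁‖) ^ 2 := by
    nlinarith [mul_nonneg hu₀ hg₀, mul_nonneg (add_nonneg hu₀ hg₀) hu₁]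
  refine ⟨h_norm h (by positivity) (h_decay ?_) (h_decay ?_) t ht,
    h_gradNorm h (by positivity) (h_decay ?_) (h_decay ?_) h_energy t ht,
    h_dt h (by positivity) (h_decay ?_) (h_decay ?_) h_energy t ht⟩ <;> linarith

theorem Q_div_four (n : ℕ) : Q n / 4 = ((n + 1 : ℕ) / 2 : ℝ) := by
  rw [Q]
  push_cast
  ring

theorem eventually_bounds_of_integrable (hn : 1 ≤ n) : ∀ᶠ M : ℝ in atTop,
    ∀ {u₀ u₁ : L2 n} {u : ℝ → L2 n}, IsSolution u₀ u₁ u → Integrable u₀ → Integrable u₁ →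
      ∀ t : ℝ, 0 ≤ t →
        ‖u t‖ ≤ M * (1 + t) ^ (-(Q n / 4)) * (L1norm u₀ + ‖u₀‖ + L1norm u₁ + ‖u₁‖) ∧
        gradNorm (u t) ≤ M * (1 + t) ^ (-(Q n / 4) - 1 / 2) *
          (L1norm u₀ + gradNorm u₀ + L1norm u₁ + ‖u₁‖) ∧
        ‖dt u t‖ ≤ M * (1 + t) ^ (-(Q n / 4) - 1) *
          (L1norm u₀ + gradNorm u₀ + L1norm u₁ + ‖u₁‖) := by
  obtain ⟨K, h_decay, h_decay_memH1⟩ :=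
    ((eventually_hasHeatDecay hn).and (eventually_hasHeatDecay_of_memH1 hn)).exists
  simp only [Q_div_four]
  filter_upwards [eventually_norm_decay n (n + 1) K, eventually_gradNorm_decay n (n + 1) K,
    eventually_dt_decay n (n + 1) K] with M h_norm h_gradNorm h_dt u₀ u₁ u h hu₀ hu₁ t ht
  have h_memH1 : MemH1 u₀ := h.init ▸ h.energy.memH1 0 le_rfl
  have h_grad := gradNorm_nonneg u₀
  have h_L1₀ := L1norm_nonneg u₀
  have h_L1₁ := L1norm_nonneg u₁
  have h_norm₀ := norm_nonneg u₀
  have h_norm₁ := norm_nonneg u₁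
  obtain ⟨h_decay₀, h_energy⟩ := h_decay_memH1 (S := L1norm u₀ + gradNorm u₀ + L1norm u₁ + ‖u₁‖)
    h_memH1 hu₀ (by linarith)
  have h_decay₁ := h_decay (S := L1norm u₀ + gradNorm u₀ + L1norm u₁ + ‖u₁‖) hu₁ (by linarith)
  exact ⟨h_norm h (by positivity) (h_decay hu₀ (by linarith)) (h_decay hu₁ (by linarith)) t ht,
    h_gradNorm h (by positivity) h_decay₀ h_decay₁ h_energy t ht,
    h_dt h (by positivity) h_decay₀ h_decay₁ h_energy t ht⟩

end Bounds

end Solution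

end Heisenberg

end

theorem theorem1 (n : ℕ) (hn : 1 ≤ n) :
    ∃ C : ℝ, 0 < C ∧
      ∀ (u₀ u₁ : Heisenberg.L2 n) (u : ℝ → Heisenberg.L2 n),
        Heisenberg.MemH1 u₀ → Heisenberg.IsSolution u₀ u₁ u →
          (∀ t : ℝ, 0 ≤ t →
            ‖u t‖ ≤ C * (‖u₀‖ + ‖u₁‖) ∧
            Heisenberg.gradNorm (u t) ≤
              C * (1 + t) ^ (-(1 / 2) : ℝ) * (‖u₀‖ + Heisenberg.gradNorm u₀ + ‖u₁‖) ∧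
            ‖Heisenberg.dt u t‖ ≤
              C * (1 + t) ^ (-1 : ℝ) * (‖u₀‖ + Heisenberg.gradNorm u₀ + ‖u₁‖)) ∧
          (MeasureTheory.Integrable u₀ MeasureTheory.volume →
            MeasureTheory.Integrable u₁ MeasureTheory.volume →
            ∀ t : ℝ, 0 ≤ t →
              ‖u t‖ ≤ C * (1 + t) ^ (-(Heisenberg.Q n / 4)) *
                (Heisenberg.L1norm u₀ + ‖u₀‖ + Heisenberg.L1norm u₁ + ‖u₁‖) ∧
              Heisenberg.gradNorm (u t) ≤ C * (1 + t) ^ (-(Heisenberg.Q n / 4) - 1 / 2) *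
                (Heisenberg.L1norm u₀ + Heisenberg.gradNorm u₀ +
                  Heisenberg.L1norm u₁ + ‖u₁‖) ∧
              ‖Heisenberg.dt u t‖ ≤ C * (1 + t) ^ (-(Heisenberg.Q n / 4) - 1) *
                (Heisenberg.L1norm u₀ + Heisenberg.gradNorm u₀ +
                  Heisenberg.L1norm u₁ + ‖u₁‖)) := by
  obtain ⟨C, hC, h_bounds, h_bounds_of_integrable⟩ := ((Filter.eventually_gt_atTop 0).and
    ((Heisenberg.eventually_bounds n).and (Heisenberg.eventually_bounds_of_integrable hn))).exists
  exact ⟨C, hC, fun u₀ u₁ u _ h => ⟨h_bounds h, h_bounds_of_integrable h⟩⟩
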